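/- Let $\mathcal A$ be a unital $C^\ast$-algebra (for instance the von Neumann algebra of a non-commutative probability space $(\mathcal A,\varphi)$), let $T>0$ and $\gamma>\frac13$, and let $X:[0,T]\to\mathcal A$ be a $\gamma$-Hölder path of self-adjoint elements. Let $\mathcal A_t$ be the closed unital subalgebra of $\mathcal A$ generated by $\{X_s\}_{s\in[0,t]}$, and let $\hat\otimes$ be the projective tensor product. Write $(\delta g)_{st}=g_t-g_s$ and $(\delta h)_{sut}=h_{st}-h_{su}-h_{ut}$, and $$(a\otimes b)\sharp x=axb,\quad x\sharp(a\otimes b\otimes c)=(axb)\otimes c,\quad (a\otimes b\otimes c)\sharp x=a\otimes(bxc),\quad (a\otimes b)^\ast=b^\ast\otimes a^\ast.$$ *Hölder spaces.* $\mathcal C_1^\kappa(V)$ is the space of continuous $g:[0,T]\to V$ with $\sup_{s<t}\|g_t-g_s\|/|t-s|^\kappa<\infty$, and $\mathcal C_2^\kappa(V)$ the space of continuous $h$ on $\{0\le s\le t\le T\}$, zero on the diagonal, with $\sup_{s<t}\|h_{st}\|/|t-s|^\kappa<\infty$; convergence in these spaces is meant for these seminorms. $\mathcal C_2^\kappa(\mathcal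 L(\mathcal A_\to))$ is the space of families of bounded operators $\mathbf L_{st}:\mathcal A_s\hat\otimes\mathcal A_s\to\mathcal A_t$, $0\le s<t\le T$, with $$\sup\big\{\|\mathbf L_{st}[\mathbf U]\|\,|t-s|^{-\kappa}\,\|\mathbf U\|^{-1}:\ s<t,\ 0\neq\mathbf U\in\mathcal A_s\hat\otimes\mathcal A_s\big\}<\infty;$$ the same supremum measures the distance of such a family to operators with values in $\mathcal A$. A *product Lévy area* above $X$ is an $\mathbf X\in\mathcal C_2^{2\gamma}(\mathcal L(\mathcal A_\to))$ with $(\delta\mathbf X)_{sut}[\mathbf U]=(\mathbf U\sharp(\delta X)_{su})\cdot(\delta X)_{ut}$ for all $s<u<t$ and $\mathbf U\in\mathcal A_s\hat\otimes\mathcal A_s$. Put $\mathbf X^\ast_{st}[\mathbf U]=\mathbf X_{st}[\mathbf U^\ast]^\ast$. *Functions.* $\mathcal P$ is the space of complex polynomials and $\mathbf F_3$ the class of functions $f(x)=\int_{\mathbb R}e^{\imath x\xi}\mu_f(d\xi)$ with $\mu_f$ a complex measure such that $\int|\xi|^i\,|\mu_f|(d\xi)<\infty$ for $0\le i\le3$.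 For self-adjoint $x$ and $f\in\mathbf F_3$, $f(x)=\int e^{\imath\xi x}\mu_f(d\xi)$, $$\partial f(x)=\int_0^1\!d\alpha\int\imath\xi\,e^{\imath\alpha\xi x}\otimes e^{\imath(1-\alpha)\xi x}\mu_f(d\xi),\qquad \partial^2f(x)=-\iint_{\alpha,\beta\ge0,\,\alpha+\beta\le1}\!d\alpha\,d\beta\int\xi^2\,e^{\imath\alpha\xi x}\otimes e^{\imath\beta\xi x}\otimes e^{\imath(1-\alpha-\beta)\xi x}\mu_f(d\xi),$$ and $\partial x^m=\sum_{i+j=m-1}x^i\otimes x^j$, $\partial^2x^m=\sum_{i+j+l=m-2}x^i\otimes x^j\otimes x^l$, extended linearly to $\mathcal P$. *Rough integrals.* Let $\mathbf U$ be a $\gamma$-Hölder path in $\mathcal A\hat\otimes\mathcal A$ with $\mathbf U_s\in\mathcal A_s\hat\otimes\mathcal A_s$ and $$(\delta\mathbf U)_{st}=(\delta X)_{st}\sharp\mathbb U^1_s+\mathbb U^2_s\sharp(\delta X)_{st}+\mathbf U^\flat_{st},$$ where $\mathbb U^i$ are $\gamma$-Hölder paths in $\mathcal A^{\hat\otimes3}$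 with $\mathbb U^i_s\in\mathcal A_s^{\hat\otimes3}$ and $\mathbf U^\flat\in\mathcal C_2^{2\gamma}(\mathcal A\hat\otimes\mathcal A)$ (an *adapted controlled biprocess*). Its rough integral is $\mathcal J(\mathbf U\sharp dX)=M-\Lambda(\delta M)$, where $$M_{st}=\mathbf U_s\sharp(\delta X)_{st}+[\mathbf X_{st}\times\mathrm{Id}](\mathbb U^1_s)+[\mathrm{Id}\times\mathbf X^\ast_{st}](\mathbb U^2_s)$$ and $\Lambda(\delta M)$ is the unique $R\in\mathcal C_2^{3\gamma}(\mathcal A)$ with $\delta R=\delta M$. The integral $\mathcal J(f(X)\cdot dX\cdot g(X))$ is that of $\mathbf U=f(X)\otimes g(X)$ with $\mathbb U^1=\partial f(X)\otimes g(X)$, $\mathbb U^2=f(X)\otimes\partial g(X)$, and $\mathcal J(\partial f(X)\sharp dX)$ is that of $\mathbf U=\partial f(X)$ with $\mathbb U^1=\mathbb U^2=\partial^2f(X)$. **Proposition.** Let $(D^n)$ be a sequence of partitions of $[0,T]$ with mesh tending to zero, let $X^n$ be the linear interpolation of $X$ along $D^n$, and let $\mathbf X^n_{st}[\mathbf U]=\int_s^t(\mathbf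 U\sharp(\delta X^n)_{su})\cdot dX^n_u$. Assume that there is an $\mathbf X\in\mathcal C_2^{2\gamma}(\mathcal L(\mathcal A_\to))$ such that $X^n\to X$ in $\mathcal C_1^\gamma(\mathcal A)$ and $\mathbf X^n\to\mathbf X$ in $\mathcal C_2^{2\gamma}(\mathcal L(\mathcal A_\to))$. Then: 1. $\mathbf X$ is a product Lévy area above $X$; 2. for all $f,g\in\mathcal P\cup\mathbf F_3$, the path $f(X)\otimes g(X)$ is an adapted controlled biprocess with the above $\mathbb U^1,\mathbb U^2$, its rough integral is well defined, and $\int f(X^n)\cdot dX^n\cdot g(X^n)\to\mathcal J(f(X)\cdot dX\cdot g(X))$ in $\mathcal C_2^\gamma(\mathcal A)$; 3. for all $f\in\mathcal P\cup\mathbf F_3$, the path $\partial f(X)$ is an adapted controlled biprocess with the above $\mathbb U^1,\mathbb U^2$, its rough integral is well defined, and $\int\partial f(X^n_u)\sharp dX^n_u\to\mathcal J(\partial f(X)\sharp dX)$ in $\mathcal C_2^\gamma(\mathcal A)$; moreover, Itô's formula holds: $f(X_t)-f(X_s)=\mathcal J_{st}(\partial f(X)\sharp dX)$ for all $0\le s\le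 t\le T$. -/

import Mathlib

open Set Filter Topology MeasureTheory
open scoped TensorProduct ENNReal

noncomputable section

namespace RoughNC

/-! ### Projective tensor powers -/

/-- The `n`-fold projective tensor power of a normed space `B`: the completion of the algebraic
tensor power `B ⊗ ⋯ ⊗ B` for the projective norm
`‖U‖ = inf {∑ ‖u₁‖ ⋯ ‖uₙ‖ : U = ∑ u₁ ⊗ ⋯ ⊗ uₙ}` (the norm that Mathlib puts on `⨂[ℂ] i, B`). -/
abbrev PTensor (n : ℕ) (B : Type*) [NormedAddCommGroup B] [NormedSpace ℂ B] : Type _ :=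
  UniformSpace.Completion (⨂[ℂ] _ : Fin n, B)

section Tensor

variable {n : ℕ} {B C F : Type*} [NormedAddCommGroup B] [NormedSpace ℂ B]
  [NormedAddCommGroup C] [NormedSpace ℂ C]
  [NormedAddCommGroup F] [NormedSpace ℂ F]

/-- The elementary tensor `b 0 ⊗ ⋯ ⊗ b (n - 1)`. -/
def tmul (b : Fin n → B) : PTensor n B :=
  UniformSpace.Completion.toComplL (𝕜 := ℂ) (PiTensorProduct.tprodL ℂ b)

/-- The continuous linear map on the projective tensor power which a continuous multilinear map
induces. -/
def tlift [CompleteSpace F] (m : ContinuousMultilinearMap ℂ (fun _ : Fin n => B) F) :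
    PTensor n B →L[ℂ] F :=
  ContinuousLinearMap.extend (PiTensorProduct.liftIsometry ℂ (fun _ : Fin n => B) F m)
    (UniformSpace.Completion.toComplL (𝕜 := ℂ))

theorem tlift_tmul [CompleteSpace F] (m : ContinuousMultilinearMap ℂ (fun _ : Fin n => B) F)
    (b : Fin n → B) : tlift m (tmul b) = m b := by
  unfold tlift tmul
  rw [ContinuousLinearMap.extend_eq]
  · simp
  · exact UniformSpace.Completion.denseRange_coe
  · exact UniformSpace.Completion.isUniformInducing_coe _

/-- The elementary tensor as a continuous multilinear map. -/
def tmulL (n : ℕ) (B : Type*) [NormedAddCommGroup B] [NormedSpace ℂ B] :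
    ContinuousMultilinearMap ℂ (fun _ : Fin n => B) (PTensor n B) :=
  (UniformSpace.Completion.toComplL (𝕜 := ℂ)).compContinuousMultilinearMap
    (PiTensorProduct.tprodL ℂ)

theorem tmulL_apply (b : Fin n → B) : tmulL n B b = tmul b := rfl

/-- The map `φ ⊗ ⋯ ⊗ φ` on projective tensor powers. -/
def tmap (n : ℕ) (φ : B →L[ℂ] C) : PTensor n B →L[ℂ] PTensor n C :=
  tlift ((tmulL n C).compContinuousLinearMap fun _ => φ)

theorem tmap_tmul (φ : B →L[ℂ] C) (b : Fin n → B) :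
    tmap n φ (tmul b) = tmul fun i => φ (b i) := by
  simp [tmap, tlift_tmul, tmulL_apply]

theorem fin_two_ne : (0 : Fin 2) ≠ 1 := by decide

theorem fin_three_ne : (0 : Fin 3) ≠ 1 ∧ (0 : Fin 3) ≠ 2 ∧ (1 : Fin 3) ≠ 2 := by decide

theorem fin_two_cases (i : Fin 2) : i = 0 ∨ i = 1 := by revert i; decide

theorem fin_three_cases (i : Fin 3) : i = 0 ∨ i = 1 ∨ i = 2 := by revert i; decide

/-- A continuous map of two variables that is linear in each, as a multilinear map. -/
def mkBilin (q : B → B → F) (h1 : ∀ b, IsLinearMap ℂ fun a => q a b)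
    (h2 : ∀ a, IsLinearMap ℂ (q a)) (hq : Continuous fun p : B × B => q p.1 p.2) :
    ContinuousMultilinearMap ℂ (fun _ : Fin 2 => B) F where
  toFun v := q (v 0) (v 1)
  map_update_add' v i x y := by
    have h01 := fin_two_ne
    obtain rfl | rfl := fin_two_cases i
    · simp only [Function.update_self, Function.update_of_ne h01.symm]
      exact (h1 (v 1)).map_add x y
    · simp only [Function.update_self, Function.update_of_ne h01]
      exact (h2 (v 0)).map_add x y
  map_update_smul' v i c x := by
    have h01 := fin_two_ne
    obtain rfl | rfl := fin_two_cases i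
    · simp only [Function.update_self, Function.update_of_ne h01.symm]
      exact (h1 (v 1)).map_smul c x
    · simp only [Function.update_self, Function.update_of_ne h01]
      exact (h2 (v 0)).map_smul c x
  cont := by
    have h : Continuous fun v : Fin 2 → B => ((v 0, v 1) : B × B) := by fun_prop
    exact hq.comp h

/-- A continuous map of three variables that is linear in each, as a multilinear map. -/
def mkTrilin (q : B → B → B → F) (h1 : ∀ b c, IsLinearMap ℂ fun a => q a b c)
    (h2 : ∀ a c, IsLinearMap ℂ fun b => q a b c) (h3 : ∀ a b, IsLinearMap ℂ (q a b))
    (hq : Continuous fun p : B × B × B => q p.1 p.2.1 p.2.2) :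
    ContinuousMultilinearMap ℂ (fun _ : Fin 3 => B) F where
  toFun v := q (v 0) (v 1) (v 2)
  map_update_add' v i x y := by
    obtain ⟨h01, h02, h12⟩ := fin_three_ne
    obtain rfl | rfl | rfl := fin_three_cases i
    · simp only [Function.update_self, Function.update_of_ne h01.symm,
        Function.update_of_ne h02.symm]
      exact (h1 (v 1) (v 2)).map_add x y
    · simp only [Function.update_self, Function.update_of_ne h01, Function.update_of_ne h12.symm]
      exact (h2 (v 0) (v 2)).map_add x y
    · simp only [Function.update_self, Function.update_of_ne h02, Function.update_of_ne h12]
      exact (h3 (v 0) (v 1)).map_add x y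
  map_update_smul' v i c x := by
    obtain ⟨h01, h02, h12⟩ := fin_three_ne
    obtain rfl | rfl | rfl := fin_three_cases i
    · simp only [Function.update_self, Function.update_of_ne h01.symm,
        Function.update_of_ne h02.symm]
      exact (h1 (v 1) (v 2)).map_smul c x
    · simp only [Function.update_self, Function.update_of_ne h01, Function.update_of_ne h12.symm]
      exact (h2 (v 0) (v 2)).map_smul c x
    · simp only [Function.update_self, Function.update_of_ne h02, Function.update_of_ne h12]
      exact (h3 (v 0) (v 1)).map_smul c x
  cont := by
    have h : Continuous fun v : Fin 3 → B => ((v 0, v 1, v 2) : B × B × B) := by fun_prop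
    exact hq.comp h

theorem isLinearMap_tmulL (n : ℕ) (v : Fin n → B) (i : Fin n) :
    IsLinearMap ℂ fun x => tmulL n B (Function.update v i x) :=
  ⟨(tmulL n B).map_update_add v i, (tmulL n B).map_update_smul v i⟩

theorem lin₂₀ (b : B) : IsLinearMap ℂ fun x => tmulL 2 B ![x, b] := by
  have h : ∀ x : B, Function.update ![0, b] 0 x = ![x, b] := fun x => by
    funext i
    fin_cases i <;> rfl
  simpa only [h] using isLinearMap_tmulL 2 ![0, b] 0

theorem lin₂₁ (a : B) : IsLinearMap ℂ fun x => tmulL 2 B ![a, x] := by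
  have h : ∀ x : B, Function.update ![a, 0] 1 x = ![a, x] := fun x => by
    funext i
    fin_cases i <;> rfl
  simpa only [h] using isLinearMap_tmulL 2 ![a, 0] 1

theorem lin₃₀ (b c : B) : IsLinearMap ℂ fun x => tmulL 3 B ![x, b, c] := by
  have h : ∀ x : B, Function.update ![0, b, c] 0 x = ![x, b, c] := fun x => by
    funext i
    fin_cases i <;> rfl
  simpa only [h] using isLinearMap_tmulL 3 ![0, b, c] 0

theorem lin₃₁ (a c : B) : IsLinearMap ℂ fun x => tmulL 3 B ![a, x, c] := by
  have h : ∀ x : B, Function.update ![a, 0, c] 1 x = ![a, x, c] := fun x => by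
    funext i
    fin_cases i <;> rfl
  simpa only [h] using isLinearMap_tmulL 3 ![a, 0, c] 1

theorem lin₃₂ (a b : B) : IsLinearMap ℂ fun x => tmulL 3 B ![a, b, x] := by
  have h : ∀ x : B, Function.update ![a, b, 0] 2 x = ![a, b, x] := fun x => by
    funext i
    fin_cases i <;> rfl
  simpa only [h] using isLinearMap_tmulL 3 ![a, b, 0] 2

end Tensor

section Algebra

variable {B : Type*} [NormedRing B] [NormedAlgebra ℂ B]

/-- `U ↦ U ♯ x`, where `(a ⊗ b) ♯ x = a x b`. -/
def sharp [CompleteSpace B] (x : B) : PTensor 2 B →L[ℂ] B :=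
  tlift <| mkBilin (fun a b => a * x * b)
    (fun b => ⟨by intros; simp [add_mul], by intros; simp⟩)
    (fun a => ⟨by intros; simp [mul_add], by intros; simp⟩) (by fun_prop)

/-- `𝕌 ↦ x ♯ 𝕌`, where `x ♯ (a ⊗ b ⊗ c) = (a x b) ⊗ c`. -/
def sharpLeft (x : B) : PTensor 3 B →L[ℂ] PTensor 2 B :=
  tlift <| mkTrilin (fun a b c => tmulL 2 B ![a * x * b, c])
    (fun _ c => ⟨fun _ _ => by simpa [add_mul] using (lin₂₀ c).map_add _ _,
      fun _ _ => by simpa using (lin₂₀ c).map_smul _ _⟩)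
    (fun _ c => ⟨fun _ _ => by simpa [mul_add] using (lin₂₀ c).map_add _ _,
      fun _ _ => by simpa using (lin₂₀ c).map_smul _ _⟩)
    (fun a b => lin₂₁ (a * x * b))
    (by
      refine (tmulL 2 B).cont.comp (continuous_pi fun i => ?_)
      fin_cases i <;> simp <;> fun_prop)

/-- `𝕌 ↦ 𝕌 ♯ x`, where `(a ⊗ b ⊗ c) ♯ x = a ⊗ (b x c)`. -/
def sharpRight (x : B) : PTensor 3 B →L[ℂ] PTensor 2 B :=
  tlift <| mkTrilin (fun a b c => tmulL 2 B ![a, b * x * c])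
    (fun b c => lin₂₀ (b * x * c))
    (fun a _ => ⟨fun _ _ => by simpa [add_mul] using (lin₂₁ a).map_add _ _,
      fun _ _ => by simpa using (lin₂₁ a).map_smul _ _⟩)
    (fun a _ => ⟨fun _ _ => by simpa [mul_add] using (lin₂₁ a).map_add _ _,
      fun _ _ => by simpa using (lin₂₁ a).map_smul _ _⟩)
    (by
      refine (tmulL 2 B).cont.comp (continuous_pi fun i => ?_)
      fin_cases i <;> simp <;> fun_prop)

/-- `U ↦ U ⊗ y`. -/
def tensRight (y : B) : PTensor 2 B →L[ℂ] PTensor 3 B :=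
  tlift <| mkBilin (fun a b => tmulL 3 B ![a, b, y]) (fun b => lin₃₀ b y) (fun a => lin₃₁ a y)
    (by
      refine (tmulL 3 B).cont.comp (continuous_pi fun i => ?_)
      fin_cases i <;> simp <;> fun_prop)

/-- `U ↦ y ⊗ U`. -/
def tensLeft (y : B) : PTensor 2 B →L[ℂ] PTensor 3 B :=
  tlift <| mkBilin (fun a b => tmulL 3 B ![y, a, b]) (fun b => lin₃₁ y b) (fun a => lin₃₂ y a)
    (by
      refine (tmulL 3 B).cont.comp (continuous_pi fun i => ?_)
      fin_cases i <;> simp <;> fun_prop)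

theorem sharp_tmul [CompleteSpace B] (x a b : B) : sharp x (tmul ![a, b]) = a * x * b :=
  tlift_tmul _ _

theorem sharpLeft_tmul (x a b c : B) :
    sharpLeft x (tmul ![a, b, c]) = tmul ![a * x * b, c] :=
  tlift_tmul _ _

theorem sharpRight_tmul (x a b c : B) :
    sharpRight x (tmul ![a, b, c]) = tmul ![a, b * x * c] :=
  tlift_tmul _ _

theorem tensRight_tmul (y a b : B) : tensRight y (tmul ![a, b]) = tmul ![a, b, y] :=
  tlift_tmul _ _

theorem tensLeft_tmul (y a b : B) : tensLeft y (tmul ![a, b]) = tmul ![y, a, b] :=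
  tlift_tmul _ _

end Algebra

/-! ### Functional calculus -/

/-- A complex measure `μ = h • ν` on `ℝ` (a measurable density `h` with `|h| ≤ 1` with respect to a
positive measure `ν`; every complex measure is of this form, by polar decomposition) with
`∫ |ξ|^i |μ|(dξ) < ∞` for `i = 0, …, k`. It stands for the function
`f(x) = ∫ exp (i x ξ) μ(dξ)` of the class `𝐅ₖ`. -/
structure FourierFn (k : ℕ) where
  ν : Measure ℝ
  h : ℝ → ℂ
  measurable_h : Measurable h
  norm_h_le : ∀ ξ, ‖h ξ‖ ≤ 1
  moment : ∀ i ≤ k, Integrable (fun ξ : ℝ => |ξ| ^ i) ν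

/-- The functions of `𝒫 ∪ 𝐅ₖ`: a complex polynomial, or a function of `𝐅ₖ`. -/
inductive TestFn (k : ℕ) where
  | poly (p : Polynomial ℂ)
  | fourier (μ : FourierFn k)

namespace TestFn

variable {k : ℕ} {B : Type*} [NormedRing B] [NormedAlgebra ℂ B]

/-- The unitary `exp (i r x)`. -/
def expI (r : ℝ) (x : B) : B := NormedSpace.exp ((Complex.I * (r : ℂ)) • x)

/-- The element `f(x)`. -/
def eval (f : TestFn k) (x : B) : B :=
  match f with
  | poly p => Polynomial.aeval x p
  | fourier μ => ∫ ξ, μ.h ξ • expI ξ x ∂μ.ν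

/-- The tensor derivative `∂f(x)`. -/
def deriv₁ (f : TestFn k) (x : B) : PTensor 2 B :=
  match f with
  | poly p => p.sum fun m a => a • ∑ i ∈ Finset.range m, tmul ![x ^ i, x ^ (m - 1 - i)]
  | fourier μ => ∫ α in (0 : ℝ)..1, ∫ ξ : ℝ,
      (Complex.I * ξ * μ.h ξ) • tmul ![expI (α * ξ) x, expI ((1 - α) * ξ) x] ∂μ.ν

/-- The second tensor derivative `∂²f(x)`. -/
def deriv₂ (f : TestFn k) (x : B) : PTensor 3 B :=
  match f with
  | poly p => p.sum fun m a => a • ∑ i ∈ Finset.range (m - 1), ∑ j ∈ Finset.range (m - 1 - i),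
      tmul ![x ^ i, x ^ j, x ^ (m - 2 - i - j)]
  | fourier μ => -∫ α in (0 : ℝ)..1, ∫ β in (0 : ℝ)..(1 - α), ∫ ξ : ℝ,
      ((ξ : ℂ) ^ 2 * μ.h ξ) •
        tmul ![expI (α * ξ) x, expI (β * ξ) x, expI ((1 - α - β) * ξ) x] ∂μ.ν

end TestFn

/-! ### Hölder spaces -/

section Holder

variable {E : Type*} [NormedAddCommGroup E]

/-- The simplex `{0 ≤ s ≤ t ≤ T}`. -/
def simplex (T : ℝ) : Set (ℝ × ℝ) := {p | 0 ≤ p.1 ∧ p.1 ≤ p.2 ∧ p.2 ≤ T}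

/-- The seminorm `𝒩[h; 𝒞₂^κ] = sup_{0 ≤ s < t ≤ T} ‖h_{st}‖ / (t - s)^κ`, with values in
`[0, ∞]`. -/
def holder₂ (T κ : ℝ) (h : ℝ → ℝ → E) : ℝ≥0∞ :=
  ⨆ (s : ℝ) (t : ℝ) (_ : 0 ≤ s ∧ s < t ∧ t ≤ T), ‖h s t‖ₑ / ENNReal.ofReal ((t - s) ^ κ)

/-- The seminorm `𝒩[g; 𝒞₁^κ]`, the one above for the increments `g_t - g_s`. -/
def holder₁ (T κ : ℝ) (g : ℝ → E) : ℝ≥0∞ := holder₂ T κ fun s t => g t - g s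

/-- `g ∈ 𝒞₁^κ([0, T]; E)`. -/
def MemC₁ (T κ : ℝ) (g : ℝ → E) : Prop :=
  ContinuousOn g (Icc 0 T) ∧ holder₁ T κ g < ∞

/-- `h ∈ 𝒞₂^κ([0, T]; E)`: continuous on the simplex, zero on the diagonal, finite seminorm. -/
def MemC₂ (T κ : ℝ) (h : ℝ → ℝ → E) : Prop :=
  ContinuousOn (Function.uncurry h) (simplex T) ∧ (∀ t ∈ Icc 0 T, h t t = 0) ∧
    holder₂ T κ h < ∞

/-- Convergence in the space `𝒞₂^κ([0, T]; E)`. -/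
def TendstoC₂ (T κ : ℝ) (h : ℕ → ℝ → ℝ → E) (l : ℝ → ℝ → E) : Prop :=
  (∀ n, MemC₂ T κ (h n)) ∧ MemC₂ T κ l ∧
    Tendsto (fun n => holder₂ T κ fun s t => h n s t - l s t) atTop (𝓝 0)

/-- The coboundary `(δh)_{sut} = h_{st} - h_{su} - h_{ut}`. -/
def delta (h : ℝ → ℝ → E) (s u t : ℝ) : E := h s t - h s u - h u t

/-- `R = Λh`: the element `R` of `𝒞₂^μ` such that `δR = h` (for `μ > 1` there is at most one on the
simplex). -/
def IsSewing (T μ : ℝ) (h : ℝ → ℝ → ℝ → E) (R : ℝ → ℝ → E) : Prop :=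
  MemC₂ T μ R ∧ ∀ s u t, 0 ≤ s → s < u → u < t → t ≤ T → delta R s u t = h s u t

open Classical in
/-- The sewing map `Λ`, set to `0` where it is not defined. -/
def sewing (T μ : ℝ) (h : ℝ → ℝ → ℝ → E) : ℝ → ℝ → E :=
  if H : ∃ R, IsSewing T μ h R then H.choose else 0

end Holder

/-! ### The filtration of a process and product Lévy areas -/

section Area

variable {A : Type*} [CStarAlgebra A]

/-- `𝒜_t`: the closed unital (star-)subalgebra generated by the (self-adjoint) elements `X_s`,
`s ∈ [0, t]`. -/
def filt (X : ℝ → A) (t : ℝ) : StarSubalgebra ℂ A :=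
  (StarAlgebra.adjoin ℂ (X '' Icc 0 t)).topologicalClosure

theorem filt_mono (X : ℝ → A) {s t : ℝ} (h : s ≤ t) : filt X s ≤ filt X t :=
  StarSubalgebra.topologicalClosure_mono
    (StarAlgebra.adjoin_mono (image_mono (Icc_subset_Icc_right h)))

theorem mem_filt (X : ℝ → A) {s : ℝ} (hs : 0 ≤ s) : X s ∈ filt X s :=
  StarSubalgebra.le_topologicalClosure _
    (StarAlgebra.subset_adjoin ℂ _ (mem_image_of_mem X ⟨hs, le_rfl⟩))

open Classical in
/-- `X_s` as an element of `𝒜_s` (for `s ≥ 0`). -/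
def filtElem (X : ℝ → A) (s : ℝ) : filt X s :=
  if h : X s ∈ filt X s then ⟨X s, h⟩ else 0

theorem coe_filtElem (X : ℝ → A) {s : ℝ} (hs : 0 ≤ s) : (filtElem X s : A) = X s := by
  simp [filtElem, mem_filt X hs]

/-- The inclusion of a subalgebra as a continuous linear map. -/
def subIncl (S : StarSubalgebra ℂ A) : S →L[ℂ] A where
  toFun x := x
  map_add' _ _ := rfl
  map_smul' _ _ := rfl
  cont := continuous_subtype_val

/-- The inclusion `S ⊆ S'` as a continuous linear map. -/
def subInclLE {S S' : StarSubalgebra ℂ A} (h : S ≤ S') : S →L[ℂ] S' where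
  toFun x := ⟨x, h x.2⟩
  map_add' _ _ := rfl
  map_smul' _ _ := rfl
  cont := continuous_subtype_val.subtype_mk _

/-- The canonical map `𝒜_s^{⊗̂ n} → 𝒜^{⊗̂ n}`. -/
def toAmbient (n : ℕ) (X : ℝ → A) (s : ℝ) : PTensor n (filt X s) →L[ℂ] PTensor n A :=
  tmap n (subIncl (filt X s))

/-- An element of `ℒ(𝒜_→)`: bounded operators `L_{st} : 𝒜_s ⊗̂ 𝒜_s → 𝒜_t`
(only `0 ≤ s < t ≤ T` is relevant). -/
abbrev AreaFamily (X : ℝ → A) : Type _ :=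
  (s t : ℝ) → PTensor 2 (filt X s) →L[ℂ] filt X t

/-- The seminorm `𝒩[L; 𝒞₂^κ(ℒ(𝒜_→))]`, the supremum of `‖L_{st}[U]‖ / ((t - s)^κ ‖U‖)` over
`0 ≤ s < t ≤ T` and `0 ≠ U ∈ 𝒜_s ⊗̂ 𝒜_s`. It is stated for families with values in the whole
algebra, so that it also measures the distance to areas that are not adapted. -/
def holderOp (T κ : ℝ) (X : ℝ → A) (L : (s t : ℝ) → PTensor 2 (filt X s) → A) : ℝ≥0∞ :=
  ⨆ (s : ℝ) (t : ℝ) (_ : 0 ≤ s ∧ s < t ∧ t ≤ T) (U : PTensor 2 (filt X s)) (_ : U ≠ 0),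
    ‖L s t U‖ₑ / (ENNReal.ofReal ((t - s) ^ κ) * ‖U‖ₑ)

/-- A product Lévy area above `X`: a `2γ`-Hölder element of `ℒ(𝒜_→)` with Chen's relation
`(δ𝐗)_{sut}[U] = (U ♯ (δX)_{su}) (δX)_{ut}`. -/
def IsProductLevyArea (T γ : ℝ) (X : ℝ → A) (L : AreaFamily X) : Prop :=
  holderOp T (2 * γ) X (fun s t U => (L s t U : A)) < ∞ ∧
  ∀ (s u t : ℝ) (_ : 0 ≤ s) (hsu : s < u) (_ : u < t) (_ : t ≤ T) (U : PTensor 2 (filt X s)),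
    (L s t U : A) - L s u U - L u t (tmap 2 (subInclLE (filt_mono X hsu.le)) U) =
      sharp (X u - X s) (toAmbient 2 X s U) * (X t - X u)

/-! ### The rough integral -/

/-- `L × Id : a ⊗ b ⊗ c ↦ L[a ⊗ b] c`. -/
def areaTimesId {S : StarSubalgebra ℂ A} (L : PTensor 2 S →L[ℂ] A) : PTensor 3 S →L[ℂ] A :=
  tlift <| mkTrilin (fun a b c => L (tmulL 2 S ![a, b]) * (c : A))
    (fun b c => ⟨fun a a' => by simp [(lin₂₀ b).map_add a a', add_mul],
      fun r a => by simp [(lin₂₀ b).map_smul r a]⟩)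
    (fun a c => ⟨fun b b' => by simp [(lin₂₁ a).map_add b b', add_mul],
      fun r b => by simp [(lin₂₁ a).map_smul r b]⟩)
    (fun a b => ⟨by intros; simp [mul_add], by intros; simp⟩)
    (by
      refine (L.continuous.comp ((tmulL 2 S).cont.comp (continuous_pi fun i => ?_))).mul
        (by fun_prop)
      fin_cases i <;> simp <;> fun_prop)

/-- `Id × L⋆ : a ⊗ b ⊗ c ↦ a L⋆[b ⊗ c]`, where `L⋆[U] = (L[U⋆])⋆` and `(b ⊗ c)⋆ = c⋆ ⊗ b⋆`. -/
def idTimesAreaStar {S : StarSubalgebra ℂ A} (L : PTensor 2 S →L[ℂ] A) : PTensor 3 S →L[ℂ] A :=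
  tlift <| mkTrilin (fun a b c => (a : A) * star (L (tmulL 2 S ![star c, star b])))
    (fun b c => ⟨by intros; simp [add_mul], by intros; simp⟩)
    (fun a c => ⟨fun b b' => by simp [(lin₂₁ (star c)).map_add (star b) (star b'), mul_add],
      fun r b => by simp [(lin₂₁ (star c)).map_smul (starRingEnd ℂ r) (star b)]⟩)
    (fun a b => ⟨fun c c' => by simp [(lin₂₀ (star b)).map_add (star c) (star c'), mul_add],
      fun r c => by simp [(lin₂₀ (star b)).map_smul (starRingEnd ℂ r) (star c)]⟩)
    (by
      refine Continuous.mul (by fun_prop) (Continuous.star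
        (L.continuous.comp ((tmulL 2 S).cont.comp (continuous_pi fun i => ?_))))
      fin_cases i <;> simp <;> fun_prop)

theorem areaTimesId_tmul {S : StarSubalgebra ℂ A} (L : PTensor 2 S →L[ℂ] A) (a b c : S) :
    areaTimesId L (tmul ![a, b, c]) = L (tmul ![a, b]) * (c : A) :=
  tlift_tmul _ _

theorem idTimesAreaStar_tmul {S : StarSubalgebra ℂ A} (L : PTensor 2 S →L[ℂ] A) (a b c : S) :
    idTimesAreaStar L (tmul ![a, b, c]) = (a : A) * star (L (tmul ![star c, star b])) :=
  tlift_tmul _ _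

/-- An adapted controlled biprocess: an adapted biprocess `U`, given with adapted triprocesses
`U1`, `U2` such that `(δU)_{st} = (δX)_{st} ♯ U1_s + U2_s ♯ (δX)_{st} + U♭_{st}`, where `U`, `U1`,
`U2` are `γ`-Hölder and `U♭` is `2γ`-Hölder. -/
def IsControlledBiprocess (T γ : ℝ) (X : ℝ → A) (U : (s : ℝ) → PTensor 2 (filt X s))
    (U1 U2 : (s : ℝ) → PTensor 3 (filt X s)) : Prop :=
  MemC₁ T γ (fun s => toAmbient 2 X s (U s)) ∧
  MemC₁ T γ (fun s => toAmbient 3 X s (U1 s)) ∧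
  MemC₁ T γ (fun s => toAmbient 3 X s (U2 s)) ∧
  MemC₂ T (2 * γ) (fun s t => toAmbient 2 X t (U t) - toAmbient 2 X s (U s)
    - sharpLeft (X t - X s) (toAmbient 3 X s (U1 s))
    - sharpRight (X t - X s) (toAmbient 3 X s (U2 s)))

open Classical in
/-- `M_{st} = U_s ♯ (δX)_{st} + [𝐗_{st} × Id](U1_s) + [Id × 𝐗⋆_{st}](U2_s)` for `s < t`, and
`M_{tt} = 0`. -/
def germ (X : ℝ → A) (L : AreaFamily X) (U : (s : ℝ) → PTensor 2 (filt X s))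
    (U1 U2 : (s : ℝ) → PTensor 3 (filt X s)) (s t : ℝ) : A :=
  if s < t then
    sharp (X t - X s) (toAmbient 2 X s (U s))
      + areaTimesId ((subIncl (filt X t)).comp (L s t)) (U1 s)
      + idTimesAreaStar ((subIncl (filt X t)).comp (L s t)) (U2 s)
  else 0

/-- The rough integral of `U` is well defined: `U` is an adapted controlled biprocess and `Λ(δM)`
exists. -/
def RoughIntegrable (T γ : ℝ) (X : ℝ → A) (L : AreaFamily X) (U : (s : ℝ) → PTensor 2 (filt X s))
    (U1 U2 : (s : ℝ) → PTensor 3 (filt X s)) : Prop :=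
  IsControlledBiprocess T γ X U U1 U2 ∧
    ∃ R, IsSewing T (3 * γ) (delta (germ X L U U1 U2)) R

/-- The rough integral `𝒥(U ♯ dX) = (Id - Λδ)(M)`. -/
def roughIntegral (T γ : ℝ) (X : ℝ → A) (L : AreaFamily X) (U : (s : ℝ) → PTensor 2 (filt X s))
    (U1 U2 : (s : ℝ) → PTensor 3 (filt X s)) (s t : ℝ) : A :=
  germ X L U U1 U2 s t - sewing T (3 * γ) (delta (germ X L U U1 U2)) s t

/-! The two biprocesses `f(X) ⊗ g(X)`, with `U1 = ∂f(X) ⊗ g(X)` and `U2 = f(X) ⊗ ∂g(X)`, and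
`∂f(X)`, with `U1 = U2 = ∂²f(X)`. -/

/-- `f(X_s) ⊗ g(X_s)`. -/
def prodBiprocess {k : ℕ} (X : ℝ → A) (f g : TestFn k) (s : ℝ) : PTensor 2 (filt X s) :=
  tmul ![f.eval (filtElem X s), g.eval (filtElem X s)]

/-- `∂f(X_s) ⊗ g(X_s)`. -/
def prodTri₁ {k : ℕ} (X : ℝ → A) (f g : TestFn k) (s : ℝ) : PTensor 3 (filt X s) :=
  tensRight (g.eval (filtElem X s)) (f.deriv₁ (filtElem X s))

/-- `f(X_s) ⊗ ∂g(X_s)`. -/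
def prodTri₂ {k : ℕ} (X : ℝ → A) (f g : TestFn k) (s : ℝ) : PTensor 3 (filt X s) :=
  tensLeft (f.eval (filtElem X s)) (g.deriv₁ (filtElem X s))

/-- `∂f(X_s)`. -/
def gradBiprocess {k : ℕ} (X : ℝ → A) (f : TestFn k) (s : ℝ) : PTensor 2 (filt X s) :=
  f.deriv₁ (filtElem X s)

/-- `∂²f(X_s)`. -/
def gradTri {k : ℕ} (X : ℝ → A) (f : TestFn k) (s : ℝ) : PTensor 3 (filt X s) :=
  f.deriv₂ (filtElem X s)

/-! ### Linear interpolations and their classical integrals -/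

/-- A partition `0 = t₀ < t₁ < ⋯ < t_k = T` (the values `pt i` with `i > k` play no role). -/
structure TimePartition (T : ℝ) where
  k : ℕ
  pt : ℕ → ℝ
  pt_zero : pt 0 = 0
  pt_last : pt k = T
  pt_lt : ∀ i < k, pt i < pt (i + 1)

/-- The mesh of a partition. -/
def TimePartition.mesh {T : ℝ} (D : TimePartition T) : ℝ :=
  ⨆ i : Fin D.k, (D.pt (i + 1) - D.pt i)

/-- The linear interpolation of `X` along a partition, as the sum over the cells of the part of
the increment of `X` that is covered at time `t`; see `interp_apply`. -/
def interp {T : ℝ} (X : ℝ → A) (D : TimePartition T) (t : ℝ) : A :=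
  X 0 + ∑ i ∈ Finset.range D.k,
    (max 0 (min 1 ((t - D.pt i) / (D.pt (i + 1) - D.pt i)))) • (X (D.pt (i + 1)) - X (D.pt i))

theorem interp_apply {T : ℝ} (X : ℝ → A) (D : TimePartition T) {i : ℕ} (hi : i < D.k) {t : ℝ}
    (ht : t ∈ Icc (D.pt i) (D.pt (i + 1))) :
    interp X D t = X (D.pt i) +
      ((t - D.pt i) / (D.pt (i + 1) - D.pt i)) • (X (D.pt (i + 1)) - X (D.pt i)) := by
  have mono : ∀ a b, a ≤ b → b ≤ D.k → D.pt a ≤ D.pt b := by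
    intro a b hab
    induction hab with
    | refl => intro _; exact le_rfl
    | step _ ih => intro hb; exact (ih (by omega)).trans (D.pt_lt _ (by omega)).le
  set c : ℕ → A := fun j =>
    (max 0 (min 1 ((t - D.pt j) / (D.pt (j + 1) - D.pt j)))) • (X (D.pt (j + 1)) - X (D.pt j))
    with hc
  have hlow : ∀ j, j < i → c j = X (D.pt (j + 1)) - X (D.pt j) := by
    intro j hj
    have hp := sub_pos.2 (D.pt_lt j (by omega))
    have : 1 ≤ (t - D.pt j) / (D.pt (j + 1) - D.pt j) := by
      rw [le_div_iff₀ hp]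
      linarith [mono (j + 1) i hj hi.le, ht.1]
    simp [hc, min_eq_left this]
  have hhigh : ∀ j ∈ Finset.range D.k, j ∉ Finset.range (i + 1) → c j = 0 := by
    intro j hj hj'
    simp only [Finset.mem_range, not_lt] at hj hj'
    have hp := sub_pos.2 (D.pt_lt j hj)
    have : (t - D.pt j) / (D.pt (j + 1) - D.pt j) ≤ 0 :=
      div_nonpos_of_nonpos_of_nonneg (by linarith [mono (i + 1) j hj' hj.le, ht.2]) hp.le
    simp [hc, max_eq_left ((min_le_right _ _).trans this)]
  have hmid : c i =
      ((t - D.pt i) / (D.pt (i + 1) - D.pt i)) • (X (D.pt (i + 1)) - X (D.pt i)) := by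
    have hp := sub_pos.2 (D.pt_lt i hi)
    have h0 : 0 ≤ (t - D.pt i) / (D.pt (i + 1) - D.pt i) :=
      div_nonneg (by linarith [ht.1]) hp.le
    have h1 : (t - D.pt i) / (D.pt (i + 1) - D.pt i) ≤ 1 := by
      rw [div_le_one hp]; linarith [ht.2]
    simp [hc, min_eq_right h1, max_eq_right h0]
  have hsum : ∑ j ∈ Finset.range D.k, c j = ∑ j ∈ Finset.range (i + 1), c j :=
    (Finset.sum_subset (Finset.range_mono hi) hhigh).symm
  change X 0 + ∑ j ∈ Finset.range D.k, c j = _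
  rw [hsum, Finset.sum_range_succ, hmid,
    Finset.sum_congr rfl fun j hj => hlow j (Finset.mem_range.1 hj),
    Finset.sum_range_sub (fun j => X (D.pt j)), D.pt_zero]
  abel

/-- `∫_s^t (U ♯ (δx)_{su}) dx_u` for a piecewise linear path `x`. -/
def smoothArea (x : ℝ → A) (s t : ℝ) (U : PTensor 2 A) : A :=
  ∫ u in s..t, sharp (x u - x s) U * deriv x u

/-- `∫_s^t f(x_u) dx_u g(x_u)` for a piecewise linear path `x`. -/
def smoothIntegral {k : ℕ} (x : ℝ → A) (f g : TestFn k) (s t : ℝ) : A :=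
  ∫ u in s..t, f.eval (x u) * deriv x u * g.eval (x u)

/-- `∫_s^t ∂f(x_u) ♯ dx_u` for a piecewise linear path `x`. -/
def smoothGradIntegral {k : ℕ} (x : ℝ → A) (f : TestFn k) (s t : ℝ) : A :=
  ∫ u in s..t, sharp (deriv x u) (f.deriv₁ (x u))

end Area

end RoughNC

end

/-! Write `M` for the germ of the rough integral of `F(X)`, where `F` is `f ⊗ g` or `∂f`. Chen's
relation tensored with the identity on either side (`areaTimesId_of_chen`, and
`idTimesAreaStar_of_chen`, where the self-adjointness of `X` enters) produces in `(δM)_{sut}`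
exactly the first order part of `F(X_u) - F(X_s)` tested against `X_t - X_u`. What survives is a
Taylor remainder of `F` times an increment of `X`, and an increment of `U1` or `U2` under an area;
both have order `3γ > 1` (`delta_germ_eq`). The sewing lemma `exists_sewing_path` then yields the
rough integral. Chen's relation for `L` itself is the limit of the elementary relation for piecewise
linear paths (`chen_of_tendsto`).

The expansions of `F` come from Duhamel's formula for exponentials and from telescoping for
monomials (`TestFn.bounds`). They are proved in any Banach algebra, for elements `x` whose
exponentials `exp (i r x)` are contractions. This generality is needed because `L s t` acts on the
projective tensor square of `𝒜_s`, whose norm may be larger than the norm of the image over `𝒜`: the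
bounds on `∂f(X_s)` and `∂²f(X_s)` have to hold inside `𝒜_s`.

For the convergence, a continuity theorem in the driver does not apply directly. The value `X^n_s`
involves a later value of `X` and need not lie in `𝒜_s`, unless `s` is a partition point. The
comparison is therefore made at partition points, where `X^n = X`. On one cell `X^n` is affine, and
the second order expansion of the classical integral is expressed by the area of `X^n`. Hence the
two integrals differ by `areaError`, the second order terms built on the difference of the areas, up
to a multiple of the cell length to the power `3γ` (`RoughSetting.norm_cell_le`). These last errors
sum to a positive power of the mesh. The area errors cannot be summed term by term, since `2γ` may
be below `1`. But at partition points both areas satisfy Chen's relation with the same right side,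
so that the coboundary of the area error only sees increments of `U1` and `U2` and has size `ε (t -
s)^{3γ}`; `discrete_sewing` then compares the sum with a single area error on the whole interval
(`CloseInterp.exists_points_bound`). For two times in the same cell the first order expansions are
enough, one factor `(t - s)^γ` being paid for by the mesh (`CloseInterp.exists_cell_bound`).

Itô's formula is the fundamental theorem of calculus along `X^n` (`PLPath.pathIntegral_deriv₁`),
both sides of which converge. -/

noncomputable section

namespace RoughNC

section Instances

/-! Shortcuts that keep the instance search out of the ring structures on tensor products. -/

variable {n : ℕ} {B : Type*} [NormedAddCommGroup B] [NormedSpace ℂ B]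

instance instNormedAddCommGroupPTensor : NormedAddCommGroup (PTensor n B) := inferInstance

instance instNormedSpacePTensor : NormedSpace ℂ (PTensor n B) := inferInstance

instance instAddCommMonoidPTensor : AddCommMonoid (PTensor n B) :=
  instNormedAddCommGroupPTensor.toAddCommMonoid

instance instModulePTensor : Module ℂ (PTensor n B) := instNormedSpacePTensor.toModule

instance instTopologicalSpacePTensor : TopologicalSpace (PTensor n B) :=
  instNormedAddCommGroupPTensor.toMetricSpace.toUniformSpace.toTopologicalSpace

instance instAddCommGroupPTensor : AddCommGroup (PTensor n B) :=
  instNormedAddCommGroupPTensor.toAddCommGroup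

instance instSeminormedAddCommGroupPTensor : SeminormedAddCommGroup (PTensor n B) :=
  instNormedAddCommGroupPTensor.toSeminormedAddCommGroup

instance instCompleteSpacePTensor : CompleteSpace (PTensor n B) := inferInstance

end Instances

/-! ### Norm estimates in projective tensor powers. -/

section TensorBounds

variable {n : ℕ} {B C F : Type*} [NormedAddCommGroup B] [NormedSpace ℂ B]
  [NormedAddCommGroup C] [NormedSpace ℂ C]
  [NormedAddCommGroup F] [NormedSpace ℂ F]

theorem norm_tmul_le (b : Fin n → B) : ‖tmul b‖ ≤ ∏ i, ‖b i‖ := by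
  unfold tmul
  simpa using PiTensorProduct.projectiveSeminorm_tprod_le (𝕜 := ℂ) b

theorem norm_tmul₂_le (a b : B) : ‖tmul ![a, b]‖ ≤ ‖a‖ * ‖b‖ := by
  simpa [Fin.prod_univ_two] using norm_tmul_le ![a, b]

theorem norm_tmul₃_le (a b c : B) : ‖tmul ![a, b, c]‖ ≤ ‖a‖ * ‖b‖ * ‖c‖ := by
  simpa [Fin.prod_univ_three] using norm_tmul_le ![a, b, c]

/-- Continuous linear maps on a projective tensor power are determined by the elementary
tensors. -/
theorem ptensor_ext {f g : PTensor n B →L[ℂ] F} (h : ∀ b, f (tmul b) = g (tmul b)) : f = g := by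
  have key : f.comp (UniformSpace.Completion.toComplL (𝕜 := ℂ)) =
      g.comp (UniformSpace.Completion.toComplL (𝕜 := ℂ)) := by
    apply ContinuousLinearMap.coe_injective
    apply PiTensorProduct.ext
    ext b
    exact h b
  ext U
  refine UniformSpace.Completion.induction_on U (isClosed_eq f.continuous g.continuous) fun a => ?_
  exact DFunLike.congr_fun key a

theorem ptensor_ext₂ {f g : PTensor 2 B →L[ℂ] F}
    (h : ∀ a b, f (tmul ![a, b]) = g (tmul ![a, b])) : f = g :=
  ptensor_ext fun b => by
    have : b = ![b 0, b 1] := by ext i; fin_cases i <;> rfl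
    rw [this]; exact h _ _

theorem ptensor_ext₃ {f g : PTensor 3 B →L[ℂ] F}
    (h : ∀ a b c, f (tmul ![a, b, c]) = g (tmul ![a, b, c])) : f = g :=
  ptensor_ext fun b => by
    have : b = ![b 0, b 1, b 2] := by ext i; fin_cases i <;> rfl
    rw [this]; exact h _ _ _

theorem tlift_coe [CompleteSpace F] (m : ContinuousMultilinearMap ℂ (fun _ : Fin n => B) F)
    (a : ⨂[ℂ] _ : Fin n, B) :
    tlift m (a : PTensor n B) = PiTensorProduct.liftIsometry ℂ (fun _ : Fin n => B) F m a := by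
  unfold tlift
  exact ContinuousLinearMap.extend_eq _ UniformSpace.Completion.denseRange_coe
    (UniformSpace.Completion.isUniformInducing_coe _) a

/-- On the algebraic tensor power this is the isometry between multilinear maps and their
linearizations for the projective norm; it extends to the completion by density. All operator bounds
on tensor powers are reduced to elementary tensors in this way. -/
theorem norm_tlift_le [CompleteSpace F] (m : ContinuousMultilinearMap ℂ (fun _ : Fin n => B) F)
    {K : ℝ} (hK : 0 ≤ K) (h : ∀ b, ‖m b‖ ≤ K * ∏ i, ‖b i‖) : ‖tlift m‖ ≤ K := by
  refine ContinuousLinearMap.opNorm_le_bound _ hK fun U => ?_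
  refine UniformSpace.Completion.induction_on U (isClosed_le (by fun_prop) (by fun_prop))
    fun a => ?_
  rw [tlift_coe, UniformSpace.Completion.norm_coe]
  refine ContinuousLinearMap.le_of_opNorm_le _ ?_ a
  rw [LinearIsometryEquiv.norm_map]
  exact m.opNorm_le_bound hK h

theorem tmap_comp {G : Type*} [NormedAddCommGroup G] [NormedSpace ℂ G]
    (ψ : C →L[ℂ] G) (φ : B →L[ℂ] C) (U : PTensor n B) :
    tmap n ψ (tmap n φ U) = tmap n (ψ.comp φ) U := by
  have : (tmap n ψ).comp (tmap n φ) = tmap n (ψ.comp φ) :=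
    ptensor_ext fun b => by simp [tmap_tmul]
  exact DFunLike.congr_fun this U

theorem tmap_tmul₂ (φ : B →L[ℂ] C) (a b : B) : tmap 2 φ (tmul ![a, b]) = tmul ![φ a, φ b] := by
  rw [tmap_tmul]; congr 1; ext i; fin_cases i <;> rfl

theorem tmap_tmul₃ (φ : B →L[ℂ] C) (a b c : B) :
    tmap 3 φ (tmul ![a, b, c]) = tmul ![φ a, φ b, φ c] := by
  rw [tmap_tmul]; congr 1; ext i; fin_cases i <;> rfl

theorem tmul₂_add_left (a a' b : B) : tmul ![a + a', b] = tmul ![a, b] + tmul ![a', b] :=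
  (lin₂₀ b).map_add a a'

theorem tmul₂_add_right (a b b' : B) : tmul ![a, b + b'] = tmul ![a, b] + tmul ![a, b'] :=
  (lin₂₁ a).map_add b b'

theorem tmul₂_sub_left (a a' b : B) : tmul ![a - a', b] = tmul ![a, b] - tmul ![a', b] :=
  (lin₂₀ b).map_sub a a'

theorem tmul₂_sub_right (a b b' : B) : tmul ![a, b - b'] = tmul ![a, b] - tmul ![a, b'] :=
  (lin₂₁ a).map_sub b b'

theorem tmul₃_sub₀ (a a' b c : B) :
    tmul ![a - a', b, c] = tmul ![a, b, c] - tmul ![a', b, c] :=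
  (lin₃₀ b c).map_sub a a'

theorem tmul₃_sub₁ (a b b' c : B) :
    tmul ![a, b - b', c] = tmul ![a, b, c] - tmul ![a, b', c] :=
  (lin₃₁ a c).map_sub b b'

theorem tmul₃_sub₂ (a b c c' : B) :
    tmul ![a, b, c - c'] = tmul ![a, b, c] - tmul ![a, b, c'] :=
  (lin₃₂ a b).map_sub c c'

theorem norm_tmul₂_sub_le (a a' b b' : B) :
    ‖tmul ![a', b'] - tmul ![a, b]‖ ≤ ‖a' - a‖ * ‖b'‖ + ‖a‖ * ‖b' - b‖ := by
  have : tmul ![a', b'] - tmul ![a, b] = tmul ![a' - a, b'] + tmul ![a, b' - b] := by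
    rw [tmul₂_sub_left, tmul₂_sub_right]; abel
  rw [this]
  exact norm_add_le_of_le (norm_tmul₂_le _ _) (norm_tmul₂_le _ _)

theorem norm_tmul₃_sub_le (a a' b b' c c' : B) :
    ‖tmul ![a', b', c'] - tmul ![a, b, c]‖ ≤
      ‖a' - a‖ * ‖b'‖ * ‖c'‖ + ‖a‖ * ‖b' - b‖ * ‖c'‖ + ‖a‖ * ‖b‖ * ‖c' - c‖ := by
  have : tmul ![a', b', c'] - tmul ![a, b, c] =
      tmul ![a' - a, b', c'] + tmul ![a, b' - b, c'] + tmul ![a, b, c' - c] := by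
    rw [tmul₃_sub₀, tmul₃_sub₁, tmul₃_sub₂]; abel
  rw [this]
  exact norm_add_le_of_le (norm_add_le_of_le (norm_tmul₃_le _ _ _) (norm_tmul₃_le _ _ _))
    (norm_tmul₃_le _ _ _)

/-- First order expansion of an elementary tensor whose factors have first order expansions. -/
theorem norm_tmul₂_taylor_le (a a' da b b' db : B) :
    ‖tmul ![a', b'] - tmul ![a, b] - tmul ![da, b] - tmul ![a, db]‖ ≤
      ‖a' - a - da‖ * ‖b‖ + ‖a‖ * ‖b' - b - db‖ + ‖a' - a‖ * ‖b' - b‖ := by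
  have : tmul ![a', b'] - tmul ![a, b] - tmul ![da, b] - tmul ![a, db] =
      tmul ![a' - a - da, b] + tmul ![a, b' - b - db] + tmul ![a' - a, b' - b] := by
    simp only [tmul₂_sub_left, tmul₂_sub_right]; abel
  rw [this]
  exact norm_add_le_of_le (norm_add_le_of_le (norm_tmul₂_le _ _) (norm_tmul₂_le _ _))
    (norm_tmul₂_le _ _)

theorem continuous_tmul₂ {Y : Type*} [TopologicalSpace Y] {f g : Y → B} (hf : Continuous f)
    (hg : Continuous g) : Continuous fun y => tmul ![f y, g y] := by
  refine (tmulL 2 B).cont.comp (continuous_pi fun i => ?_)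
  fin_cases i
  · exact hf
  · exact hg

theorem continuous_tmul₃ {Y : Type*} [TopologicalSpace Y] {f g h : Y → B} (hf : Continuous f)
    (hg : Continuous g) (hh : Continuous h) : Continuous fun y => tmul ![f y, g y, h y] := by
  refine (tmulL 3 B).cont.comp (continuous_pi fun i => ?_)
  fin_cases i
  · exact hf
  · exact hg
  · exact hh

end TensorBounds

theorem norm_mul₃_le' {B : Type*} [NormedRing B] (a b c : B) : ‖a * b * c‖ ≤ ‖a‖ * ‖b‖ * ‖c‖ :=
  norm_mul_le_of_le (norm_mul_le _ _) le_rfl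

/-! ### The operations `♯` and tensoring with a fixed element. -/

section AlgebraBounds

variable {B : Type*} [NormedRing B] [NormedAlgebra ℂ B]

theorem opNorm_sharp_le [CompleteSpace B] (x : B) : ‖sharp x‖ ≤ ‖x‖ := by
  refine norm_tlift_le _ (norm_nonneg _) fun b => ?_
  rw [Fin.prod_univ_two]
  calc ‖b 0 * x * b 1‖ ≤ ‖b 0‖ * ‖x‖ * ‖b 1‖ := norm_mul₃_le' _ _ _
    _ = _ := by ring

theorem norm_sharp_le [CompleteSpace B] (x : B) (U : PTensor 2 B) :
    ‖sharp x U‖ ≤ ‖x‖ * ‖U‖ :=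
  (sharp x).le_of_opNorm_le (opNorm_sharp_le x) U

theorem opNorm_sharpLeft_le (x : B) : ‖sharpLeft x‖ ≤ ‖x‖ := by
  refine norm_tlift_le _ (norm_nonneg _) fun b => ?_
  rw [Fin.prod_univ_three]
  calc ‖tmul ![b 0 * x * b 1, b 2]‖ ≤ ‖b 0 * x * b 1‖ * ‖b 2‖ := norm_tmul₂_le _ _
    _ ≤ ‖b 0‖ * ‖x‖ * ‖b 1‖ * ‖b 2‖ := by gcongr; exact norm_mul₃_le' _ _ _
    _ = _ := by ring

theorem norm_sharpLeft_le (x : B) (U : PTensor 3 B) : ‖sharpLeft x U‖ ≤ ‖x‖ * ‖U‖ :=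
  (sharpLeft x).le_of_opNorm_le (opNorm_sharpLeft_le x) U

theorem opNorm_sharpRight_le (x : B) : ‖sharpRight x‖ ≤ ‖x‖ := by
  refine norm_tlift_le _ (norm_nonneg _) fun b => ?_
  rw [Fin.prod_univ_three]
  calc ‖tmul ![b 0, b 1 * x * b 2]‖ ≤ ‖b 0‖ * ‖b 1 * x * b 2‖ := norm_tmul₂_le _ _
    _ ≤ ‖b 0‖ * (‖b 1‖ * ‖x‖ * ‖b 2‖) := by gcongr; exact norm_mul₃_le' _ _ _
    _ = _ := by ring

theorem norm_sharpRight_le (x : B) (U : PTensor 3 B) : ‖sharpRight x U‖ ≤ ‖x‖ * ‖U‖ :=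
  (sharpRight x).le_of_opNorm_le (opNorm_sharpRight_le x) U

theorem norm_tensRight_le (y : B) (U : PTensor 2 B) : ‖tensRight y U‖ ≤ ‖y‖ * ‖U‖ := by
  refine (tensRight y).le_of_opNorm_le (norm_tlift_le _ (norm_nonneg _) fun b => ?_) U
  rw [Fin.prod_univ_two]
  exact (norm_tmul₃_le _ _ _).trans_eq (by ring)

theorem norm_tensLeft_le (y : B) (U : PTensor 2 B) : ‖tensLeft y U‖ ≤ ‖y‖ * ‖U‖ := by
  refine (tensLeft y).le_of_opNorm_le (norm_tlift_le _ (norm_nonneg _) fun b => ?_) U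
  rw [Fin.prod_univ_two]
  exact (norm_tmul₃_le _ _ _).trans_eq (by ring)

theorem tensRight_sub (y z : B) (U : PTensor 2 B) :
    tensRight (y - z) U = tensRight y U - tensRight z U := by
  have : tensRight (y - z) = tensRight y - tensRight z :=
    ptensor_ext₂ fun a b => by simp [tensRight_tmul, tmul₃_sub₂]
  rw [this]; rfl

theorem tensLeft_sub (y z : B) (U : PTensor 2 B) :
    tensLeft (y - z) U = tensLeft y U - tensLeft z U := by
  have : tensLeft (y - z) = tensLeft y - tensLeft z :=
    ptensor_ext₂ fun a b => by simp [tensLeft_tmul, tmul₃_sub₀]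
  rw [this]; rfl

theorem norm_tensRight_sub_le (y z : B) (U V : PTensor 2 B) :
    ‖tensRight y U - tensRight z V‖ ≤ ‖y - z‖ * ‖U‖ + ‖z‖ * ‖U - V‖ := by
  have : tensRight y U - tensRight z V = tensRight (y - z) U + tensRight z (U - V) := by
    rw [tensRight_sub, map_sub]; abel
  rw [this]
  exact norm_add_le_of_le (norm_tensRight_le _ _) (norm_tensRight_le _ _)

theorem norm_tensLeft_sub_le (y z : B) (U V : PTensor 2 B) :
    ‖tensLeft y U - tensLeft z V‖ ≤ ‖y - z‖ * ‖U‖ + ‖z‖ * ‖U - V‖ := by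
  have : tensLeft y U - tensLeft z V = tensLeft (y - z) U + tensLeft z (U - V) := by
    rw [tensLeft_sub, map_sub]; abel
  rw [this]
  exact norm_add_le_of_le (norm_tensLeft_le _ _) (norm_tensLeft_le _ _)

/-- For `U = ∂f(z)` and `y = g(z)` this turns `x ♯ (∂f ⊗ g)` into the derivative of `f` in the
direction `x`, tensored with `g`. In this form the product rule `norm_tmul₂_taylor_le` applies to `f
⊗ g`. -/
theorem sharpLeft_tensRight [CompleteSpace B] (x y : B) (U : PTensor 2 B) :
    sharpLeft x (tensRight y U) = tmul ![sharp x U, y] := by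
  have : (sharpLeft x).comp (tensRight y) =
      (LinearMap.mkContinuous ⟨⟨fun a => tmulL 2 B ![a, y], (lin₂₀ y).map_add⟩, (lin₂₀ y).map_smul⟩
        ‖y‖ fun a => (norm_tmul₂_le a y).trans_eq (mul_comm _ _) : B →L[ℂ] PTensor 2 B).comp
        (sharp x) :=
    ptensor_ext₂ fun a b => by simp [tensRight_tmul, sharpLeft_tmul, sharp_tmul, tmulL_apply]
  exact DFunLike.congr_fun this U

theorem sharpRight_tensLeft [CompleteSpace B] (x y : B) (U : PTensor 2 B) :
    sharpRight x (tensLeft y U) = tmul ![y, sharp x U] := by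
  have : (sharpRight x).comp (tensLeft y) =
      (LinearMap.mkContinuous ⟨⟨fun a => tmulL 2 B ![y, a], (lin₂₁ y).map_add⟩, (lin₂₁ y).map_smul⟩
        ‖y‖ fun a => norm_tmul₂_le y a : B →L[ℂ] PTensor 2 B).comp
        (sharp x) :=
    ptensor_ext₂ fun a b => by simp [tensLeft_tmul, sharpRight_tmul, sharp_tmul, tmulL_apply]
  exact DFunLike.congr_fun this U

/-- A continuous linear map from a linear map that does not increase norms. -/
def clmOfBound {B E : Type*} [NormedAddCommGroup B] [NormedSpace ℂ B] [NormedAddCommGroup E]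
    [NormedSpace ℂ E] (q : B → E) (hadd : ∀ x y, q (x + y) = q x + q y)
    (hsmul : ∀ (r : ℂ) x, q (r • x) = r • q x) (hq : ∀ x, ‖q x‖ ≤ ‖x‖) : B →L[ℂ] E :=
  LinearMap.mkContinuous ⟨⟨q, hadd⟩, hsmul⟩ 1 fun x => (hq x).trans_eq (one_mul _).symm

theorem sharp_add' [CompleteSpace B] (x y : B) :
    (sharp (x + y) : PTensor 2 B →L[ℂ] B) = sharp x + sharp y :=
  ptensor_ext₂ fun a b => by
    rw [add_apply, sharp_tmul, sharp_tmul, sharp_tmul]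
    simp [mul_add, add_mul]

theorem sharp_smul' [CompleteSpace B] (r : ℂ) (x : B) :
    (sharp (r • x) : PTensor 2 B →L[ℂ] B) = r • sharp x :=
  ptensor_ext₂ fun a b => by
    rw [smul_apply, sharp_tmul, sharp_tmul]
    simp

/-- `x ↦ (U ↦ U ♯ x)` as a continuous linear map. -/
def sharpL (B : Type*) [NormedRing B] [NormedAlgebra ℂ B] [CompleteSpace B] :
    B →L[ℂ] PTensor 2 B →L[ℂ] B :=
  clmOfBound sharp sharp_add' sharp_smul' opNorm_sharp_le

theorem sharpLeft_add' (x y : B) :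
    (sharpLeft (x + y) : PTensor 3 B →L[ℂ] PTensor 2 B) = sharpLeft x + sharpLeft y :=
  ptensor_ext₃ fun a b c => by
    rw [add_apply, sharpLeft_tmul, sharpLeft_tmul, sharpLeft_tmul]
    rw [mul_add, add_mul, tmul₂_add_left]

theorem sharpLeft_smul' (r : ℂ) (x : B) :
    (sharpLeft (r • x) : PTensor 3 B →L[ℂ] PTensor 2 B) = r • sharpLeft x :=
  ptensor_ext₃ fun a b c => by
    rw [smul_apply, sharpLeft_tmul, sharpLeft_tmul]
    simpa [tmulL_apply] using (lin₂₀ c).map_smul r (a * x * b)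

/-- `x ↦ (𝕌 ↦ x ♯ 𝕌)` as a continuous linear map. -/
def sharpLeftL (B : Type*) [NormedRing B] [NormedAlgebra ℂ B] :
    B →L[ℂ] PTensor 3 B →L[ℂ] PTensor 2 B :=
  clmOfBound sharpLeft sharpLeft_add' sharpLeft_smul' opNorm_sharpLeft_le

theorem sharpRight_add' (x y : B) :
    (sharpRight (x + y) : PTensor 3 B →L[ℂ] PTensor 2 B) = sharpRight x + sharpRight y :=
  ptensor_ext₃ fun a b c => by
    rw [add_apply, sharpRight_tmul, sharpRight_tmul, sharpRight_tmul]
    rw [mul_add, add_mul, tmul₂_add_right]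

theorem sharpRight_smul' (r : ℂ) (x : B) :
    (sharpRight (r • x) : PTensor 3 B →L[ℂ] PTensor 2 B) = r • sharpRight x :=
  ptensor_ext₃ fun a b c => by
    rw [smul_apply, sharpRight_tmul, sharpRight_tmul]
    simpa [tmulL_apply] using (lin₂₁ a).map_smul r (b * x * c)

/-- `x ↦ (𝕌 ↦ 𝕌 ♯ x)` as a continuous linear map. -/
def sharpRightL (B : Type*) [NormedRing B] [NormedAlgebra ℂ B] :
    B →L[ℂ] PTensor 3 B →L[ℂ] PTensor 2 B :=
  clmOfBound sharpRight sharpRight_add' sharpRight_smul' opNorm_sharpRight_le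

theorem sharp_add [CompleteSpace B] (x y : B) (U : PTensor 2 B) :
    sharp (x + y) U = sharp x U + sharp y U := by
  rw [sharp_add']; rfl

theorem sharp_sub [CompleteSpace B] (x y : B) (U : PTensor 2 B) :
    sharp (x - y) U = sharp x U - sharp y U :=
  DFunLike.congr_fun ((sharpL B).map_sub x y) U

theorem continuous_sharpLeft : Continuous fun p : B × PTensor 3 B => sharpLeft p.1 p.2 :=
  (sharpLeftL B).continuous₂

theorem continuous_sharpRight : Continuous fun p : B × PTensor 3 B => sharpRight p.1 p.2 :=
  (sharpRightL B).continuous₂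

end AlgebraBounds

/-! ### The operators `L × Id` and `Id × L⋆`. -/

section AreaBounds

variable {A : Type*} [CStarAlgebra A] {S S' : StarSubalgebra ℂ A}

theorem norm_subIncl (S : StarSubalgebra ℂ A) (x : S) : ‖subIncl S x‖ = ‖x‖ := rfl

theorem norm_subInclLE (h : S ≤ S') (x : S) : ‖subInclLE h x‖ = ‖x‖ := rfl

theorem norm_areaTimesId_le (L : PTensor 2 S →L[ℂ] A) {K : ℝ} (hK : 0 ≤ K) (hL : ∀ U, ‖L U‖ ≤ K * ‖U‖)
    (U : PTensor 3 S) : ‖areaTimesId L U‖ ≤ K * ‖U‖ := by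
  refine (areaTimesId L).le_of_opNorm_le (norm_tlift_le _ hK fun b => ?_) U
  rw [Fin.prod_univ_three]
  calc ‖L (tmul ![b 0, b 1]) * (b 2 : A)‖ ≤ ‖L (tmul ![b 0, b 1])‖ * ‖(b 2 : A)‖ := norm_mul_le _ _
    _ ≤ K * (‖b 0‖ * ‖b 1‖) * ‖b 2‖ := by
      gcongr
      · exact (hL _).trans (by gcongr; exact norm_tmul₂_le _ _)
      · exact le_rfl
    _ = _ := by ring

/-- The star is isometric on both sides, so passing from `L` to `L⋆` keeps the constant. -/
theorem norm_idTimesAreaStar_le (L : PTensor 2 S →L[ℂ] A) {K : ℝ} (hK : 0 ≤ K)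
    (hL : ∀ U, ‖L U‖ ≤ K * ‖U‖) (U : PTensor 3 S) : ‖idTimesAreaStar L U‖ ≤ K * ‖U‖ := by
  refine (idTimesAreaStar L).le_of_opNorm_le (norm_tlift_le _ hK fun b => ?_) U
  rw [Fin.prod_univ_three]
  calc ‖(b 0 : A) * star (L (tmul ![star (b 2), star (b 1)]))‖
      ≤ ‖(b 0 : A)‖ * ‖L (tmul ![star (b 2), star (b 1)])‖ := by
        simpa using norm_mul_le (b 0 : A) (star (L (tmul ![star (b 2), star (b 1)])))
    _ ≤ ‖b 0‖ * (K * (‖b 2‖ * ‖b 1‖)) := by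
      gcongr
      · exact le_rfl
      · refine (hL _).trans ?_
        gcongr
        simpa using norm_tmul₂_le (star (b 2)) (star (b 1))
    _ = _ := by ring

theorem areaTimesId_sub (L L' : PTensor 2 S →L[ℂ] A) :
    areaTimesId (L - L') = areaTimesId L - areaTimesId L' :=
  ptensor_ext₃ fun a b c => by simp [areaTimesId_tmul, sub_mul]

theorem idTimesAreaStar_sub (L L' : PTensor 2 S →L[ℂ] A) :
    idTimesAreaStar (L - L') = idTimesAreaStar L - idTimesAreaStar L' :=
  ptensor_ext₃ fun a b c => by simp [idTimesAreaStar_tmul, mul_sub]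

/-- Areas at different times act on different algebras. Moving the inclusion from the operator to
its argument lets the area on `[u, t]` in Chen's relation act on the image of the triprocess at time
`s`. -/
theorem areaTimesId_comp_tmap (h : S ≤ S') (L : PTensor 2 S' →L[ℂ] A) (U : PTensor 3 S) :
    areaTimesId (L.comp (tmap 2 (subInclLE h))) U = areaTimesId L (tmap 3 (subInclLE h) U) := by
  have : areaTimesId (L.comp (tmap 2 (subInclLE h))) =
      (areaTimesId L).comp (tmap 3 (subInclLE h)) :=
    ptensor_ext₃ fun a b c => by simp [areaTimesId_tmul, tmap_tmul₂, tmap_tmul₃]; rfl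
  exact DFunLike.congr_fun this U

theorem idTimesAreaStar_comp_tmap (h : S ≤ S') (L : PTensor 2 S' →L[ℂ] A) (U : PTensor 3 S) :
    idTimesAreaStar (L.comp (tmap 2 (subInclLE h))) U =
      idTimesAreaStar L (tmap 3 (subInclLE h) U) := by
  have : idTimesAreaStar (L.comp (tmap 2 (subInclLE h))) =
      (idTimesAreaStar L).comp (tmap 3 (subInclLE h)) :=
    ptensor_ext₃ fun a b c => by simp [idTimesAreaStar_tmul, tmap_tmul₂, tmap_tmul₃]; rfl
  exact DFunLike.congr_fun this U

/-- The operator `U ↦ (U ♯ x) y` on the projective tensor square of a subalgebra. -/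
def sharpMul (S : StarSubalgebra ℂ A) (x y : A) : PTensor 2 S →L[ℂ] A :=
  ((ContinuousLinearMap.mul ℂ A).flip y).comp ((sharp x).comp (tmap 2 (subIncl S)))

theorem sharpMul_apply (x y : A) (U : PTensor 2 S) :
    sharpMul S x y U = sharp x (tmap 2 (subIncl S) U) * y := rfl

/-- On elementary tensors both sides are `(a x b) y c`. The right side of Chen's relation thereby
becomes the first order term `x ♯ 𝕌` of a controlled biprocess, integrated against `y`. -/
theorem areaTimesId_sharpMul (x y : A) (U : PTensor 3 S) :
    areaTimesId (sharpMul S x y) U = sharp y (sharpLeft x (tmap 3 (subIncl S) U)) := by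
  have : areaTimesId (sharpMul S x y) =
      (sharp y).comp ((sharpLeft x).comp (tmap 3 (subIncl S))) :=
    ptensor_ext₃ fun a b c => by
      simp [areaTimesId_tmul, sharpMul_apply, tmap_tmul₂, tmap_tmul₃, sharp_tmul, sharpLeft_tmul]
      rfl
  exact DFunLike.congr_fun this U

/-- On elementary tensors the left side is `a ((c⋆ x b⋆) y)⋆ = a y⋆ b x⋆ c`. Self-adjointness of the
increments turns it into `a y (b x c)`; this is the reason for the star in the definition of the
integral. -/
theorem idTimesAreaStar_sharpMul {x y : A} (hx : IsSelfAdjoint x) (hy : IsSelfAdjoint y)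
    (U : PTensor 3 S) :
    idTimesAreaStar (sharpMul S x y) U = sharp y (sharpRight x (tmap 3 (subIncl S) U)) := by
  have : idTimesAreaStar (sharpMul S x y) =
      (sharp y).comp ((sharpRight x).comp (tmap 3 (subIncl S))) :=
    ptensor_ext₃ fun a b c => by
      simp [idTimesAreaStar_tmul, sharpMul_apply, tmap_tmul₂, tmap_tmul₃, sharp_tmul,
        sharpRight_tmul, subIncl, hx.star_eq, hy.star_eq, mul_assoc]
  exact DFunLike.congr_fun this U

end AreaBounds

/-! ### The sewing lemma, discrete and continuous. -/

section Sewing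

variable {E : Type*} [NormedAddCommGroup E]

/-- The constant of the sewing lemma. -/
def sewConst (θ : ℝ) : ℝ := 2 / (1 - 2 ^ (1 - θ))

theorem two_rpow_one_sub_lt_one {θ : ℝ} (hθ : 1 < θ) : (2 : ℝ) ^ (1 - θ) < 1 :=
  Real.rpow_lt_one_of_one_lt_of_neg (by norm_num) (by linarith)

theorem sewConst_pos {θ : ℝ} (hθ : 1 < θ) : 0 < sewConst θ :=
  div_pos two_pos (sub_pos.2 (two_rpow_one_sub_lt_one hθ))

/-- The fixed point equation that closes the induction in `discrete_sewing`: two coboundaries cost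
`2`, and two pieces of at most half the length cost the constant times `(1/2)^θ` each. -/
theorem sewConst_eq {θ : ℝ} (hθ : 1 < θ) :
    2 * (sewConst θ * (1 / 2) ^ θ) + 2 = sewConst θ := by
  have h := (sub_pos.2 (two_rpow_one_sub_lt_one hθ)).ne'
  have h2 : (2 : ℝ) * (1 / 2) ^ θ = 2 ^ (1 - θ) := by
    rw [Real.rpow_sub two_pos, Real.rpow_one, Real.div_rpow zero_le_one two_pos.le,
      Real.one_rpow]
    ring
  have h3 : sewConst θ * (1 - 2 ^ (1 - θ)) = 2 := by
    unfold sewConst; field_simp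
  calc _ = sewConst θ * (2 * (1 / 2) ^ θ) + 2 := by ring
    _ = sewConst θ * 2 ^ (1 - θ) + sewConst θ * (1 - 2 ^ (1 - θ)) := by rw [h2, h3]
    _ = _ := by ring

/-- Discrete sewing: a two-parameter array whose coboundary has order `θ > 1` is close to the sum
of its increments. -/
theorem discrete_sewing {θ K : ℝ} (hθ : 1 < θ) (hK : 0 ≤ K) (t : ℕ → ℝ) (N : ℕ)
    (ht : ∀ i j, i ≤ j → j ≤ N → t i ≤ t j) (h : ℕ → ℕ → E) (h0 : ∀ i ≤ N, h i i = 0)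
    (hδ : ∀ i j k, i ≤ j → j ≤ k → k ≤ N → ‖h i k - h i j - h j k‖ ≤ K * (t k - t i) ^ θ) :
    ∀ d i, i + d ≤ N →
      ‖h i (i + d) - ∑ l ∈ Finset.range d, h (i + l) (i + l + 1)‖ ≤
        sewConst θ * K * (t (i + d) - t i) ^ θ := by
  have hC := (sewConst_pos hθ).le
  intro d
  induction d using Nat.strong_induction_on with
  | _ d ih =>
    intro i hi
    have hti : 0 ≤ t (i + d) - t i := sub_nonneg.2 (ht _ _ (by omega) hi)
    rcases Nat.eq_zero_or_pos d with rfl | hd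
    · simp only [add_zero, Finset.range_zero, Finset.sum_empty, sub_zero, h0 i hi, norm_zero]
      exact mul_nonneg (mul_nonneg hC hK) (Real.rpow_nonneg (by simp) _)
    -- the last index whose point lies in the first half
    obtain ⟨e, hed, he1, he2⟩ : ∃ e < d, t (i + e) - t i ≤ (t (i + d) - t i) / 2 ∧
        t (i + d) - t (i + e + 1) ≤ (t (i + d) - t i) / 2 := by
      classical
      let P : ℕ → Prop := fun e => e < d ∧ t (i + e) - t i ≤ (t (i + d) - t i) / 2
      have hP0 : P 0 := ⟨hd, by simpa using by linarith⟩
      have hP := Nat.findGreatest_spec (P := P) (Nat.zero_le d) hP0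
      refine ⟨Nat.findGreatest P d, hP.1, hP.2, ?_⟩
      by_cases hlt : Nat.findGreatest P d + 1 < d
      · have := Nat.findGreatest_is_greatest (P := P) (Nat.lt_succ_self _) hlt.le
        have h2 : ¬ (t (i + (Nat.findGreatest P d + 1)) - t i ≤ (t (i + d) - t i) / 2) :=
          fun hh => this ⟨hlt, hh⟩
        rw [← add_assoc] at h2
        linarith
      · have : i + Nat.findGreatest P d + 1 = i + d := by have := hP.1; omega
        rw [this]; linarith
    -- The block splits into `e` steps, one single step, and `g` steps. The two outer pieces have at
    -- most half of the total length; the single step is its own summand, so its length does not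
    -- matter.
    obtain ⟨g, rfl⟩ : ∃ g, d = e + 1 + g := ⟨d - (e + 1), by omega⟩
    set w := t (i + (e + 1 + g)) - t i with hw
    have hsum : ∑ l ∈ Finset.range (e + 1 + g), h (i + l) (i + l + 1) =
        (∑ l ∈ Finset.range e, h (i + l) (i + l + 1)) + h (i + e) (i + e + 1) +
        ∑ l ∈ Finset.range g, h (i + e + 1 + l) (i + e + 1 + l + 1) := by
      rw [Finset.sum_range_add, Finset.sum_range_succ]
      congr 1
      refine Finset.sum_congr rfl fun l _ => ?_
      simp only [add_assoc]
    have i1 := ih e (by omega) i (by omega)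
    have i2 := ih g (by omega) (i + e + 1) (by omega)
    have d1 := hδ i (i + e + 1) (i + (e + 1 + g)) (by omega) (by omega) (by omega)
    have d2 := hδ i (i + e) (i + e + 1) (by omega) (by omega) (by omega)
    have m1 : (t (i + e + 1) - t i) ^ θ ≤ w ^ θ :=
      Real.rpow_le_rpow (sub_nonneg.2 (ht _ _ (by omega) (by omega)))
        (sub_le_sub_right (ht _ _ (by omega) (by omega)) _) (by linarith)
    have m2 : (t (i + e) - t i) ^ θ ≤ (1 / 2) ^ θ * w ^ θ := by
      rw [← Real.mul_rpow (by norm_num) hti]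
      exact Real.rpow_le_rpow (sub_nonneg.2 (ht _ _ (by omega) (by omega))) (by linarith)
        (by linarith)
    have e3 : i + e + 1 + g = i + (e + 1 + g) := by omega
    rw [e3] at i2
    have m3 : (t (i + (e + 1 + g)) - t (i + e + 1)) ^ θ ≤ (1 / 2) ^ θ * w ^ θ := by
      rw [← Real.mul_rpow (by norm_num) hti]
      exact Real.rpow_le_rpow (sub_nonneg.2 (ht _ _ (by omega) (by omega))) (by linarith)
        (by linarith)
    rw [hsum]
    have key : h i (i + (e + 1 + g)) - ((∑ l ∈ Finset.range e, h (i + l) (i + l + 1)) +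
        h (i + e) (i + e + 1) + ∑ l ∈ Finset.range g, h (i + e + 1 + l) (i + e + 1 + l + 1)) =
      (h i (i + (e + 1 + g)) - h i (i + e + 1) - h (i + e + 1) (i + (e + 1 + g))) +
      (h i (i + e + 1) - h i (i + e) - h (i + e) (i + e + 1)) +
      (h i (i + e) - ∑ l ∈ Finset.range e, h (i + l) (i + l + 1)) +
      (h (i + e + 1) (i + (e + 1 + g)) -
        ∑ l ∈ Finset.range g, h (i + e + 1 + l) (i + e + 1 + l + 1)) := by abel
    rw [key]
    have hCK := mul_nonneg hC hK
    calc _ ≤ K * w ^ θ + K * w ^ θ + sewConst θ * K * ((1 / 2) ^ θ * w ^ θ) +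
          sewConst θ * K * ((1 / 2) ^ θ * w ^ θ) := by
          refine norm_add_le_of_le (norm_add_le_of_le (norm_add_le_of_le d1 ?_) ?_) ?_
          · exact d2.trans (by gcongr)
          · exact i1.trans (by gcongr)
          · exact i2.trans (by gcongr)
      _ = (2 * (sewConst θ * (1 / 2) ^ θ) + 2) * K * w ^ θ := by ring
      _ = _ := by rw [sewConst_eq hθ]

/-- There are `2^m` dyadic cells, each with an error of order `θ` in its length. The total is
geometric in `m`, with ratio below `1` when `θ > 1`. -/
theorem two_pow_mul_rpow_div {θ T : ℝ} (hT : 0 ≤ T) (K : ℝ) :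
    ∀ m : ℕ, (2 : ℝ) ^ m * (K * (T / 2 ^ m) ^ θ) = K * T ^ θ * (2 ^ (1 - θ)) ^ m := by
  intro m
  rw [Real.div_rpow hT (by positivity), ← Real.rpow_natCast 2 m, ← Real.rpow_mul two_pos.le,
    ← Real.rpow_natCast (2 ^ (1 - θ)) m, ← Real.rpow_mul two_pos.le]
  have : (2 : ℝ) ^ ((1 - θ) * (m : ℝ)) = 2 ^ (m : ℝ) / 2 ^ ((m : ℝ) * θ) := by
    rw [← Real.rpow_sub two_pos]; ring_nf
  rw [this]; ring

/-- Riemann sums of `h` on `[0, t]` along the dyadic partition of `[0, T]`. -/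
def dyadicSum (T : ℝ) (h : ℝ → ℝ → E) (m : ℕ) (t : ℝ) : E :=
  ∑ i ∈ Finset.range (2 ^ m), h (min t (i * (T / 2 ^ m))) (min t ((i + 1 : ℕ) * (T / 2 ^ m)))

/-- The sewing lemma: a germ whose coboundary has order `θ > 1` is close to the increments of a
path. -/
theorem exists_sewing_path [CompleteSpace E] {θ K T : ℝ} (hθ : 1 < θ) (hK : 0 ≤ K) (hT : 0 ≤ T)
    (h : ℝ → ℝ → E) (h0 : ∀ t, h t t = 0)
    (hδ : ∀ s u t, 0 ≤ s → s ≤ u → u ≤ t → t ≤ T → ‖delta h s u t‖ ≤ K * (t - s) ^ θ) :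
    ∃ J : ℝ → E, ∀ s t, 0 ≤ s → s ≤ t → t ≤ T →
      ‖J t - J s - h s t‖ ≤ sewConst θ * K * (t - s) ^ θ := by
  set a : ℕ → ℕ → ℝ := fun m i => i * (T / 2 ^ m) with ha
  have hmono : ∀ m i j, i ≤ j → a m i ≤ a m j := fun m i j hij => by
    have : (i : ℝ) ≤ j := by exact_mod_cast hij
    exact mul_le_mul_of_nonneg_right this (by positivity)
  have ha0 : ∀ m, a m 0 = 0 := fun m => by simp [ha]
  have haT : ∀ m, a m (2 ^ m) = T := fun m => by
    simp only [ha]; push_cast; field_simp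
  have hnn : ∀ m i, 0 ≤ a m i := fun m i => by simp only [ha]; positivity
  have hstep : ∀ m i, a m (i + 1) - a m i = T / 2 ^ m := fun m i => by
    simp only [ha]; push_cast; ring
  set S := dyadicSum T h with hS
  have hSdef : ∀ m t, S m t = ∑ i ∈ Finset.range (2 ^ m),
    h (min t (a m i)) (min t (a m (i + 1))) := fun m t => rfl
  set r : ℝ := 2 ^ (1 - θ) with hr
  have hr0 : 0 ≤ r := Real.rpow_nonneg two_pos.le _
  have hr1 : r < 1 := two_rpow_one_sub_lt_one hθ
  -- refinement
  have hrefine : ∀ m t, 0 ≤ t → t ≤ T → ‖S (m + 1) t - S m t‖ ≤ K * T ^ θ * r ^ m := by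
    intro m t ht0 htT
    have hdouble : ∀ i, a (m + 1) (2 * i) = a m i := fun i => by
      simp only [ha]; push_cast; rw [pow_succ]; field_simp
    have hsplit : ∀ (f : ℕ → E) (n : ℕ), ∑ i ∈ Finset.range (2 * n), f i =
        ∑ i ∈ Finset.range n, (f (2 * i) + f (2 * i + 1)) := by
      intro f n
      induction n with
      | zero => simp
      | succ n ih =>
        rw [Finset.sum_range_succ, ← ih, mul_add, mul_one, Finset.sum_range_succ,
          Finset.sum_range_succ]
        abel
    rw [hSdef, hSdef, pow_succ, mul_comm (2 ^ m) 2, hsplit, ← Finset.sum_sub_distrib]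
    refine (norm_sum_le _ _).trans ?_
    rw [← two_pow_mul_rpow_div hT K m]
    refine (Finset.sum_le_card_nsmul _ _ (K * (T / 2 ^ m) ^ θ) fun i _ => ?_).trans
      (le_of_eq (by simp))
    have e1 := hdouble i
    have e2 : a (m + 1) (2 * i + 1 + 1) = a m (i + 1) := hdouble (i + 1)
    have l1 := hmono (m + 1) (2 * i) (2 * i + 1) (by omega)
    have l2 := hmono (m + 1) (2 * i + 1) (2 * i + 1 + 1) (by omega)
    rw [e1] at l1 ⊢
    rw [e2] at l2 ⊢
    have hd := hδ (min t (a m i)) (min t (a (m + 1) (2 * i + 1))) (min t (a m (i + 1)))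
      (le_min ht0 (hnn _ _)) (min_le_min_left _ l1) (min_le_min_left _ l2)
      ((min_le_left _ _).trans htT)
    -- Cell by cell, the refined sum minus the coarse one is minus the coboundary at the midpoint,
    -- with all points clipped at `t`.
    rw [← norm_neg]
    refine le_trans (le_of_eq ?_) (hd.trans ?_)
    · congr 1; unfold delta; abel
    · refine mul_le_mul_of_nonneg_left (Real.rpow_le_rpow ?_ ?_ (by linarith)) hK
      · exact sub_nonneg.2 (min_le_min_left _ (l1.trans l2))
      · rw [← hstep m i]
        rcases le_total t (a m i) with h1 | h1
        · rw [min_eq_left h1, min_eq_left (h1.trans (l1.trans l2)), sub_self, hstep]; positivity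
        · rw [min_eq_right h1]; exact sub_le_sub_right (min_le_right _ _) _
  have hcauchy : ∀ t, 0 ≤ t → t ≤ T → ∃ L, Tendsto (fun m => S m t) atTop (𝓝 L) := by
    intro t ht0 htT
    refine cauchySeq_tendsto_of_complete
      (cauchySeq_of_le_geometric r (K * T ^ θ) hr1 fun m => ?_)
    rw [dist_eq_norm, ← norm_neg, neg_sub]
    exact hrefine m t ht0 htT
  choose! J hJ using hcauchy
  refine ⟨J, fun s t hs hst htT => ?_⟩
  have hlim : Tendsto (fun m => ‖S m t - S m s - h s t‖) atTop (𝓝 ‖J t - J s - h s t‖) :=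
    (((hJ t (hs.trans hst) htT).sub (hJ s hs (hst.trans htT))).sub_const _).norm
  have hlim2 : Tendsto (fun m : ℕ => K * T ^ θ * r ^ m + sewConst θ * K * (t - s) ^ θ) atTop
      (𝓝 (sewConst θ * K * (t - s) ^ θ)) := by
    simpa using ((tendsto_pow_atTop_nhds_zero_of_lt_one hr0 hr1).const_mul (K * T ^ θ)).add_const
      (sewConst θ * K * (t - s) ^ θ)
  refine le_of_tendsto_of_tendsto' hlim hlim2 fun m => ?_
  -- the clipped partition of `[s, t]`
  set d : ℕ → ℝ := fun i => max s (min t (a m i)) with hd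
  have hdm : ∀ i j, i ≤ j → d i ≤ d j := fun i j hij =>
    max_le_max_left _ (min_le_min_left _ (hmono m i j hij))
  have hds : ∀ i, s ≤ d i := fun i => le_max_left _ _
  have hdt : ∀ i, d i ≤ t := fun i => max_le hst (min_le_left _ _)
  have hsew := discrete_sewing hθ hK d (2 ^ m) (fun i j hij _ => hdm i j hij)
    (fun i j => h (d i) (d j)) (fun i _ => h0 _)
    (fun i j k hij hjk _ => hδ _ _ _ (hs.trans (hds i)) (hdm i j hij) (hdm j k hjk)
      ((hdt k).trans htT)) (2 ^ m) 0 (by simp)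
  have hd0 : d 0 = s := by
    simp only [hd, ha0]; rw [min_eq_right (hs.trans hst), max_eq_left hs]
  have hd1 : d (2 ^ m) = t := by
    simp only [hd, haT]; rw [min_eq_left htT, max_eq_right hst]
  simp only [zero_add, hd0, hd1] at hsew
  -- Cells on either side of `s` cancel exactly. The cell that contains `s` is cut there and leaves
  -- one coboundary. Charging this to every cell is wasteful, but the sum still tends to `0`.
  have hcell : ‖S m t - S m s - ∑ i ∈ Finset.range (2 ^ m), h (d i) (d (i + 1))‖ ≤
      K * T ^ θ * r ^ m := by
    rw [hSdef, hSdef, ← Finset.sum_sub_distrib, ← Finset.sum_sub_distrib]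
    refine (norm_sum_le _ _).trans ?_
    rw [← two_pow_mul_rpow_div hT K m]
    refine (Finset.sum_le_card_nsmul _ _ (K * (T / 2 ^ m) ^ θ) fun i _ => ?_).trans
      (le_of_eq (by simp))
    have l1 := hmono m i (i + 1) (by omega)
    have hB : 0 ≤ K * (T / 2 ^ m) ^ θ := by positivity
    simp only [hd]
    rcases le_total s (a m i) with h1 | h1
    · have h2 : s ≤ min t (a m i) := le_min hst h1
      have h3 : s ≤ min t (a m (i + 1)) := le_min hst (h1.trans l1)
      rw [min_eq_left h1, min_eq_left (h1.trans l1), max_eq_right h2, max_eq_right h3, h0]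
      simpa using hB
    · rcases le_total s (a m (i + 1)) with h4 | h4
      · have h3 : s ≤ min t (a m (i + 1)) := le_min hst h4
        rw [min_eq_right h1, min_eq_left h4, max_eq_right h3, min_eq_right (h1.trans hst),
          max_eq_left h1]
        refine (hδ (a m i) s (min t (a m (i + 1))) (hnn _ _) h1 h3
          ((min_le_left _ _).trans htT)).trans ?_
        refine mul_le_mul_of_nonneg_left (Real.rpow_le_rpow ?_ ?_ (by linarith)) hK
        · exact sub_nonneg.2 (h1.trans h3)
        · rw [← hstep m i]; exact sub_le_sub_right (min_le_right _ _) _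
      · rw [min_eq_right h1, min_eq_right h4, min_eq_right (h1.trans hst),
          min_eq_right (h4.trans hst), max_eq_left h1, max_eq_left h4, h0]
        simpa using hB
  have : S m t - S m s - h s t =
      (S m t - S m s - ∑ i ∈ Finset.range (2 ^ m), h (d i) (d (i + 1))) -
      (h s t - ∑ i ∈ Finset.range (2 ^ m), h (d i) (d (i + 1))) := by abel
  rw [this]
  exact norm_sub_le_of_le hcell hsew

end Sewing

/-! ### Hölder seminorms as pointwise bounds, and continuity on the simplex. -/

section HolderBounds

variable {E : Type*} [NormedAddCommGroup E] {T κ : ℝ}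

theorem holder₂_le_ofReal {h : ℝ → ℝ → E} {C : ℝ}
    (hC : ∀ s t, 0 ≤ s → s < t → t ≤ T → ‖h s t‖ ≤ C * (t - s) ^ κ) :
    holder₂ T κ h ≤ ENNReal.ofReal C := by
  refine iSup_le fun s => iSup_le fun t => iSup_le fun hst => ?_
  have hp : 0 < (t - s) ^ κ := Real.rpow_pos_of_pos (sub_pos.2 hst.2.1) _
  rw [ENNReal.div_le_iff (by simpa using hp) (by simp), ← ENNReal.ofReal_mul' hp.le,
    ← ofReal_norm]
  exact ENNReal.ofReal_le_ofReal (hC s t hst.1 hst.2.1 hst.2.2)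

theorem holder₂_lt_top {h : ℝ → ℝ → E} {C : ℝ}
    (hC : ∀ s t, 0 ≤ s → s < t → t ≤ T → ‖h s t‖ ≤ C * (t - s) ^ κ) : holder₂ T κ h < ∞ :=
  (holder₂_le_ofReal hC).trans_lt ENNReal.ofReal_lt_top

theorem norm_le_of_holder₂_le {h : ℝ → ℝ → E} {C : ℝ} (hC0 : 0 ≤ C)
    (hC : holder₂ T κ h ≤ ENNReal.ofReal C) {s t : ℝ} (hs : 0 ≤ s) (hst : s < t) (ht : t ≤ T) :
    ‖h s t‖ ≤ C * (t - s) ^ κ := by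
  have hp : 0 < (t - s) ^ κ := Real.rpow_pos_of_pos (sub_pos.2 hst) _
  have h1 : ‖h s t‖ₑ / ENNReal.ofReal ((t - s) ^ κ) ≤ ENNReal.ofReal C :=
    by
    refine le_trans ?_ hC
    refine le_iSup_of_le s (le_iSup_of_le t (le_iSup_of_le ⟨hs, hst, ht⟩ le_rfl))
  rw [ENNReal.div_le_iff (by simpa using hp) (by simp), ← ENNReal.ofReal_mul' hp.le,
    ← ofReal_norm] at h1
  exact (ENNReal.ofReal_le_ofReal_iff (by positivity)).1 h1

theorem exists_bound_of_holder₂_lt_top {h : ℝ → ℝ → E} (hh : holder₂ T κ h < ∞) :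
    ∃ C, 0 ≤ C ∧ ∀ s t, 0 ≤ s → s < t → t ≤ T → ‖h s t‖ ≤ C * (t - s) ^ κ :=
  ⟨(holder₂ T κ h).toReal, ENNReal.toReal_nonneg, fun _ _ hs hst ht =>
    norm_le_of_holder₂_le ENNReal.toReal_nonneg (by rw [ENNReal.ofReal_toReal hh.ne]) hs hst ht⟩

theorem tendsto_holder₂_zero {h : ℕ → ℝ → ℝ → E}
    (hh : ∀ ε > 0, ∀ᶠ n in atTop, ∀ s t, 0 ≤ s → s < t → t ≤ T →
      ‖h n s t‖ ≤ ε * (t - s) ^ κ) : Tendsto (fun n => holder₂ T κ (h n)) atTop (𝓝 0) := by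
  rw [ENNReal.tendsto_nhds_zero]
  intro ε hε
  rcases eq_or_ne ε ∞ with rfl | hε'
  · simp
  filter_upwards [hh ε.toReal (ENNReal.toReal_pos hε.ne' hε')] with n hn
  simpa [ENNReal.ofReal_toReal hε'] using holder₂_le_ofReal hn

theorem eventually_of_tendsto_holder₂ {h : ℕ → ℝ → ℝ → E}
    (hh : Tendsto (fun n => holder₂ T κ (h n)) atTop (𝓝 0)) {ε : ℝ} (hε : 0 < ε) :
    ∀ᶠ n in atTop, ∀ s t, 0 ≤ s → s < t → t ≤ T → ‖h n s t‖ ≤ ε * (t - s) ^ κ := by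
  filter_upwards [ENNReal.tendsto_nhds_zero.1 hh (ENNReal.ofReal ε) (by simpa using hε)] with n hn
  intro s t hs hst ht
  exact norm_le_of_holder₂_le hε.le hn hs hst ht

/-- A germ with small values and small coboundaries near the diagonal is continuous. -/
theorem continuousOn_simplex_of_delta {h : ℝ → ℝ → E} {a b c C : ℝ} (hT : 0 ≤ T) (ha : 0 < a) (hb : 0 < b)
    (hc : 0 < c) (hC : 0 ≤ C)
    (hh : ∀ s t, 0 ≤ s → s ≤ t → t ≤ T → ‖h s t‖ ≤ C * (t - s) ^ c)
    (hδ : ∀ s u t, 0 ≤ s → s ≤ u → u ≤ t → t ≤ T →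
      ‖delta h s u t‖ ≤ C * ((u - s) ^ a * (t - u) ^ b + (u - s) ^ b * (t - u) ^ a)) :
    ContinuousOn (Function.uncurry h) (simplex T) := by
  -- Moving one end of the interval changes `h` by its value on the short piece plus one coboundary;
  -- `ω` dominates the sum of the two.
  set ω : ℝ → ℝ := fun x => C * x ^ c + C * (x ^ a * T ^ b + x ^ b * T ^ a) with hω
  have hω0 : Tendsto (fun x : ℝ => ω |x|) (𝓝 0) (𝓝 0) := by
    have hcont : Continuous fun x : ℝ => ω |x| := by
      simp only [hω]
      have h1 : ∀ p : ℝ, 0 < p → Continuous fun x : ℝ => |x| ^ p := fun p hp =>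
        (continuous_abs).rpow_const fun _ => Or.inr hp.le
      have := h1 a ha
      have := h1 b hb
      have := h1 c hc
      fun_prop
    have := hcont.tendsto 0
    simpa [hω, Real.zero_rpow ha.ne', Real.zero_rpow hb.ne', Real.zero_rpow hc.ne'] using this
  -- moving the left end
  have hleft : ∀ s s' t, 0 ≤ s → s ≤ s' → s' ≤ t → t ≤ T → ‖h s t - h s' t‖ ≤ ω (s' - s) := by
    intro s s' t hs h1 h2 ht
    have e : h s t - h s' t = h s s' + delta h s s' t := by unfold delta; abel
    rw [e]
    refine norm_add_le_of_le (hh s s' hs h1 (h2.trans ht)) ((hδ s s' t hs h1 h2 ht).trans ?_)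
    have : t - s' ≤ T := by linarith
    have : 0 ≤ t - s' := by linarith
    have : 0 ≤ s' - s := by linarith
    gcongr
  have hright : ∀ s t t', 0 ≤ s → s ≤ t → t ≤ t' → t' ≤ T → ‖h s t' - h s t‖ ≤ ω (t' - t) := by
    intro s t t' hs h1 h2 ht
    have e : h s t' - h s t = h t t' + delta h s t t' := by unfold delta; abel
    rw [e]
    refine norm_add_le_of_le (hh t t' (hs.trans h1) h2 ht) ((hδ s t t' hs h1 h2 ht).trans ?_)
    have : t - s ≤ T := by linarith
    have : 0 ≤ t - s := by linarith
    have : 0 ≤ t' - t := by linarith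
    rw [add_comm, mul_comm ((t - s) ^ b), mul_comm ((t - s) ^ a)]
    gcongr
  have hmono : ∀ x y, 0 ≤ x → x ≤ y → ω x ≤ ω y := by
    intro x y hx hxy
    simp only [hω]
    gcongr
  have hle : ∀ x, 0 ≤ x → C * x ^ c ≤ ω x := fun x hx => by
    simp only [hω]
    exact le_add_of_nonneg_right (by positivity)
  have key : ∀ p ∈ simplex T, ∀ q ∈ simplex T, ‖h p.1 p.2 - h q.1 q.2‖ ≤
      2 * ω |p.1 - q.1| + 2 * ω |p.2 - q.2| := by
    rintro ⟨s, t⟩ ⟨hs, hst, ht⟩ ⟨s', t'⟩ ⟨hs', hst', ht'⟩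
    simp only at hs hst ht hs' hst' ht' ⊢
    have hω1 : 0 ≤ ω |s - s'| := by simp only [hω]; positivity
    have hω2 : 0 ≤ ω |t - t'| := by simp only [hω]; positivity
    have hbig : ∀ x y s t : ℝ, 0 ≤ x → x ≤ y → y ≤ T → y - x ≤ |s - t| →
        ‖h x y‖ ≤ ω |s - t| := fun x y s t h1 h2 h3 h4 =>
      (hh x y h1 h2 h3).trans ((hle _ (sub_nonneg.2 h2)).trans (hmono _ _ (sub_nonneg.2 h2) h4))
    -- Overlapping intervals are both compared with their intersection. If the intervals are
    -- disjoint, each of them is shorter than the displacement of one of the ends, so both values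
    -- are small.
    by_cases hm : max s s' ≤ min t t'
    · have aux : ∀ x y, 0 ≤ x → y ≤ T → x ≤ max s s' → min t t' ≤ y →
          max s s' - x ≤ |s - s'| → y - min t t' ≤ |t - t'| →
          ‖h x y - h (max s s') (min t t')‖ ≤ ω |s - s'| + ω |t - t'| := by
        intro x y hx hy h1 h2 h3 h4
        have := hleft x (max s s') y hx h1 (hm.trans h2) hy
        have := hright (max s s') (min t t') y (hx.trans h1) hm h2 hy
        rw [← sub_add_sub_cancel _ (h (max s s') y)]
        exact norm_add_le_of_le
          ((hleft x (max s s') y hx h1 (hm.trans h2) hy).trans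
            (hmono _ _ (sub_nonneg.2 h1) h3))
          ((hright (max s s') (min t t') y (hx.trans h1) hm h2 hy).trans
            (hmono _ _ (sub_nonneg.2 h2) h4))
      have a1 := aux s t hs ht (le_max_left _ _) (min_le_left _ _)
        (by rcases le_total s s' with h | h <;> simp [h, abs_nonneg, abs_sub_comm s s', le_abs_self])
        (by rcases le_total t t' with h | h <;> simp [h, abs_nonneg, le_abs_self])
      have a2 := aux s' t' hs' ht' (le_max_right _ _) (min_le_right _ _)
        (by rcases le_total s s' with h | h <;> simp [h, abs_nonneg, le_abs_self])
        (by rcases le_total t t' with h | h <;> simp [h, abs_nonneg, abs_sub_comm t t', le_abs_self])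
      rw [← sub_sub_sub_cancel_right _ _ (h (max s s') (min t t'))]
      exact (norm_sub_le_of_le a1 a2).trans_eq (by ring)
    · have hcase : t < s' ∨ t' < s := by
        by_contra hcon
        push Not at hcon
        exact hm (max_le (le_min hst hcon.2) (le_min hcon.1 hst'))
      rcases hcase with h1 | h1
      · have b1 := hbig s t s s' hs hst ht (by rw [abs_sub_comm]; exact le_trans (by linarith) (le_abs_self _))
        have b2 := hbig s' t' t t' hs' hst' ht' (by rw [abs_sub_comm]; exact le_trans (by linarith) (le_abs_self _))
        exact (norm_sub_le_of_le b1 b2).trans (by linarith)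
      · have b1 := hbig s t t t' hs hst ht (le_trans (by linarith) (le_abs_self _))
        have b2 := hbig s' t' s s' hs' hst' ht' (le_trans (by linarith) (le_abs_self _))
        exact (norm_sub_le_of_le b1 b2).trans (by linarith)
  intro q hq
  have hlim : Tendsto (fun p : ℝ × ℝ => 2 * ω |p.1 - q.1| + 2 * ω |p.2 - q.2|)
      (𝓝[simplex T] q) (𝓝 0) := by
    have c1 : Tendsto (fun p : ℝ × ℝ => p.1 - q.1) (𝓝[simplex T] q) (𝓝 0) := by
      have : Continuous fun p : ℝ × ℝ => p.1 - q.1 := by fun_prop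
      simpa using (this.tendsto q).mono_left nhdsWithin_le_nhds
    have c2 : Tendsto (fun p : ℝ × ℝ => p.2 - q.2) (𝓝[simplex T] q) (𝓝 0) := by
      have : Continuous fun p : ℝ × ℝ => p.2 - q.2 := by fun_prop
      simpa using (this.tendsto q).mono_left nhdsWithin_le_nhds
    simpa using ((hω0.comp c1).const_mul 2).add ((hω0.comp c2).const_mul 2)
  rw [ContinuousWithinAt, tendsto_iff_norm_sub_tendsto_zero]
  refine squeeze_zero' (Eventually.of_forall fun _ => norm_nonneg _) ?_ hlim
  filter_upwards [self_mem_nhdsWithin] with p hp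
  exact key p hp q hq

end HolderBounds

open TestFn

/-! ### Contractive exponential groups and Duhamel's formula. -/

section Exponential

variable {B : Type*} [NormedRing B] [NormedAlgebra ℂ B]

/-- The elements `x` for which the group `r ↦ exp (i r x)` is contractive. -/
def Hermitian (x : B) : Prop := ∀ r : ℝ, ‖expI r x‖ ≤ 1

theorem expI_eq (r : ℝ) (x : B) : expI r x = NormedSpace.exp (r • (Complex.I • x)) := by
  unfold expI
  rw [mul_comm, mul_smul, Complex.coe_smul]

theorem expI_zero (x : B) : expI 0 x = 1 := by
  rw [expI_eq, zero_smul, NormedSpace.exp_zero]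

/-- A normed ring may have `‖1‖ > 1`; the contraction at `r = 0` excludes this, which the zeroth
power of `x` needs. -/
theorem Hermitian.norm_one_le {x : B} (hx : Hermitian x) : ‖(1 : B)‖ ≤ 1 := by
  simpa [expI_zero] using hx 0

theorem Hermitian.norm_pow_le {x : B} (hx : Hermitian x) {R : ℝ} (hR : ‖x‖ ≤ R) (m : ℕ) :
    ‖x ^ m‖ ≤ R ^ m := by
  rcases Nat.eq_zero_or_pos m with rfl | hm
  · simpa using hx.norm_one_le
  · exact (norm_pow_le' x hm).trans (pow_le_pow_left₀ (norm_nonneg _) hR m)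

variable [CompleteSpace B]

theorem hasDerivAt_expI (x : B) (r : ℝ) :
    HasDerivAt (fun r => expI r x) (expI r x * (Complex.I • x)) r := by
  simp only [expI_eq]
  exact hasDerivAt_exp_smul_const (𝕂 := ℝ) (Complex.I • x) r

theorem hasDerivAt_expI' (x : B) (r : ℝ) :
    HasDerivAt (fun r => expI r x) ((Complex.I • x) * expI r x) r := by
  simp only [expI_eq]
  exact hasDerivAt_exp_smul_const' (𝕂 := ℝ) (Complex.I • x) r

theorem continuous_expI (x : B) : Continuous fun r => expI r x :=
  continuous_iff_continuousAt.2 fun r => (hasDerivAt_expI x r).continuousAt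

theorem continuous_expI_comp {Y : Type*} [TopologicalSpace Y] (x : B) {g : Y → ℝ}
    (hg : Continuous g) : Continuous fun y => expI (g y) x :=
  (continuous_expI x).comp hg

/-- Duhamel's formula. -/
theorem expI_sub_expI (ξ α : ℝ) (x y : B) :
    expI (α * ξ) y - expI (α * ξ) x =
      ∫ β in (0 : ℝ)..α, (Complex.I * ξ) •
        (expI (β * ξ) x * (y - x) * expI ((α - β) * ξ) y) := by
  -- The product runs from `exp (i α ξ y)` at `β = 0` to `exp (i α ξ x)` at `β = α`, whence the
  -- minus sign.
  have hd : ∀ β : ℝ, HasDerivAt (fun β : ℝ => expI (β * ξ) x * expI ((α - β) * ξ) y)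
      (-((Complex.I * ξ) • (expI (β * ξ) x * (y - x) * expI ((α - β) * ξ) y))) β := by
    intro β
    have h1 : HasDerivAt (fun β : ℝ => expI (β * ξ) x)
        (ξ • (expI (β * ξ) x * (Complex.I • x))) β := by
      have := (hasDerivAt_expI x (β * ξ)).scomp β (hasDerivAt_mul_const ξ)
      exact this
    have h2 : HasDerivAt (fun β : ℝ => expI ((α - β) * ξ) y)
        ((-ξ) • ((Complex.I • y) * expI ((α - β) * ξ) y)) β := by
      have h3 : HasDerivAt (fun β : ℝ => (α - β) * ξ) (-ξ) β := by
        simpa using ((hasDerivAt_id β).const_sub α).mul_const ξ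
      exact (hasDerivAt_expI' y ((α - β) * ξ)).scomp β h3
    refine (h1.mul h2).congr_deriv ?_
    rw [← Complex.coe_smul ξ, ← Complex.coe_smul (-ξ)]
    simp only [smul_mul_assoc, mul_smul_comm, mul_assoc, mul_sub, sub_mul, smul_sub, smul_smul,
      Complex.ofReal_neg, neg_smul, neg_sub, neg_mul, mul_neg]
    rw [mul_comm (Complex.I) (ξ : ℂ)]
    abel
  have hcont : Continuous fun β : ℝ =>
      (Complex.I * ξ) • (expI (β * ξ) x * (y - x) * expI ((α - β) * ξ) y) := by
    have h1 := continuous_expI_comp x (g := fun β : ℝ => β * ξ) (by fun_prop)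
    have h2 := continuous_expI_comp y (g := fun β : ℝ => (α - β) * ξ) (by fun_prop)
    fun_prop
  have := intervalIntegral.integral_eq_sub_of_hasDerivAt (fun β _ => hd β)
    (hcont.neg.intervalIntegrable 0 α)
  rw [intervalIntegral.integral_neg] at this
  rw [← neg_inj, this]
  simp [expI_zero]

/-- The derivative of `exp (i α ξ x)` in the direction `v`. -/
def expIDeriv (ξ α : ℝ) (x v : B) : B :=
  ∫ β in (0 : ℝ)..α, (Complex.I * ξ) • (expI (β * ξ) x * v * expI ((α - β) * ξ) x)

theorem norm_expI_sub_le {x y : B} (hx : Hermitian x) (hy : Hermitian y) {ξ α : ℝ} (hα : 0 ≤ α) :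
    ‖expI (α * ξ) y - expI (α * ξ) x‖ ≤ |ξ| * ‖y - x‖ * α := by
  rw [expI_sub_expI]
  refine (intervalIntegral.norm_integral_le_of_norm_le_const fun β _ => ?_).trans_eq
    (by rw [sub_zero, abs_of_nonneg hα])
  rw [norm_smul]
  have : ‖Complex.I * (ξ : ℂ)‖ = |ξ| := by simp
  rw [this]
  gcongr
  calc _ ≤ ‖expI (β * ξ) x‖ * ‖y - x‖ * ‖expI ((α - β) * ξ) y‖ := norm_mul₃_le' _ _ _
    _ ≤ 1 * ‖y - x‖ * 1 := by gcongr; exacts [hx _, hy _]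
    _ = _ := by ring

/-- In Duhamel's formula, replacing `y` by `x` in the last exponential gives the derivative, and the
cost is one more Lipschitz bound. The constant is not optimal. -/
theorem norm_expI_taylor_le {x y : B} (hx : Hermitian x) (hy : Hermitian y) {ξ α : ℝ}
    (hα : 0 ≤ α) :
    ‖expI (α * ξ) y - expI (α * ξ) x - expIDeriv ξ α x (y - x)‖ ≤
      |ξ| ^ 2 * ‖y - x‖ ^ 2 * α ^ 2 := by
  have hc : ∀ z : B, Continuous fun β : ℝ =>
      (Complex.I * ξ) • (expI (β * ξ) x * (y - x) * expI ((α - β) * ξ) z) := by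
    intro z
    have h1 := continuous_expI_comp x (g := fun β : ℝ => β * ξ) (by fun_prop)
    have h2 := continuous_expI_comp z (g := fun β : ℝ => (α - β) * ξ) (by fun_prop)
    fun_prop
  rw [expI_sub_expI, expIDeriv, ← intervalIntegral.integral_sub
    ((hc y).intervalIntegrable _ _) ((hc x).intervalIntegrable _ _)]
  have hbound : ∀ β ∈ Set.uIoc 0 α, ‖(Complex.I * ξ) • (expI (β * ξ) x * (y - x) *
      expI ((α - β) * ξ) y) - (Complex.I * ξ) • (expI (β * ξ) x * (y - x) *
      expI ((α - β) * ξ) x)‖ ≤ |ξ| ^ 2 * ‖y - x‖ ^ 2 * α := by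
    intro β hβ
    rw [uIoc_of_le hα] at hβ
    have : ‖Complex.I * (ξ : ℂ)‖ = |ξ| := by simp
    rw [← smul_sub, ← mul_sub, norm_smul, this]
    calc |ξ| * ‖expI (β * ξ) x * (y - x) * (expI ((α - β) * ξ) y - expI ((α - β) * ξ) x)‖
        ≤ |ξ| * (1 * ‖y - x‖ * (|ξ| * ‖y - x‖ * α)) := by
          gcongr
          refine (norm_mul₃_le' _ _ _).trans ?_
          gcongr
          · exact hx _
          · refine (norm_expI_sub_le hx hy (by linarith [hβ.2])).trans ?_
            gcongr
            linarith [hβ.1]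
      _ = _ := by ring
  refine (intervalIntegral.norm_integral_le_of_norm_le_const hbound).trans_eq ?_
  rw [sub_zero, abs_of_nonneg hα]; ring

theorem map_expI {C : Type*} [NormedRing C] [NormedAlgebra ℂ C] (φ : B →L[ℂ] C) (h1 : φ 1 = 1)
    (hm : ∀ a b, φ (a * b) = φ a * φ b) (r : ℝ) (x : B) : φ (expI r x) = expI r (φ x) := by
  let +nondep : NormedAlgebra ℚ B := .restrictScalars ℚ ℂ B
  let +nondep : NormedAlgebra ℚ C := .restrictScalars ℚ ℂ C
  have := NormedSpace.map_exp (AlgHom.ofLinearMap (φ : B →ₗ[ℂ] C) h1 hm) φ.continuous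
    ((Complex.I * (r : ℂ)) • x)
  unfold expI
  refine Eq.trans ?_ (this.trans ?_)
  · rfl
  · congr 1
    exact map_smul φ _ _

/-- Contractivity of the exponentials passes through homomorphisms without any reference to a star.
In particular `X_s` keeps it when regarded as an element of a larger `𝒜_t`. -/
theorem Hermitian.map {C : Type*} [NormedRing C] [NormedAlgebra ℂ C] (φ : B →L[ℂ] C)
    (h1 : φ 1 = 1) (hm : ∀ a b, φ (a * b) = φ a * φ b) (hφ : ∀ b, ‖φ b‖ ≤ ‖b‖) {x : B}
    (hx : Hermitian x) : Hermitian (φ x) := fun r => by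
  rw [← map_expI φ h1 hm]
  exact (hφ _).trans (hx r)

end Exponential

/-! ### Self-adjoint elements have contractive exponentials. -/

section SelfAdjoint

variable {A : Type*} [CStarAlgebra A]

theorem _root_.IsSelfAdjoint.hermitian {x : A} (hx : IsSelfAdjoint x) : Hermitian x := by
  intro r
  have hr : IsSelfAdjoint (r • x) := IsSelfAdjoint.smul (IsSelfAdjoint.all r) hx
  have hu := (selfAdjoint.expUnitary ⟨r • x, hr⟩).2
  rw [selfAdjoint.expUnitary_coe] at hu
  have e : expI r x = NormedSpace.exp (Complex.I • r • x) := by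
    rw [expI_eq, smul_comm]
  rw [e]
  -- A unitary has norm `1` only in a nontrivial algebra.
  rcases subsingleton_or_nontrivial A with h | h
  · rw [Subsingleton.elim (NormedSpace.exp (Complex.I • r • x)) 0]; simp
  · exact (CStarRing.norm_of_mem_unitary hu).le

end SelfAdjoint

/-! ### Integrals against the measure of a Fourier function. -/

section Weights

/-- The moment `∫ |ξ|^i |μ|(dξ)`. -/
def FourierFn.mom {k : ℕ} (μ : FourierFn k) (i : ℕ) : ℝ := ∫ ξ, |ξ| ^ i ∂μ.ν

theorem FourierFn.mom_nonneg {k : ℕ} (μ : FourierFn k) (i : ℕ) : 0 ≤ μ.mom i :=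
  integral_nonneg fun _ => by positivity

theorem FourierFn.isFiniteMeasure {k : ℕ} (μ : FourierFn k) : IsFiniteMeasure μ.ν := by
  have := μ.moment 0 (Nat.zero_le _)
  simpa [integrable_const_iff] using this

variable {k : ℕ} (μ : FourierFn k) {E : Type*} [NormedAddCommGroup E] [NormedSpace ℂ E]

/-- The weight brings `i` powers of `|ξ|`, one per tensor derivative already taken; the integrand
brings `j` further powers from Lipschitz or Taylor estimates. The moment of order `i + j` pays for
both. -/
theorem FourierFn.integrable_smul {w : ℝ → ℂ} (hw : Measurable w) {i j : ℕ}
    (hwi : ∀ ξ, ‖w ξ‖ ≤ |ξ| ^ i) (hij : i + j ≤ k) {g : ℝ → E} (hg : Continuous g) {C : ℝ}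
    (hC : ∀ ξ, ‖g ξ‖ ≤ C * |ξ| ^ j) : Integrable (fun ξ => w ξ • g ξ) μ.ν := by
  refine ((μ.moment (i + j) hij).const_mul C).mono'
    (hw.aestronglyMeasurable.smul hg.aestronglyMeasurable) (Eventually.of_forall fun ξ => ?_)
  rw [norm_smul]
  calc ‖w ξ‖ * ‖g ξ‖ ≤ |ξ| ^ i * (C * |ξ| ^ j) :=
        mul_le_mul (hwi ξ) (hC ξ) (norm_nonneg _) (by positivity)
    _ = _ := by ring

theorem FourierFn.norm_integral_smul_le {w : ℝ → ℂ} {i j : ℕ}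
    (hwi : ∀ ξ, ‖w ξ‖ ≤ |ξ| ^ i) (hij : i + j ≤ k) {g : ℝ → E} {C : ℝ}
    (hC : ∀ ξ, ‖g ξ‖ ≤ C * |ξ| ^ j) : ‖∫ ξ, w ξ • g ξ ∂μ.ν‖ ≤ C * μ.mom (i + j) := by
  rw [FourierFn.mom, ← integral_const_mul]
  refine norm_integral_le_of_norm_le ((μ.moment (i + j) hij).const_mul C)
    (Eventually.of_forall fun ξ => ?_)
  rw [norm_smul]
  calc ‖w ξ‖ * ‖g ξ‖ ≤ |ξ| ^ i * (C * |ξ| ^ j) :=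
        mul_le_mul (hwi ξ) (hC ξ) (norm_nonneg _) (by positivity)
    _ = _ := by ring

theorem FourierFn.continuous_integral_smul {Y : Type*} [TopologicalSpace Y]
    [FirstCountableTopology Y] {w : ℝ → ℂ} (hw : Measurable w) {i : ℕ}
    (hwi : ∀ ξ, ‖w ξ‖ ≤ |ξ| ^ i) (hi : i ≤ k) {g : Y → ℝ → E}
    (hg : Continuous (Function.uncurry g)) {C : ℝ} (hC : ∀ y ξ, ‖g y ξ‖ ≤ C) :
    Continuous fun y => ∫ ξ, w ξ • g y ξ ∂μ.ν := by
  refine continuous_of_dominated (bound := fun ξ => |ξ| ^ i * C) (fun y => ?_) (fun y => ?_)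
    ((μ.moment i hi).mul_const C) (Eventually.of_forall fun ξ => ?_)
  · exact hw.aestronglyMeasurable.smul (hg.comp (by fun_prop : Continuous fun ξ : ℝ => (y, ξ))).aestronglyMeasurable
  · refine Eventually.of_forall fun ξ => ?_
    rw [norm_smul]
    exact mul_le_mul (hwi ξ) (hC y ξ) (norm_nonneg _) (by positivity)
  · exact (hg.comp (by fun_prop : Continuous fun y : Y => (y, ξ))).const_smul (w ξ)

theorem FourierFn.integral_swap {w : ℝ → ℂ} (hw : Measurable w) {i : ℕ}
    (hwi : ∀ ξ, ‖w ξ‖ ≤ |ξ| ^ i) (hi : i ≤ k) {g : ℝ → ℝ → E}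
    (hg : Continuous (Function.uncurry g)) {C : ℝ} (hC : ∀ y ξ, ‖g y ξ‖ ≤ C) (a b : ℝ) :
    ∫ α in a..b, ∫ ξ, w ξ • g α ξ ∂μ.ν = ∫ ξ, w ξ • (∫ α in a..b, g α ξ) ∂μ.ν := by
  have := μ.isFiniteMeasure
  rw [intervalIntegral_integral_swap]
  · refine integral_congr_ae (Eventually.of_forall fun ξ => ?_)
    exact intervalIntegral.integral_smul (w ξ) fun α => g α ξ
  · have hfin : IsFiniteMeasure (volume.restrict (uIoc a b)) :=
      ⟨by simp [uIoc]⟩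
    refine (((integrable_const (1 : ℝ)).mul_prod ((μ.moment i hi).mul_const C))).mono' ?_
      (Eventually.of_forall fun p => ?_)
    · exact (hw.comp measurable_snd).aestronglyMeasurable.smul hg.aestronglyMeasurable
    · simp only [Function.uncurry, norm_smul, one_mul]
      exact mul_le_mul (hwi p.2) (hC p.1 p.2) (norm_nonneg _) (by positivity)

end Weights

/-- Fubini's theorem on the triangle `{α, β ≥ 0, α + β ≤ 1}`, in two parametrizations. -/
theorem integral_triangle {E : Type*} [NormedAddCommGroup E] [NormedSpace ℝ E]
    {G : ℝ → ℝ → E} (hG : Continuous (Function.uncurry G)) :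
    ∫ α in (0 : ℝ)..1, ∫ β in (0 : ℝ)..(1 - α), G α β =
      ∫ α in (0 : ℝ)..1, ∫ β in (0 : ℝ)..α, G β (α - β) := by
  -- In the coordinates given by the first variable and the sum `α` of the two, the triangle becomes
  -- `β < α`.
  set H : ℝ → ℝ → E := fun β α => G β (α - β) with hH
  have hHc : Continuous (Function.uncurry H) :=
    hG.comp (by fun_prop : Continuous fun p : ℝ × ℝ => (p.1, p.2 - p.1))
  set S : Set (ℝ × ℝ) := {p | p.1 < p.2} with hS
  have hSm : MeasurableSet S := measurableSet_lt measurable_fst measurable_snd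
  set F : ℝ → ℝ → E := fun β α => S.indicator (Function.uncurry H) (β, α) with hF
  have hint : Integrable (Function.uncurry F)
      ((volume.restrict (uIoc (0 : ℝ) 1)).prod (volume.restrict (uIoc (0 : ℝ) 1))) := by
    have e : Function.uncurry F = S.indicator (Function.uncurry H) := rfl
    rw [e, Measure.prod_restrict]
    refine Integrable.indicator ?_ hSm
    have : IntegrableOn (Function.uncurry H) (Icc (0 : ℝ) 1 ×ˢ Icc (0 : ℝ) 1) (volume.prod volume) :=
      hHc.continuousOn.integrableOn_compact (isCompact_Icc.prod isCompact_Icc)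
    exact this.mono_set (prod_mono (by rw [uIoc_of_le zero_le_one]; exact Ioc_subset_Icc_self)
      (by rw [uIoc_of_le zero_le_one]; exact Ioc_subset_Icc_self))
  have hswap := intervalIntegral_integral_swap hint
  rw [uIoc_of_le zero_le_one] at hswap
  have e1 : ∀ β ∈ uIcc (0 : ℝ) 1, ∫ b in (0 : ℝ)..(1 - β), G β b =
      ∫ α in Ioc (0 : ℝ) 1, F β α := by
    intro β hβ
    rw [uIcc_of_le zero_le_one] at hβ
    have h1 : ∫ b in (0 : ℝ)..(1 - β), G β b = ∫ α in β..1, H β α := by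
      have := intervalIntegral.integral_comp_sub_right (fun b => G β b) β (a := β) (b := 1)
      rw [sub_self] at this
      exact this.symm
    rw [h1, intervalIntegral.integral_of_le hβ.2]
    have h2 : ∀ α, F β α = (Ioi β).indicator (H β) α := fun α => by
      simp only [hF, hS, indicator, mem_ofPred_eq, mem_Ioi]; rfl
    simp only [h2]
    rw [setIntegral_indicator measurableSet_Ioi]
    congr 2
    ext z
    simp only [mem_Ioc, mem_inter_iff, mem_Ioi]
    exact ⟨fun h => ⟨⟨by linarith [hβ.1], h.2⟩, h.1⟩, fun h => ⟨h.2, h.1.2⟩⟩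
  have e2 : ∀ α ∈ Ioc (0 : ℝ) 1, ∫ β in (0 : ℝ)..1, F β α = ∫ β in (0 : ℝ)..α, G β (α - β) := by
    intro α hα
    rw [intervalIntegral.integral_of_le zero_le_one, intervalIntegral.integral_of_le hα.1.le]
    have h2 : ∀ β, F β α = (Iio α).indicator (fun β => H β α) β := fun β => by
      simp only [hF, hS, indicator, mem_ofPred_eq, mem_Iio]; rfl
    simp only [h2]
    rw [setIntegral_indicator measurableSet_Iio, integral_Ioc_eq_integral_Ioo]
    congr 2
    ext z
    simp only [mem_Ioc, mem_inter_iff, mem_Iio, mem_Ioo]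
    exact ⟨fun h => ⟨h.1.1, h.2⟩, fun h => ⟨⟨h.1, h.2.le.trans hα.2⟩, h.2⟩⟩
  rw [intervalIntegral.integral_congr e1, hswap, intervalIntegral.integral_of_le zero_le_one]
  exact setIntegral_congr_fun measurableSet_Ioc e2

/-! ### The bounds required of a test function, with auxiliary facts. -/

open TestFn

/-- The bounds on `f`, `∂f`, `∂²f` at two points `x`, `y`: size, Lipschitz bounds and first order
expansions. -/
structure TestFn.Bounds {k : ℕ} {B : Type*} [NormedRing B] [NormedAlgebra ℂ B] [CompleteSpace B]
    (f : TestFn k) (K : ℝ) (x y : B) : Prop where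
  norm_eval : ‖f.eval x‖ ≤ K
  norm_deriv₁ : ‖f.deriv₁ x‖ ≤ K
  norm_deriv₂ : ‖f.deriv₂ x‖ ≤ K
  lip_eval : ‖f.eval y - f.eval x‖ ≤ K * ‖y - x‖
  lip_deriv₁ : ‖f.deriv₁ y - f.deriv₁ x‖ ≤ K * ‖y - x‖
  lip_deriv₂ : ‖f.deriv₂ y - f.deriv₂ x‖ ≤ K * ‖y - x‖
  taylor_eval : ‖f.eval y - f.eval x - sharp (y - x) (f.deriv₁ x)‖ ≤ K * ‖y - x‖ ^ 2
  taylor_deriv₁ : ‖f.deriv₁ y - f.deriv₁ x - sharpLeft (y - x) (f.deriv₂ x)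
    - sharpRight (y - x) (f.deriv₂ x)‖ ≤ K * ‖y - x‖ ^ 2

/-- `a ↦ a ⊗ b` as a continuous linear map. -/
def tmulLeftL {B : Type*} [NormedAddCommGroup B] [NormedSpace ℂ B] (b : B) : B →L[ℂ] PTensor 2 B :=
  LinearMap.mkContinuous ⟨⟨fun a => tmulL 2 B ![a, b], (lin₂₀ b).map_add⟩, (lin₂₀ b).map_smul⟩
    ‖b‖ fun a => (norm_tmul₂_le a b).trans_eq (mul_comm _ _)

/-- `b ↦ a ⊗ b` as a continuous linear map. -/
def tmulRightL {B : Type*} [NormedAddCommGroup B] [NormedSpace ℂ B] (a : B) : B →L[ℂ] PTensor 2 B :=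
  LinearMap.mkContinuous ⟨⟨fun b => tmulL 2 B ![a, b], (lin₂₁ a).map_add⟩, (lin₂₁ a).map_smul⟩
    ‖a‖ fun b => norm_tmul₂_le a b

theorem tmulLeftL_apply {B : Type*} [NormedAddCommGroup B] [NormedSpace ℂ B] (a b : B) :
    tmulLeftL b a = tmul ![a, b] := rfl

theorem tmulRightL_apply {B : Type*} [NormedAddCommGroup B] [NormedSpace ℂ B] (a b : B) :
    tmulRightL a b = tmul ![a, b] := rfl

theorem integral_sub_sub {α E : Type*} [MeasurableSpace α] {ν : Measure α} [NormedAddCommGroup E]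
    [NormedSpace ℝ E] {f g h : α → E} (hf : Integrable f ν) (hg : Integrable g ν)
    (hh : Integrable h ν) :
    ∫ x, (f x - g x - h x) ∂ν = ∫ x, f x ∂ν - ∫ x, g x ∂ν - ∫ x, h x ∂ν := by
  rw [integral_sub (f := fun x => f x - g x) (hf.sub hg) hh, integral_sub hf hg]

theorem integral_sub_sub_sub {α E : Type*} [MeasurableSpace α] {ν : Measure α}
    [NormedAddCommGroup E] [NormedSpace ℝ E] {f g h i : α → E} (hf : Integrable f ν)
    (hg : Integrable g ν) (hh : Integrable h ν) (hi : Integrable i ν) :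
    ∫ x, (f x - g x - h x - i x) ∂ν = ∫ x, f x ∂ν - ∫ x, g x ∂ν - ∫ x, h x ∂ν - ∫ x, i x ∂ν := by
  rw [integral_sub (f := fun x => f x - g x - h x) ((hf.sub hg).sub hh) hi,
    integral_sub_sub hf hg hh]

theorem intervalIntegral_sub_sub_sub {E : Type*} [NormedAddCommGroup E] [NormedSpace ℝ E]
    {f g h i : ℝ → E} {a b : ℝ} (hf : IntervalIntegrable f volume a b)
    (hg : IntervalIntegrable g volume a b) (hh : IntervalIntegrable h volume a b)
    (hi : IntervalIntegrable i volume a b) :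
    ∫ x in a..b, (f x - g x - h x - i x) =
      (∫ x in a..b, f x) - (∫ x in a..b, g x) - (∫ x in a..b, h x) - ∫ x in a..b, i x := by
  rw [intervalIntegral.integral_sub (f := fun x => f x - g x - h x) ((hf.sub hg).sub hh) hi,
    intervalIntegral.integral_sub (f := fun x => f x - g x) (hf.sub hg) hh,
    intervalIntegral.integral_sub hf hg]

theorem norm_integral_unit_le {E : Type*} [NormedAddCommGroup E] [NormedSpace ℝ E] {f : ℝ → E}
    {C b : ℝ} (hb0 : 0 ≤ b) (hb : b ≤ 1) (hC : 0 ≤ C) (h : ∀ α, 0 ≤ α → α ≤ b → ‖f α‖ ≤ C) :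
    ‖∫ α in (0 : ℝ)..b, f α‖ ≤ C := by
  refine (intervalIntegral.norm_integral_le_of_norm_le_const (C := C) fun α hα => ?_).trans ?_
  · rw [uIoc_of_le hb0] at hα
    exact h α hα.1.le hα.2
  · rw [sub_zero, abs_of_nonneg hb0]
    exact mul_le_of_le_one_right hC hb

/-! ### Bounds for functions of the Fourier class. -/

section Fourier

variable (μ : FourierFn 3)

theorem FourierFn.norm_weight₀ (ξ : ℝ) : ‖μ.h ξ‖ ≤ |ξ| ^ 0 := by simpa using μ.norm_h_le ξ

/-- The weight of the first tensor derivative. -/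
def FourierFn.w₁ (ξ : ℝ) : ℂ := Complex.I * ξ * μ.h ξ

/-- The weight of the second tensor derivative. -/
def FourierFn.w₂ (ξ : ℝ) : ℂ := (ξ : ℂ) ^ 2 * μ.h ξ

theorem FourierFn.measurable_w₁ : Measurable μ.w₁ := by
  have := μ.measurable_h
  unfold FourierFn.w₁
  fun_prop

theorem FourierFn.measurable_w₂ : Measurable μ.w₂ := by
  have := μ.measurable_h
  unfold FourierFn.w₂
  fun_prop

theorem FourierFn.norm_w₁ (ξ : ℝ) : ‖μ.w₁ ξ‖ ≤ |ξ| ^ 1 := by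
  simp only [FourierFn.w₁, norm_mul, Complex.norm_I, one_mul, Complex.norm_real, Real.norm_eq_abs,
    pow_one]
  exact mul_le_of_le_one_right (abs_nonneg _) (μ.norm_h_le ξ)

theorem FourierFn.norm_w₂ (ξ : ℝ) : ‖μ.w₂ ξ‖ ≤ |ξ| ^ 2 := by
  simp only [FourierFn.w₂, norm_mul, norm_pow, Complex.norm_real, Real.norm_eq_abs]
  exact mul_le_of_le_one_right (by positivity) (μ.norm_h_le ξ)

/-- A second factor `iξ` turns the weight of `∂f` into minus that of `∂²f`; this is the sign in
front of `∂²f`. -/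
theorem FourierFn.w₁_mul (ξ : ℝ) : μ.w₁ ξ * (Complex.I * ξ) = -μ.w₂ ξ := by
  simp only [FourierFn.w₁, FourierFn.w₂]
  linear_combination ((ξ : ℂ) ^ 2 * μ.h ξ) * Complex.I_mul_I

variable {B : Type*} [NormedRing B] [NormedAlgebra ℂ B]

/-- `e^{iaξx} ⊗ e^{ibξx}`. -/
def exp₂ (x : B) (a b ξ : ℝ) : PTensor 2 B := tmul ![expI (a * ξ) x, expI (b * ξ) x]

/-- `e^{iaξx} ⊗ e^{ibξx} ⊗ e^{icξx}`. -/
def exp₃ (x : B) (a b c ξ : ℝ) : PTensor 3 B :=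
  tmul ![expI (a * ξ) x, expI (b * ξ) x, expI (c * ξ) x]

theorem Hermitian.norm_exp₂_le {x : B} (hx : Hermitian x) (a b ξ : ℝ) : ‖exp₂ x a b ξ‖ ≤ 1 :=
  (norm_tmul₂_le _ _).trans (mul_le_one₀ (hx _) (norm_nonneg _) (hx _))

theorem Hermitian.norm_exp₃_le {x : B} (hx : Hermitian x) (a b c ξ : ℝ) :
    ‖exp₃ x a b c ξ‖ ≤ 1 :=
  (norm_tmul₃_le _ _ _).trans
    (mul_le_one₀ (mul_le_one₀ (hx _) (norm_nonneg _) (hx _)) (norm_nonneg _) (hx _))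

/-- The factor `1` is kept so that the estimates for `exp (i α ξ x)` apply with `α = 1`. -/
theorem eval_fourier (x : B) :
    (fourier μ : TestFn 3).eval x = ∫ ξ, μ.h ξ • expI (1 * ξ) x ∂μ.ν := by
  simp only [one_mul]; rfl

theorem deriv₁_fourier (x : B) :
    (fourier μ : TestFn 3).deriv₁ x =
      ∫ α in (0 : ℝ)..1, ∫ ξ, μ.w₁ ξ • exp₂ x α (1 - α) ξ ∂μ.ν := rfl

theorem deriv₂_fourier (x : B) :
    (fourier μ : TestFn 3).deriv₂ x =
      -∫ α in (0 : ℝ)..1, ∫ β in (0 : ℝ)..(1 - α), ∫ ξ, μ.w₂ ξ • exp₃ x α β (1 - α - β) ξ ∂μ.ν :=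
  rfl

theorem norm_expI_mul_mul_le {x : B} (hx : Hermitian x) (v : B) (a b : ℝ) :
    ‖expI a x * v * expI b x‖ ≤ ‖v‖ := by
  refine (norm_mul₃_le' _ _ _).trans ?_
  calc _ ≤ 1 * ‖v‖ * 1 := by gcongr; exacts [hx _, hx _]
    _ = _ := by ring

theorem norm_expIDeriv_le {x : B} (hx : Hermitian x) (v : B) {a : ℝ} (ha0 : 0 ≤ a) (ha1 : a ≤ 1) (ξ : ℝ) :
    ‖expIDeriv ξ a x v‖ ≤ ‖v‖ * |ξ| := by
  refine norm_integral_unit_le ha0 ha1 (by positivity) fun β _ _ => ?_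
  rw [norm_smul]
  have : ‖Complex.I * (ξ : ℂ)‖ = |ξ| := by simp
  rw [this, mul_comm]
  gcongr
  exact norm_expI_mul_mul_le hx _ _ _

variable [CompleteSpace B]

theorem continuous_exp₂ {Y : Type*} [TopologicalSpace Y] (x : B) {a b ξ : Y → ℝ}
    (ha : Continuous a) (hb : Continuous b) (hξ : Continuous ξ) :
    Continuous fun y => exp₂ x (a y) (b y) (ξ y) :=
  continuous_tmul₂ (continuous_expI_comp x (ha.mul hξ)) (continuous_expI_comp x (hb.mul hξ))

theorem continuous_exp₃ {Y : Type*} [TopologicalSpace Y] (x : B) {a b c ξ : Y → ℝ}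
    (ha : Continuous a) (hb : Continuous b) (hc : Continuous c) (hξ : Continuous ξ) :
    Continuous fun y => exp₃ x (a y) (b y) (c y) (ξ y) :=
  continuous_tmul₃ (continuous_expI_comp x (ha.mul hξ)) (continuous_expI_comp x (hb.mul hξ))
    (continuous_expI_comp x (hc.mul hξ))

variable {x y : B}

theorem FourierFn.integrable_eval (hx : Hermitian x) :
    Integrable (fun ξ => μ.h ξ • expI (1 * ξ) x) μ.ν :=
  μ.integrable_smul μ.measurable_h μ.norm_weight₀ (j := 0) (C := 1) (by norm_num)
    (continuous_expI_comp x (by fun_prop)) fun ξ => by simpa using hx _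

theorem FourierFn.integrable_exp₂ (hx : Hermitian x) (a b : ℝ) :
    Integrable (fun ξ => μ.w₁ ξ • exp₂ x a b ξ) μ.ν :=
  μ.integrable_smul μ.measurable_w₁ μ.norm_w₁ (j := 0) (C := 1) (by norm_num)
    (continuous_exp₂ x continuous_const continuous_const continuous_id) fun ξ => by
      simpa using hx.norm_exp₂_le a b ξ

theorem FourierFn.integrable_exp₃ (hx : Hermitian x) (a b c : ℝ) :
    Integrable (fun ξ => μ.w₂ ξ • exp₃ x a b c ξ) μ.ν :=
  μ.integrable_smul μ.measurable_w₂ μ.norm_w₂ (j := 0) (C := 1) (by norm_num)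
    (continuous_exp₃ x continuous_const continuous_const continuous_const continuous_id) fun ξ => by
      simpa using hx.norm_exp₃_le a b c ξ

theorem FourierFn.continuous_int₂ (hx : Hermitian x) {Y : Type*} [TopologicalSpace Y]
    [FirstCountableTopology Y] {a b : Y → ℝ} (ha : Continuous a) (hb : Continuous b) :
    Continuous fun y => ∫ ξ, μ.w₁ ξ • exp₂ x (a y) (b y) ξ ∂μ.ν :=
  μ.continuous_integral_smul μ.measurable_w₁ μ.norm_w₁ (by norm_num)
    (g := fun y ξ => exp₂ x (a y) (b y) ξ)
    (continuous_exp₂ x (ha.comp continuous_fst) (hb.comp continuous_fst) continuous_snd)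
    (C := 1) fun _ _ => hx.norm_exp₂_le _ _ _

theorem FourierFn.continuous_int₃ (hx : Hermitian x) {Y : Type*} [TopologicalSpace Y]
    [FirstCountableTopology Y] {a b c : Y → ℝ} (ha : Continuous a) (hb : Continuous b)
    (hc : Continuous c) :
    Continuous fun y => ∫ ξ, μ.w₂ ξ • exp₃ x (a y) (b y) (c y) ξ ∂μ.ν :=
  μ.continuous_integral_smul μ.measurable_w₂ μ.norm_w₂ (by norm_num)
    (g := fun y ξ => exp₃ x (a y) (b y) (c y) ξ)
    (continuous_exp₃ x (ha.comp continuous_fst) (hb.comp continuous_fst) (hc.comp continuous_fst)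
      continuous_snd)
    (C := 1) fun _ _ => hx.norm_exp₃_le _ _ _ _

theorem norm_exp₂_sub_le (hx : Hermitian x) (hy : Hermitian y) {a b : ℝ} (ha : 0 ≤ a) (hb : 0 ≤ b)
    (hab : a + b ≤ 1) (ξ : ℝ) : ‖exp₂ y a b ξ - exp₂ x a b ξ‖ ≤ ‖y - x‖ * |ξ| ^ 1 := by
  refine (norm_tmul₂_sub_le _ _ _ _).trans ?_
  calc _ ≤ |ξ| * ‖y - x‖ * a * 1 + 1 * (|ξ| * ‖y - x‖ * b) := by
        gcongr
        exacts [norm_expI_sub_le hx hy ha, hy _, hx _, norm_expI_sub_le hx hy hb]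
    _ = |ξ| * ‖y - x‖ * (a + b) := by ring
    _ ≤ |ξ| * ‖y - x‖ * 1 := by gcongr
    _ = _ := by ring

theorem norm_exp₃_sub_le (hx : Hermitian x) (hy : Hermitian y) {a b c : ℝ} (ha : 0 ≤ a)
    (hb : 0 ≤ b) (hc : 0 ≤ c) (habc : a + b + c ≤ 1) (ξ : ℝ) :
    ‖exp₃ y a b c ξ - exp₃ x a b c ξ‖ ≤ ‖y - x‖ * |ξ| ^ 1 := by
  refine (norm_tmul₃_sub_le _ _ _ _ _ _).trans ?_
  calc _ ≤ |ξ| * ‖y - x‖ * a * 1 * 1 + 1 * (|ξ| * ‖y - x‖ * b) * 1 +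
        1 * 1 * (|ξ| * ‖y - x‖ * c) := by
        gcongr
        exacts [norm_expI_sub_le hx hy ha, hy _, hy _, hx _, norm_expI_sub_le hx hy hb, hy _,
          hx _, hx _, norm_expI_sub_le hx hy hc]
    _ = |ξ| * ‖y - x‖ * (a + b + c) := by ring
    _ ≤ |ξ| * ‖y - x‖ * 1 := by gcongr
    _ = _ := by ring

theorem norm_exp₂_taylor_le (hx : Hermitian x) (hy : Hermitian y) {a b : ℝ} (ha : 0 ≤ a)
    (hb : 0 ≤ b) (hab : a + b ≤ 1) (ξ : ℝ) :
    ‖exp₂ y a b ξ - exp₂ x a b ξ - tmul ![expIDeriv ξ a x (y - x), expI (b * ξ) x]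
      - tmul ![expI (a * ξ) x, expIDeriv ξ b x (y - x)]‖ ≤ 3 * ‖y - x‖ ^ 2 * |ξ| ^ 2 := by
  have ha1 : a ≤ 1 := by linarith
  have hb1 : b ≤ 1 := by linarith
  refine (norm_tmul₂_taylor_le _ _ _ _ _ _).trans ?_
  calc _ ≤ |ξ| ^ 2 * ‖y - x‖ ^ 2 * a ^ 2 * 1 + 1 * (|ξ| ^ 2 * ‖y - x‖ ^ 2 * b ^ 2) +
        |ξ| * ‖y - x‖ * a * (|ξ| * ‖y - x‖ * b) := by
        gcongr
        exacts [norm_expI_taylor_le hx hy ha, hx _, hx _, norm_expI_taylor_le hx hy hb,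
          norm_expI_sub_le hx hy ha, norm_expI_sub_le hx hy hb]
    _ = |ξ| ^ 2 * ‖y - x‖ ^ 2 * (a ^ 2 + b ^ 2 + a * b) := by ring
    _ ≤ |ξ| ^ 2 * ‖y - x‖ ^ 2 * 3 := by gcongr; nlinarith
    _ = _ := by ring

theorem expI_mul_mul_continuous (x v : B) {Y : Type*} [TopologicalSpace Y] {a b : Y → ℝ}
    (ha : Continuous a) (hb : Continuous b) :
    Continuous fun y => expI (a y) x * v * expI (b y) x :=
  ((continuous_expI_comp x ha).mul continuous_const).mul (continuous_expI_comp x hb)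

theorem continuous_expIDeriv (a : ℝ) (x v : B) : Continuous fun ξ : ℝ => expIDeriv ξ a x v := by
  unfold expIDeriv
  refine intervalIntegral.continuous_parametric_intervalIntegral_of_continuous
    (f := fun (ξ β : ℝ) => (Complex.I * (ξ : ℂ)) •
      (expI (β * ξ) x * v * expI ((a - β) * ξ) x)) ?_ continuous_const
  exact (by fun_prop : Continuous fun p : ℝ × ℝ => Complex.I * (p.1 : ℂ)).smul
    (expI_mul_mul_continuous x v (by fun_prop) (by fun_prop))

/-- Differentiating an exponential in `∂f` supplies both the missing factor `iξ` and the second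
simplex variable `β` of `∂²f`. -/
theorem smul_expIDeriv (ξ α : ℝ) (x v : B) {E : Type*} [NormedAddCommGroup E] [NormedSpace ℂ E]
    [CompleteSpace E] (φ : B →L[ℂ] E) :
    μ.w₁ ξ • φ (expIDeriv ξ α x v) =
      -(μ.w₂ ξ • ∫ β in (0 : ℝ)..α, φ (expI (β * ξ) x * v * expI ((α - β) * ξ) x)) := by
  have hc := expI_mul_mul_continuous x v (a := fun β : ℝ => β * ξ) (b := fun β => (α - β) * ξ)
    (by fun_prop) (by fun_prop)
  rw [φ.intervalIntegral_comp_comm (hc.intervalIntegrable _ _), expIDeriv,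
    intervalIntegral.integral_smul, map_smul, smul_smul, FourierFn.w₁_mul, neg_smul]

/-- Exchanging the integrals over `α` and `ξ` exhibits `∂f(x) ♯ v` as the derivative of `f` in the
direction `v`, with Duhamel's variable `α`. -/
theorem sharp_deriv₁_fourier (hx : Hermitian x) (v : B) :
    sharp v ((fourier μ : TestFn 3).deriv₁ x) = ∫ ξ, μ.h ξ • expIDeriv ξ 1 x v ∂μ.ν := by
  rw [deriv₁_fourier, ← (sharp v).intervalIntegral_comp_comm
    ((μ.continuous_int₂ hx (a := fun α : ℝ => α) (by fun_prop) (by fun_prop)).intervalIntegrable _ _)]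
  have e : ∀ α : ℝ, sharp v (∫ ξ, μ.w₁ ξ • exp₂ x α (1 - α) ξ ∂μ.ν) =
      ∫ ξ, μ.w₁ ξ • (expI (α * ξ) x * v * expI ((1 - α) * ξ) x) ∂μ.ν := by
    intro α
    rw [← (sharp v).integral_comp_comm (μ.integrable_exp₂ hx _ _)]
    congr 1; ext ξ
    rw [map_smul, exp₂, sharp_tmul]
  simp only [e]
  rw [μ.integral_swap μ.measurable_w₁ μ.norm_w₁ (by norm_num)
    (g := fun α ξ => expI (α * ξ) x * v * expI ((1 - α) * ξ) x)
    (expI_mul_mul_continuous x v (by fun_prop) (by fun_prop)) (C := ‖v‖)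
    (fun _ _ => norm_expI_mul_mul_le hx v _ _)]
  refine integral_congr_ae (Eventually.of_forall fun ξ => ?_)
  simp only
  rw [expIDeriv, intervalIntegral.integral_smul, smul_smul, FourierFn.w₁, mul_comm (μ.h ξ)]

theorem integral_expIDeriv_right (hx : Hermitian x) (v : B) (α : ℝ) :
    ∫ ξ, μ.w₁ ξ • tmul ![expI (α * ξ) x, expIDeriv ξ (1 - α) x v] ∂μ.ν =
      -sharpRight v (∫ β in (0 : ℝ)..(1 - α), ∫ ξ, μ.w₂ ξ • exp₃ x α β (1 - α - β) ξ ∂μ.ν) := by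
  have cβ : Continuous fun β => ∫ ξ, μ.w₂ ξ • exp₃ x α β (1 - α - β) ξ ∂μ.ν :=
    μ.continuous_int₃ hx (by fun_prop) (by fun_prop) (by fun_prop)
  rw [← (sharpRight v).intervalIntegral_comp_comm (cβ.intervalIntegrable _ _)]
  have e : ∀ β : ℝ, sharpRight v (∫ ξ, μ.w₂ ξ • exp₃ x α β (1 - α - β) ξ ∂μ.ν) =
      ∫ ξ, μ.w₂ ξ • tmul ![expI (α * ξ) x, expI (β * ξ) x * v * expI ((1 - α - β) * ξ) x] ∂μ.ν := by
    intro β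
    rw [← (sharpRight v).integral_comp_comm (μ.integrable_exp₃ hx _ _ _)]
    congr 1; ext ξ
    rw [map_smul, exp₃, sharpRight_tmul]
  simp only [e]
  rw [μ.integral_swap μ.measurable_w₂ μ.norm_w₂ (by norm_num)
    (g := fun β ξ => tmul ![expI (α * ξ) x, expI (β * ξ) x * v * expI ((1 - α - β) * ξ) x])
    (continuous_tmul₂ (continuous_expI_comp x (by fun_prop))
      (expI_mul_mul_continuous x v (by fun_prop) (by fun_prop))) (C := 1 * ‖v‖)
    (fun _ _ => (norm_tmul₂_le _ _).trans (mul_le_mul (hx _) (norm_expI_mul_mul_le hx v _ _)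
      (norm_nonneg _) zero_le_one)), ← integral_neg]
  congr 1; ext ξ
  exact smul_expIDeriv μ ξ (1 - α) x v (tmulRightL (expI (α * ξ) x))

theorem continuous_integral_exp₃_right (hx : Hermitian x) :
    Continuous fun α => ∫ β in (0 : ℝ)..(1 - α), ∫ ξ, μ.w₂ ξ • exp₃ x α β (1 - α - β) ξ ∂μ.ν := by
  have c3 : Continuous fun p : ℝ × ℝ => ∫ ξ, μ.w₂ ξ • exp₃ x p.1 p.2 (1 - p.1 - p.2) ξ ∂μ.ν :=
    μ.continuous_int₃ hx (by fun_prop) (by fun_prop) (by fun_prop)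
  exact intervalIntegral.continuous_parametric_intervalIntegral_of_continuous c3 (by fun_prop)

theorem continuous_integral_expIDeriv_right (hx : Hermitian x) (v : B) :
    Continuous fun α => ∫ ξ, μ.w₁ ξ • tmul ![expI (α * ξ) x, expIDeriv ξ (1 - α) x v] ∂μ.ν := by
  simp only [integral_expIDeriv_right μ hx v]
  exact ((sharpRight v).continuous.comp (continuous_integral_exp₃_right μ hx)).neg

/-- Differentiating the right factor `exp (i (1 - α) ξ x)` of `∂f` splits `1 - α` into `β` and `1 -
α - β`, which is the given parametrization of `∂²f`. -/
theorem sharpRight_deriv₂_fourier (hx : Hermitian x) (v : B) :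
    sharpRight v ((fourier μ : TestFn 3).deriv₂ x) =
      ∫ α in (0 : ℝ)..1, ∫ ξ, μ.w₁ ξ • tmul ![expI (α * ξ) x, expIDeriv ξ (1 - α) x v] ∂μ.ν := by
  rw [deriv₂_fourier, map_neg, ← (sharpRight v).intervalIntegral_comp_comm
    ((continuous_integral_exp₃_right μ hx).intervalIntegrable _ _),
    ← intervalIntegral.integral_neg]
  simp only [integral_expIDeriv_right μ hx v]

theorem integral_expIDeriv_left (hx : Hermitian x) (v : B) (α : ℝ) :
    ∫ ξ, μ.w₁ ξ • tmul ![expIDeriv ξ α x v, expI ((1 - α) * ξ) x] ∂μ.ν =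
      -sharpLeft v (∫ β in (0 : ℝ)..α, ∫ ξ, μ.w₂ ξ • exp₃ x β (α - β) (1 - α) ξ ∂μ.ν) := by
  have cβ : Continuous fun β => ∫ ξ, μ.w₂ ξ • exp₃ x β (α - β) (1 - α) ξ ∂μ.ν :=
    μ.continuous_int₃ hx (by fun_prop) (by fun_prop) (by fun_prop)
  rw [← (sharpLeft v).intervalIntegral_comp_comm (cβ.intervalIntegrable _ _)]
  have e : ∀ β : ℝ, sharpLeft v (∫ ξ, μ.w₂ ξ • exp₃ x β (α - β) (1 - α) ξ ∂μ.ν) =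
      ∫ ξ, μ.w₂ ξ • tmul ![expI (β * ξ) x * v * expI ((α - β) * ξ) x, expI ((1 - α) * ξ) x] ∂μ.ν := by
    intro β
    rw [← (sharpLeft v).integral_comp_comm (μ.integrable_exp₃ hx _ _ _)]
    congr 1; ext ξ
    rw [map_smul, exp₃, sharpLeft_tmul]
  simp only [e]
  rw [μ.integral_swap μ.measurable_w₂ μ.norm_w₂ (by norm_num)
    (g := fun β ξ => tmul ![expI (β * ξ) x * v * expI ((α - β) * ξ) x, expI ((1 - α) * ξ) x])
    (continuous_tmul₂ (expI_mul_mul_continuous x v (by fun_prop) (by fun_prop))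
      (continuous_expI_comp x (by fun_prop))) (C := ‖v‖ * 1)
    (fun _ _ => (norm_tmul₂_le _ _).trans (mul_le_mul (norm_expI_mul_mul_le hx v _ _) (hx _)
      (norm_nonneg _) (norm_nonneg _))), ← integral_neg]
  congr 1; ext ξ
  exact smul_expIDeriv μ ξ α x v (tmulLeftL (expI ((1 - α) * ξ) x))

theorem continuous_integral_exp₃_left (hx : Hermitian x) :
    Continuous fun α => ∫ β in (0 : ℝ)..α, ∫ ξ, μ.w₂ ξ • exp₃ x β (α - β) (1 - α) ξ ∂μ.ν := by
  have c3 : Continuous fun p : ℝ × ℝ => ∫ ξ, μ.w₂ ξ • exp₃ x p.2 (p.1 - p.2) (1 - p.1) ξ ∂μ.ν :=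
    μ.continuous_int₃ hx (by fun_prop) (by fun_prop) (by fun_prop)
  exact intervalIntegral.continuous_parametric_intervalIntegral_of_continuous c3 (by fun_prop)

theorem continuous_integral_expIDeriv_left (hx : Hermitian x) (v : B) :
    Continuous fun α => ∫ ξ, μ.w₁ ξ • tmul ![expIDeriv ξ α x v, expI ((1 - α) * ξ) x] ∂μ.ν := by
  simp only [integral_expIDeriv_left μ hx v]
  exact ((sharpLeft v).continuous.comp (continuous_integral_exp₃_left μ hx)).neg

/-- Differentiating the left factor `exp (i α ξ x)` splits `α` into `β` and `α - β` instead. The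
triangle then appears in the other parametrization, and `integral_triangle` reconciles the two. -/
theorem sharpLeft_deriv₂_fourier (hx : Hermitian x) (v : B) :
    sharpLeft v ((fourier μ : TestFn 3).deriv₂ x) =
      ∫ α in (0 : ℝ)..1, ∫ ξ, μ.w₁ ξ • tmul ![expIDeriv ξ α x v, expI ((1 - α) * ξ) x] ∂μ.ν := by
  have htri := integral_triangle (G := fun α β => ∫ ξ, μ.w₂ ξ • exp₃ x α β (1 - α - β) ξ ∂μ.ν)
    (μ.continuous_int₃ hx (by fun_prop) (by fun_prop) (by fun_prop))
  have harg : ∀ α β : ℝ, 1 - β - (α - β) = 1 - α := fun α β => by ring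
  simp only [harg] at htri
  rw [deriv₂_fourier, htri, map_neg, ← (sharpLeft v).intervalIntegral_comp_comm
    ((continuous_integral_exp₃_left μ hx).intervalIntegrable _ _),
    ← intervalIntegral.integral_neg]
  simp only [integral_expIDeriv_left μ hx v]

/-- The third moment is used for the Lipschitz bound on `∂²f` and for the expansion of `∂f`. The
factor `3` is that of `norm_exp₂_taylor_le`. The constant does not depend on the norms of `x` and
`y`. -/
theorem fourier_bounds (hx : Hermitian x) (hy : Hermitian y) :
    (fourier μ : TestFn 3).Bounds (3 * (μ.mom 0 + μ.mom 1 + μ.mom 2 + μ.mom 3)) x y := by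
  have m0 := μ.mom_nonneg 0
  have m1 := μ.mom_nonneg 1
  have m2 := μ.mom_nonneg 2
  have m3 := μ.mom_nonneg 3
  have hv := norm_nonneg (y - x)
  have c2 : ∀ {z : B}, Hermitian z → Continuous fun α : ℝ =>
      ∫ ξ, μ.w₁ ξ • exp₂ z α (1 - α) ξ ∂μ.ν := fun hz =>
    μ.continuous_int₂ hz (by fun_prop) (by fun_prop)
  have hi2 : ∀ {z : B}, Hermitian z → ∀ α : ℝ,
    Integrable (fun ξ => μ.w₁ ξ • exp₂ z α (1 - α) ξ) μ.ν := fun hz α =>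
    μ.integrable_exp₂ hz _ _
  refine ⟨?_, ?_, ?_, ?_, ?_, ?_, ?_, ?_⟩
  · rw [eval_fourier]
    refine (μ.norm_integral_smul_le μ.norm_weight₀ (j := 0) (C := 1) (by norm_num)
      fun ξ => by simpa using hx _).trans ?_
    simp only [add_zero]; linarith
  · rw [deriv₁_fourier]
    refine norm_integral_unit_le zero_le_one le_rfl (by positivity) fun α _ _ => ?_
    refine (μ.norm_integral_smul_le μ.norm_w₁ (j := 0) (C := 1) (by norm_num)
      fun ξ => by simpa using hx.norm_exp₂_le _ _ _).trans ?_
    simp only [add_zero]; linarith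
  · rw [deriv₂_fourier, norm_neg]
    refine norm_integral_unit_le zero_le_one le_rfl (by positivity) fun α h0 h1 => ?_
    refine norm_integral_unit_le (by linarith) (by linarith) (by positivity) fun β _ _ => ?_
    refine (μ.norm_integral_smul_le μ.norm_w₂ (j := 0) (C := 1) (by norm_num)
      fun ξ => by simpa using hx.norm_exp₃_le _ _ _ _).trans ?_
    simp only [add_zero]; linarith
  · rw [eval_fourier, eval_fourier, ← integral_sub (μ.integrable_eval hy) (μ.integrable_eval hx)]
    simp only [← smul_sub]
    refine (μ.norm_integral_smul_le μ.norm_weight₀ (j := 1) (C := ‖y - x‖) (by norm_num)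
      fun ξ => (norm_expI_sub_le hx hy zero_le_one).trans_eq (by ring)).trans ?_
    rw [mul_comm]; gcongr; simp only [zero_add]; linarith
  · rw [deriv₁_fourier, deriv₁_fourier, ← intervalIntegral.integral_sub
      ((c2 hy).intervalIntegrable _ _) ((c2 hx).intervalIntegrable _ _)]
    refine norm_integral_unit_le zero_le_one le_rfl (by positivity) fun α h0 h1 => ?_
    rw [← integral_sub (hi2 hy α) (hi2 hx α)]
    simp only [← smul_sub]
    refine (μ.norm_integral_smul_le μ.norm_w₁ (j := 1) (C := ‖y - x‖) (by norm_num)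
      fun ξ => norm_exp₂_sub_le hx hy h0 (by linarith) (by linarith) ξ).trans ?_
    rw [mul_comm]; gcongr; norm_num; linarith
  · have c3 : ∀ {z : B}, Hermitian z → ∀ α : ℝ, Continuous fun β =>
        ∫ ξ, μ.w₂ ξ • exp₃ z α β (1 - α - β) ξ ∂μ.ν := fun hz α =>
      μ.continuous_int₃ hz (by fun_prop) (by fun_prop) (by fun_prop)
    rw [deriv₂_fourier, deriv₂_fourier, ← neg_sub', norm_neg, ← intervalIntegral.integral_sub
      ((continuous_integral_exp₃_right μ hy).intervalIntegrable _ _)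
      ((continuous_integral_exp₃_right μ hx).intervalIntegrable _ _)]
    refine norm_integral_unit_le zero_le_one le_rfl (by positivity) fun α h0 h1 => ?_
    rw [← intervalIntegral.integral_sub
      ((c3 hy α).intervalIntegrable _ _) ((c3 hx α).intervalIntegrable _ _)]
    refine norm_integral_unit_le (by linarith) (by linarith) (by positivity) fun β h2 h3 => ?_
    rw [← integral_sub (μ.integrable_exp₃ hy _ _ _) (μ.integrable_exp₃ hx _ _ _)]
    simp only [← smul_sub]
    refine (μ.norm_integral_smul_le μ.norm_w₂ (j := 1) (C := ‖y - x‖) (by norm_num)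
      fun ξ => norm_exp₃_sub_le hx hy h0 h2 (by linarith) (by linarith) ξ).trans ?_
    rw [mul_comm]; gcongr; norm_num; linarith
  · have hiD : Integrable (fun ξ => μ.h ξ • expIDeriv ξ 1 x (y - x)) μ.ν := by
      exact μ.integrable_smul μ.measurable_h μ.norm_weight₀ (j := 1) (C := ‖y - x‖) (by norm_num)
        (continuous_expIDeriv 1 x (y - x)) fun ξ => by
          simpa using norm_expIDeriv_le hx (y - x) zero_le_one le_rfl ξ
    rw [sharp_deriv₁_fourier μ hx, eval_fourier, eval_fourier,
      ← integral_sub_sub (μ.integrable_eval hy) (μ.integrable_eval hx) hiD]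
    simp only [← smul_sub]
    refine (μ.norm_integral_smul_le μ.norm_weight₀ (j := 2) (C := ‖y - x‖ ^ 2) (by norm_num)
      fun ξ => (norm_expI_taylor_le hx hy zero_le_one).trans_eq (by ring)).trans ?_
    rw [mul_comm]; gcongr; simp only [zero_add]; linarith
  · have cl := continuous_integral_expIDeriv_left μ hx (y - x)
    have cr := continuous_integral_expIDeriv_right μ hx (y - x)
    rw [sharpLeft_deriv₂_fourier μ hx, sharpRight_deriv₂_fourier μ hx, deriv₁_fourier,
      deriv₁_fourier, ← intervalIntegral_sub_sub_sub ((c2 hy).intervalIntegrable _ _)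
      ((c2 hx).intervalIntegrable _ _) (cl.intervalIntegrable _ _) (cr.intervalIntegrable _ _)]
    refine norm_integral_unit_le zero_le_one le_rfl (by positivity) fun α h0 h1 => ?_
    have cD := fun a => continuous_expIDeriv a x (y - x)
    have nD := fun a (ha0 : 0 ≤ a) (ha1 : a ≤ 1) => norm_expIDeriv_le hx (y - x) ha0 ha1
    have il : Integrable (fun ξ => μ.w₁ ξ •
        tmul ![expIDeriv ξ α x (y - x), expI ((1 - α) * ξ) x]) μ.ν := by
      refine μ.integrable_smul μ.measurable_w₁ μ.norm_w₁ (j := 1) (C := ‖y - x‖) (by norm_num)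
        (continuous_tmul₂ (cD α) (continuous_expI_comp x (by fun_prop))) fun ξ => ?_
      refine (norm_tmul₂_le _ _).trans ?_
      rw [pow_one, ← mul_one (‖y - x‖ * |ξ|)]
      exact mul_le_mul (nD α h0 h1 ξ) (hx _) (norm_nonneg _) (by positivity)
    have ir : Integrable (fun ξ => μ.w₁ ξ •
        tmul ![expI (α * ξ) x, expIDeriv ξ (1 - α) x (y - x)]) μ.ν := by
      refine μ.integrable_smul μ.measurable_w₁ μ.norm_w₁ (j := 1) (C := ‖y - x‖) (by norm_num)
        (continuous_tmul₂ (continuous_expI_comp x (by fun_prop)) (cD (1 - α))) fun ξ => ?_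
      refine (norm_tmul₂_le _ _).trans ?_
      rw [pow_one, ← one_mul (‖y - x‖ * |ξ|)]
      exact mul_le_mul (hx _) (nD _ (by linarith) (by linarith) ξ) (norm_nonneg _) zero_le_one
    rw [← integral_sub_sub_sub (hi2 hy α) (hi2 hx α) il ir]
    simp only [← smul_sub]
    refine (μ.norm_integral_smul_le μ.norm_w₁ (j := 2) (C := 3 * ‖y - x‖ ^ 2) (by norm_num)
      fun ξ => norm_exp₂_taylor_le hx hy h0 (by linarith) (by linarith) ξ).trans ?_
    calc 3 * ‖y - x‖ ^ 2 * μ.mom 3 = 3 * μ.mom 3 * ‖y - x‖ ^ 2 := by ring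
      _ ≤ _ := by gcongr; linarith

end Fourier

/-! ### Bounds for monomials, by telescoping. -/

open TestFn

theorem norm_sum_range_le {E : Type*} [NormedAddCommGroup E] {u : ℕ → E} {C : ℝ} (m : ℕ)
    (h : ∀ i < m, ‖u i‖ ≤ C) : ‖∑ i ∈ Finset.range m, u i‖ ≤ m * C :=
  (norm_sum_le_of_le _ fun i hi => h i (Finset.mem_range.1 hi)).trans_eq (by simp)

theorem pow_sub_pow_eq {B : Type*} [Ring B] (m : ℕ) (x y : B) :
    y ^ m - x ^ m = ∑ i ∈ Finset.range m, y ^ i * (y - x) * x ^ (m - 1 - i) := by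
  have h : ∀ i ∈ Finset.range m, y ^ i * (y - x) * x ^ (m - 1 - i) =
      y ^ (i + 1) * x ^ (m - (i + 1)) - y ^ i * x ^ (m - i) := by
    intro i hi
    have hi' := Finset.mem_range.1 hi
    have e1 : m - (i + 1) = m - 1 - i := by omega
    have e2 : m - i = m - 1 - i + 1 := by omega
    rw [mul_sub, sub_mul, ← pow_succ, mul_assoc, ← pow_succ', e1, e2]
  rw [Finset.sum_congr rfl h, Finset.sum_range_sub (fun i => y ^ i * x ^ (m - i))]
  simp

section Monomials

variable {B : Type*} [NormedRing B] [NormedAlgebra ℂ B] {x y : B} {R : ℝ}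

/-- `∂x^m`. -/
def powDeriv₁ (m : ℕ) (x : B) : PTensor 2 B :=
  ∑ i ∈ Finset.range m, tmul ![x ^ i, x ^ (m - 1 - i)]

/-- `∂²x^m`. -/
def powDeriv₂ (m : ℕ) (x : B) : PTensor 3 B :=
  ∑ i ∈ Finset.range (m - 1), ∑ j ∈ Finset.range (m - 1 - i),
    tmul ![x ^ i, x ^ j, x ^ (m - 2 - i - j)]

/-- The directional derivative of `x^m`. -/
def powDir (m : ℕ) (x v : B) : B := ∑ i ∈ Finset.range m, x ^ i * v * x ^ (m - 1 - i)

theorem norm_pow_sub_le (hx : Hermitian x) (hy : Hermitian y) (hR : 1 ≤ R) (hxR : ‖x‖ ≤ R)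
    (hyR : ‖y‖ ≤ R) (m : ℕ) : ‖y ^ m - x ^ m‖ ≤ m * R ^ m * ‖y - x‖ := by
  rw [pow_sub_pow_eq]
  refine (norm_sum_range_le m (C := R ^ m * ‖y - x‖) fun i hi' => ?_).trans_eq (by ring)
  calc _ ≤ ‖y ^ i‖ * ‖y - x‖ * ‖x ^ (m - 1 - i)‖ := norm_mul₃_le' _ _ _
    _ ≤ R ^ i * ‖y - x‖ * R ^ (m - 1 - i) := by
      gcongr; exacts [hy.norm_pow_le hyR _, hx.norm_pow_le hxR _]
    _ = R ^ (i + (m - 1 - i)) * ‖y - x‖ := by rw [pow_add]; ring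
    _ ≤ R ^ m * ‖y - x‖ := by gcongr; omega

theorem norm_pow_taylor_le (hx : Hermitian x) (hy : Hermitian y) (hR : 1 ≤ R) (hxR : ‖x‖ ≤ R)
    (hyR : ‖y‖ ≤ R) (m : ℕ) :
    ‖y ^ m - x ^ m - powDir m x (y - x)‖ ≤ (m : ℝ) ^ 2 * R ^ m * ‖y - x‖ ^ 2 := by
  rw [pow_sub_pow_eq, powDir, ← Finset.sum_sub_distrib]
  refine (norm_sum_range_le m (C := m * R ^ m * ‖y - x‖ ^ 2) fun i hi' => ?_).trans_eq (by ring)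
  rw [← sub_mul, ← sub_mul]
  calc _ ≤ ‖y ^ i - x ^ i‖ * ‖y - x‖ * ‖x ^ (m - 1 - i)‖ := norm_mul₃_le' _ _ _
    _ ≤ (i * R ^ i * ‖y - x‖) * ‖y - x‖ * R ^ (m - 1 - i) := by
      gcongr; exacts [norm_pow_sub_le hx hy hR hxR hyR i, hx.norm_pow_le hxR _]
    _ = i * R ^ (i + (m - 1 - i)) * ‖y - x‖ ^ 2 := by rw [pow_add]; ring
    _ ≤ m * R ^ m * ‖y - x‖ ^ 2 := by
      gcongr; omega

theorem sharp_powDeriv₁ [CompleteSpace B] (m : ℕ) (x v : B) :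
    sharp v (powDeriv₁ m x) = powDir m x v := by
  simp only [powDeriv₁, powDir, map_sum, sharp_tmul]

/-- Differentiating the left factor of `∂x^m` sums over a discrete triangle in other coordinates
than `∂²x^m`. The reindexing is the counterpart of `integral_triangle`. -/
theorem sharpLeft_powDeriv₂ (m : ℕ) (x v : B) :
    sharpLeft v (powDeriv₂ m x) =
      ∑ i ∈ Finset.range m, tmul ![powDir i x v, x ^ (m - 1 - i)] := by
  have h : ∀ i, tmul ![powDir i x v, x ^ (m - 1 - i)] =
      ∑ j ∈ Finset.range i, tmul ![x ^ j * v * x ^ (i - 1 - j), x ^ (m - 1 - i)] := by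
    intro i
    rw [← tmulLeftL_apply, powDir, map_sum]; rfl
  simp only [h, powDeriv₂, map_sum, sharpLeft_tmul]
  rcases Nat.eq_zero_or_pos m with rfl | hm
  · simp
  obtain ⟨n, rfl⟩ : ∃ n, m = n + 1 := ⟨m - 1, by omega⟩
  -- The term with `i = 0` differentiates `x^0` and vanishes; without it both sides run over
  -- triangles of the same size.
  rw [Finset.sum_range_succ', Finset.range_zero, Finset.sum_empty, add_zero]
  simp only [Nat.add_sub_cancel]
  rw [Finset.sum_sigma', Finset.sum_sigma']
  refine Finset.sum_bij' (fun p _ => ⟨p.1 + p.2, p.1⟩) (fun p _ => ⟨p.2, p.1 - p.2⟩) ?_ ?_ ?_ ?_ ?_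
  · rintro ⟨i, j⟩ h; simp only [Finset.mem_sigma, Finset.mem_range] at h ⊢; omega
  · rintro ⟨i, j⟩ h; simp only [Finset.mem_sigma, Finset.mem_range] at h ⊢; omega
  · rintro ⟨i, j⟩ h; simp
  · rintro ⟨i, j⟩ h
    simp only [Finset.mem_sigma, Finset.mem_range] at h
    have : j + (i - j) = i := by omega
    simp [this]
  · rintro ⟨i, j⟩ -
    have e1 : i + j - i = j := by omega
    have e2 : n + 1 - 2 - i - j = n - (i + j + 1) := by omega
    simp only [e1, e2]

theorem sharpRight_powDeriv₂ (m : ℕ) (x v : B) :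
    sharpRight v (powDeriv₂ m x) =
      ∑ i ∈ Finset.range m, tmul ![x ^ i, powDir (m - 1 - i) x v] := by
  have h : ∀ i, tmul ![x ^ i, powDir (m - 1 - i) x v] =
      ∑ j ∈ Finset.range (m - 1 - i), tmul ![x ^ i, x ^ j * v * x ^ (m - 1 - i - 1 - j)] := by
    intro i
    rw [← tmulRightL_apply, powDir, map_sum]; rfl
  simp only [h, powDeriv₂, map_sum, sharpRight_tmul]
  rcases Nat.eq_zero_or_pos m with rfl | hm
  · simp
  obtain ⟨n, rfl⟩ : ∃ n, m = n + 1 := ⟨m - 1, by omega⟩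
  rw [Finset.sum_range_succ]
  simp only [Nat.add_sub_cancel, Nat.sub_self, Finset.range_zero, Finset.sum_empty, add_zero]
  refine Finset.sum_congr rfl fun i _ => Finset.sum_congr rfl fun j _ => ?_
  have : n + 1 - 2 - i - j = n - i - 1 - j := by omega
  rw [this]

/-- The constant in the bounds for `x^m` on the ball of radius `R`. -/
def powConst (R : ℝ) (m : ℕ) : ℝ := 3 * ((m : ℝ) + 1) ^ 3 * R ^ m

/-- The factors in the estimates range from `1` to `3 m³` and all lie below `3 (m + 1)³`; the shift
covers `m = 0`. -/
theorem le_powConst (hR : 1 ≤ R) {m : ℕ} {c : ℝ} (hc : c ≤ 3 * ((m : ℝ) + 1) ^ 3) :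
    c * R ^ m ≤ powConst R m := by
  unfold powConst; gcongr

theorem norm_powDeriv₁_le (hx : Hermitian x) (hR : 1 ≤ R) (hxR : ‖x‖ ≤ R) (m : ℕ) :
    ‖powDeriv₁ m x‖ ≤ m * R ^ m := by
  refine norm_sum_range_le m fun i hi' => ?_
  calc _ ≤ ‖x ^ i‖ * ‖x ^ (m - 1 - i)‖ := norm_tmul₂_le _ _
    _ ≤ R ^ i * R ^ (m - 1 - i) := by
      gcongr; exacts [hx.norm_pow_le hxR _, hx.norm_pow_le hxR _]
    _ = R ^ (i + (m - 1 - i)) := by rw [pow_add]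
    _ ≤ R ^ m := by gcongr; omega

theorem norm_powDeriv₁_sub_le (hx : Hermitian x) (hy : Hermitian y) (hR : 1 ≤ R) (hxR : ‖x‖ ≤ R)
    (hyR : ‖y‖ ≤ R) (m : ℕ) :
    ‖powDeriv₁ m y - powDeriv₁ m x‖ ≤ (m : ℝ) ^ 2 * R ^ m * ‖y - x‖ := by
  unfold powDeriv₁
  rw [← Finset.sum_sub_distrib]
  refine (norm_sum_range_le m (C := m * R ^ m * ‖y - x‖) fun i hi' => ?_).trans_eq (by ring)
  have hcast : (i : ℝ) + ((m - 1 - i : ℕ) : ℝ) ≤ m := by exact_mod_cast (by omega)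
  calc _ ≤ ‖y ^ i - x ^ i‖ * ‖y ^ (m - 1 - i)‖ + ‖x ^ i‖ * ‖y ^ (m - 1 - i) - x ^ (m - 1 - i)‖ :=
        norm_tmul₂_sub_le _ _ _ _
    _ ≤ (i * R ^ i * ‖y - x‖) * R ^ (m - 1 - i) +
        R ^ i * ((m - 1 - i : ℕ) * R ^ (m - 1 - i) * ‖y - x‖) := by
      gcongr
      exacts [norm_pow_sub_le hx hy hR hxR hyR _, hy.norm_pow_le hyR _, hx.norm_pow_le hxR _,
        norm_pow_sub_le hx hy hR hxR hyR _]
    _ = (i + (m - 1 - i : ℕ)) * R ^ (i + (m - 1 - i)) * ‖y - x‖ := by rw [pow_add]; ring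
    _ ≤ m * R ^ m * ‖y - x‖ := by gcongr; omega

theorem norm_powDeriv₁_taylor_le (hx : Hermitian x) (hy : Hermitian y) (hR : 1 ≤ R)
    (hxR : ‖x‖ ≤ R) (hyR : ‖y‖ ≤ R) (m : ℕ) :
    ‖powDeriv₁ m y - powDeriv₁ m x - sharpLeft (y - x) (powDeriv₂ m x)
      - sharpRight (y - x) (powDeriv₂ m x)‖ ≤ 3 * (m : ℝ) ^ 3 * R ^ m * ‖y - x‖ ^ 2 := by
  rw [sharpLeft_powDeriv₂, sharpRight_powDeriv₂]
  unfold powDeriv₁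
  rw [← Finset.sum_sub_distrib, ← Finset.sum_sub_distrib, ← Finset.sum_sub_distrib]
  refine (norm_sum_range_le m (C := 3 * (m : ℝ) ^ 2 * R ^ m * ‖y - x‖ ^ 2) fun i hi' => ?_).trans_eq (by ring)
  have h1 : (i : ℝ) ≤ m := by exact_mod_cast hi'.le
  have h2 : ((m - 1 - i : ℕ) : ℝ) ≤ m := by exact_mod_cast (by omega)
  have h3 : (i : ℝ) ^ 2 + ((m - 1 - i : ℕ) : ℝ) ^ 2 + i * ((m - 1 - i : ℕ) : ℝ) ≤ 3 * (m : ℝ) ^ 2 := by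
    have a1 : (i : ℝ) ^ 2 ≤ (m : ℝ) ^ 2 := by gcongr
    have a2 : ((m - 1 - i : ℕ) : ℝ) ^ 2 ≤ (m : ℝ) ^ 2 := by gcongr
    have a3 : (i : ℝ) * ((m - 1 - i : ℕ) : ℝ) ≤ m * m := by gcongr
    linarith
  refine (norm_tmul₂_taylor_le _ _ _ _ _ _).trans ?_
  calc _ ≤ ((i : ℝ) ^ 2 * R ^ i * ‖y - x‖ ^ 2) * R ^ (m - 1 - i) +
        R ^ i * (((m - 1 - i : ℕ) : ℝ) ^ 2 * R ^ (m - 1 - i) * ‖y - x‖ ^ 2) +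
        (i * R ^ i * ‖y - x‖) * ((m - 1 - i : ℕ) * R ^ (m - 1 - i) * ‖y - x‖) := by
        gcongr
        exacts [norm_pow_taylor_le hx hy hR hxR hyR _, hx.norm_pow_le hxR _, hx.norm_pow_le hxR _,
          norm_pow_taylor_le hx hy hR hxR hyR _, norm_pow_sub_le hx hy hR hxR hyR _,
          norm_pow_sub_le hx hy hR hxR hyR _]
    _ = ((i : ℝ) ^ 2 + ((m - 1 - i : ℕ) : ℝ) ^ 2 + i * ((m - 1 - i : ℕ) : ℝ)) *
        R ^ (i + (m - 1 - i)) * ‖y - x‖ ^ 2 := by rw [pow_add]; ring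
    _ ≤ 3 * (m : ℝ) ^ 2 * R ^ m * ‖y - x‖ ^ 2 := by gcongr; omega

theorem norm_powDeriv₂_le (hx : Hermitian x) (hR : 1 ≤ R) (hxR : ‖x‖ ≤ R) (m : ℕ) :
    ‖powDeriv₂ m x‖ ≤ (m : ℝ) ^ 2 * R ^ m := by
  refine (norm_sum_range_le _ (C := m * R ^ m) fun i hi' => ?_).trans ?_
  · refine (norm_sum_range_le _ (C := R ^ m) fun j hj' => ?_).trans ?_
    · calc ‖tmul ![x ^ i, x ^ j, x ^ (m - 2 - i - j)]‖
          ≤ ‖x ^ i‖ * ‖x ^ j‖ * ‖x ^ (m - 2 - i - j)‖ := norm_tmul₃_le _ _ _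
        _ ≤ R ^ i * R ^ j * R ^ (m - 2 - i - j) := by
          gcongr
          exacts [hx.norm_pow_le hxR _, hx.norm_pow_le hxR _, hx.norm_pow_le hxR _]
        _ = R ^ (i + j + (m - 2 - i - j)) := by rw [pow_add, pow_add]
        _ ≤ R ^ m := by gcongr; omega
    · gcongr; omega
  · rw [sq, mul_assoc]; gcongr; omega

theorem norm_powDeriv₂_sub_le (hx : Hermitian x) (hy : Hermitian y) (hR : 1 ≤ R) (hxR : ‖x‖ ≤ R)
    (hyR : ‖y‖ ≤ R) (m : ℕ) :
    ‖powDeriv₂ m y - powDeriv₂ m x‖ ≤ (m : ℝ) ^ 3 * R ^ m * ‖y - x‖ := by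
  unfold powDeriv₂
  rw [← Finset.sum_sub_distrib]
  simp only [← Finset.sum_sub_distrib]
  refine (norm_sum_range_le _ (C := m * (m * R ^ m * ‖y - x‖)) fun i hi' => ?_).trans ?_
  · refine (norm_sum_range_le _ (C := m * R ^ m * ‖y - x‖) fun j hj' => ?_).trans ?_
    · have hcast : (i : ℝ) + j + ((m - 2 - i - j : ℕ) : ℝ) ≤ m := by exact_mod_cast (by omega)
      refine (norm_tmul₃_sub_le _ _ _ _ _ _).trans ?_
      calc ‖y ^ i - x ^ i‖ * ‖y ^ j‖ * ‖y ^ (m - 2 - i - j)‖ +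
            ‖x ^ i‖ * ‖y ^ j - x ^ j‖ * ‖y ^ (m - 2 - i - j)‖ +
            ‖x ^ i‖ * ‖x ^ j‖ * ‖y ^ (m - 2 - i - j) - x ^ (m - 2 - i - j)‖
          ≤ (i * R ^ i * ‖y - x‖) * R ^ j * R ^ (m - 2 - i - j) +
            R ^ i * (j * R ^ j * ‖y - x‖) * R ^ (m - 2 - i - j) +
            R ^ i * R ^ j * ((m - 2 - i - j : ℕ) * R ^ (m - 2 - i - j) * ‖y - x‖) := by
            gcongr
            exacts [norm_pow_sub_le hx hy hR hxR hyR _, hy.norm_pow_le hyR _, hy.norm_pow_le hyR _,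
              hx.norm_pow_le hxR _, norm_pow_sub_le hx hy hR hxR hyR _, hy.norm_pow_le hyR _,
              hx.norm_pow_le hxR _, hx.norm_pow_le hxR _, norm_pow_sub_le hx hy hR hxR hyR _]
        _ = (i + j + (m - 2 - i - j : ℕ)) * R ^ (i + j + (m - 2 - i - j)) * ‖y - x‖ := by
          rw [pow_add, pow_add]; ring
        _ ≤ m * R ^ m * ‖y - x‖ := by gcongr; omega
    · gcongr; omega
  · calc ((m - 1 : ℕ) : ℝ) * (m * (m * R ^ m * ‖y - x‖)) ≤ m * (m * (m * R ^ m * ‖y - x‖)) := by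
          gcongr; omega
      _ = _ := by ring

end Monomials

/-! ### Bounds for polynomials, and one constant for all test functions. -/

section Polynomials

variable {k : ℕ} (p : Polynomial ℂ) {B : Type*} [NormedRing B] [NormedAlgebra ℂ B]

theorem eval_poly (x : B) :
    (poly p : TestFn k).eval x = ∑ m ∈ p.support, p.coeff m • x ^ m := by
  change Polynomial.aeval x p = _
  rw [Polynomial.aeval_def, Polynomial.eval₂_eq_sum, Polynomial.sum_def]
  simp [Algebra.smul_def]

theorem deriv₁_poly (x : B) :
    (poly p : TestFn k).deriv₁ x = ∑ m ∈ p.support, p.coeff m • powDeriv₁ m x := rfl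

theorem deriv₂_poly (x : B) :
    (poly p : TestFn k).deriv₂ x = ∑ m ∈ p.support, p.coeff m • powDeriv₂ m x := rfl

/-- The constant in the bounds for a polynomial on the ball of radius `R`. -/
def polyConst (R : ℝ) : ℝ := ∑ m ∈ p.support, ‖p.coeff m‖ * powConst R m

theorem norm_sum_smul_le {E : Type*} [NormedAddCommGroup E] [NormedSpace ℂ E] {R c : ℝ}
    {u : ℕ → E} (hu : ∀ m, ‖u m‖ ≤ powConst R m * c) :
    ‖∑ m ∈ p.support, p.coeff m • u m‖ ≤ polyConst p R * c := by
  rw [polyConst, Finset.sum_mul]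
  refine norm_sum_le_of_le _ fun m _ => ?_
  rw [norm_smul, mul_assoc]
  gcongr
  exact hu m

theorem poly_bounds [CompleteSpace B] {x y : B} {R : ℝ} (hx : Hermitian x) (hy : Hermitian y)
    (hR : 1 ≤ R) (hxR : ‖x‖ ≤ R) (hyR : ‖y‖ ≤ R) :
    (poly p : TestFn k).Bounds (polyConst p R) x y := by
  have hm : ∀ m : ℕ, (0 : ℝ) ≤ m := fun m => m.cast_nonneg
  refine ⟨?_, ?_, ?_, ?_, ?_, ?_, ?_, ?_⟩
  · rw [eval_poly, ← mul_one (polyConst p R)]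
    refine norm_sum_smul_le p fun m => ?_
    rw [mul_one]
    refine (hx.norm_pow_le hxR m).trans ((one_mul _).symm.trans_le (le_powConst hR ?_))
    nlinarith [hm m, pow_pos (show (0 : ℝ) < m + 1 by linarith [hm m]) 3,
      one_le_pow₀ (show (1 : ℝ) ≤ m + 1 by linarith [hm m]) (n := 3)]
  · rw [deriv₁_poly, ← mul_one (polyConst p R)]
    refine norm_sum_smul_le p fun m => ?_
    rw [mul_one]
    refine (norm_powDeriv₁_le hx hR hxR m).trans (le_powConst hR ?_)
    nlinarith [hm m, pow_nonneg (hm m) 2, pow_nonneg (hm m) 3]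
  · rw [deriv₂_poly, ← mul_one (polyConst p R)]
    refine norm_sum_smul_le p fun m => ?_
    rw [mul_one]
    refine (norm_powDeriv₂_le hx hR hxR m).trans (le_powConst hR ?_)
    nlinarith [hm m, pow_nonneg (hm m) 2, pow_nonneg (hm m) 3]
  · rw [eval_poly, eval_poly, ← Finset.sum_sub_distrib]
    simp only [← smul_sub]
    refine norm_sum_smul_le p fun m => (norm_pow_sub_le hx hy hR hxR hyR m).trans ?_
    gcongr
    refine le_powConst hR ?_
    nlinarith [hm m, pow_nonneg (hm m) 2, pow_nonneg (hm m) 3]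
  · rw [deriv₁_poly, deriv₁_poly, ← Finset.sum_sub_distrib]
    simp only [← smul_sub]
    refine norm_sum_smul_le p fun m => (norm_powDeriv₁_sub_le hx hy hR hxR hyR m).trans ?_
    gcongr
    refine le_powConst hR ?_
    nlinarith [hm m, pow_nonneg (hm m) 2, pow_nonneg (hm m) 3]
  · rw [deriv₂_poly, deriv₂_poly, ← Finset.sum_sub_distrib]
    simp only [← smul_sub]
    refine norm_sum_smul_le p fun m => (norm_powDeriv₂_sub_le hx hy hR hxR hyR m).trans ?_
    gcongr
    refine le_powConst hR ?_
    nlinarith [hm m, pow_nonneg (hm m) 2, pow_nonneg (hm m) 3]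
  · rw [eval_poly, eval_poly, deriv₁_poly, map_sum]
    simp only [map_smul]
    rw [← Finset.sum_sub_distrib, ← Finset.sum_sub_distrib]
    simp only [← smul_sub, sharp_powDeriv₁]
    refine norm_sum_smul_le p fun m => (norm_pow_taylor_le hx hy hR hxR hyR m).trans ?_
    gcongr
    refine le_powConst hR ?_
    nlinarith [hm m, pow_nonneg (hm m) 2, pow_nonneg (hm m) 3]
  · rw [deriv₁_poly, deriv₁_poly, deriv₂_poly, map_sum, map_sum]
    simp only [map_smul]
    rw [← Finset.sum_sub_distrib, ← Finset.sum_sub_distrib, ← Finset.sum_sub_distrib]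
    simp only [← smul_sub]
    refine norm_sum_smul_le p fun m => (norm_powDeriv₁_taylor_le hx hy hR hxR hyR m).trans ?_
    gcongr
    refine le_powConst hR ?_
    nlinarith [hm m, pow_nonneg (hm m) 2, pow_nonneg (hm m) 3]

end Polynomials

/-- A constant for the bounds on a test function on the ball of radius `R`. -/
def TestFn.const (f : TestFn 3) (R : ℝ) : ℝ :=
  match f with
  -- Lower powers of the radius are estimated by `R ^ m`, which asks for a radius of at least `1`.
  | poly p => polyConst p (max R 1)
  | fourier μ => 3 * (μ.mom 0 + μ.mom 1 + μ.mom 2 + μ.mom 3)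

theorem TestFn.const_nonneg (f : TestFn 3) (R : ℝ) : 0 ≤ f.const R := by
  cases f with
  | poly p =>
    refine Finset.sum_nonneg fun m _ => mul_nonneg (norm_nonneg _) ?_
    have : 0 ≤ max R 1 := zero_le_one.trans (le_max_right _ _)
    unfold powConst
    positivity
  | fourier μ =>
    have := μ.mom_nonneg 0
    have := μ.mom_nonneg 1
    have := μ.mom_nonneg 2
    have := μ.mom_nonneg 3
    simp only [TestFn.const]
    positivity

theorem TestFn.bounds (f : TestFn 3) {R : ℝ} {B : Type*} [NormedRing B] [NormedAlgebra ℂ B]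
    [CompleteSpace B] {x y : B} (hx : Hermitian x) (hy : Hermitian y) (hxR : ‖x‖ ≤ R)
    (hyR : ‖y‖ ≤ R) : f.Bounds (f.const R) x y := by
  cases f with
  | poly p =>
    exact poly_bounds p hx hy (le_max_right _ _) (hxR.trans (le_max_left _ _))
      (hyR.trans (le_max_left _ _))
  | fourier μ => exact fourier_bounds μ hx hy

/-! ### Functional calculus commutes with unital homomorphisms. -/

section Naturality

variable {B C : Type*} [NormedRing B] [NormedAlgebra ℂ B] [NormedRing C] [NormedAlgebra ℂ C]
  (φ : B →L[ℂ] C)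

theorem map_pow_of_mul (h1 : φ 1 = 1) (hm : ∀ a b, φ (a * b) = φ a * φ b) (x : B) (m : ℕ) :
    φ (x ^ m) = φ x ^ m := by
  induction m with
  | zero => simpa using h1
  | succ m ih => rw [pow_succ, hm, ih, pow_succ]

variable [CompleteSpace B]

/-- The adapted integrands are computed inside `𝒜_s`, the classical ones inside `𝒜`. This lemma and
the two that follow identify them, and also compare `𝒜_s` with `𝒜_t`. -/
theorem TestFn.map_eval [CompleteSpace C] (f : TestFn 3) (h1 : φ 1 = 1) (hm : ∀ a b, φ (a * b) = φ a * φ b) {x : B}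
    (hx : Hermitian x) : φ (f.eval x) = f.eval (φ x) := by
  cases f with
  | poly p => simp only [eval_poly, map_sum, map_smul, map_pow_of_mul φ h1 hm]
  | fourier μ =>
    rw [eval_fourier, eval_fourier, ← φ.integral_comp_comm (μ.integrable_eval hx)]
    simp only [map_smul, map_expI φ h1 hm]

theorem TestFn.map_deriv₁ (f : TestFn 3) (h1 : φ 1 = 1) (hm : ∀ a b, φ (a * b) = φ a * φ b)
    {x : B} (hx : Hermitian x) : tmap 2 φ (f.deriv₁ x) = f.deriv₁ (φ x) := by
  cases f with
  | poly p =>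
    simp only [deriv₁_poly, powDeriv₁, map_sum, map_smul, tmap_tmul₂, map_pow_of_mul φ h1 hm]
  | fourier μ =>
    have c : Continuous fun α : ℝ => ∫ ξ, μ.w₁ ξ • exp₂ x α (1 - α) ξ ∂μ.ν :=
      μ.continuous_int₂ hx (by fun_prop) (by fun_prop)
    rw [deriv₁_fourier, deriv₁_fourier,
      ← (tmap 2 φ).intervalIntegral_comp_comm (c.intervalIntegrable _ _)]
    congr 1; ext α
    rw [← (tmap 2 φ).integral_comp_comm (μ.integrable_exp₂ hx _ _)]
    simp only [map_smul, exp₂, tmap_tmul₂, map_expI φ h1 hm]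

theorem TestFn.map_deriv₂ (f : TestFn 3) (h1 : φ 1 = 1) (hm : ∀ a b, φ (a * b) = φ a * φ b)
    {x : B} (hx : Hermitian x) : tmap 3 φ (f.deriv₂ x) = f.deriv₂ (φ x) := by
  cases f with
  | poly p =>
    simp only [deriv₂_poly, powDeriv₂, map_sum, map_smul, tmap_tmul₃, map_pow_of_mul φ h1 hm]
  | fourier μ =>
    rw [deriv₂_fourier, deriv₂_fourier, map_neg, ← (tmap 3 φ).intervalIntegral_comp_comm
      ((continuous_integral_exp₃_right μ hx).intervalIntegrable _ _)]
    congr 2; ext α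
    have c : Continuous fun β : ℝ => ∫ ξ, μ.w₂ ξ • exp₃ x α β (1 - α - β) ξ ∂μ.ν :=
      μ.continuous_int₃ hx (by fun_prop) (by fun_prop) (by fun_prop)
    rw [← (tmap 3 φ).intervalIntegral_comp_comm (c.intervalIntegrable _ _)]
    congr 1; ext β
    rw [← (tmap 3 φ).integral_comp_comm (μ.integrable_exp₃ hx _ _ _)]
    simp only [map_smul, exp₃, tmap_tmul₃, map_expI φ h1 hm]

end Naturality

/-! ### Classical integrals along piecewise linear paths. -/

section Paths

variable {A : Type*} [CStarAlgebra A]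

/-- Self-adjoint Lipschitz paths that are differentiable off a countable set. -/
structure PLPath (x : ℝ → A) : Prop where
  lip : ∃ C, LipschitzWith C x
  diff : ∃ S : Set ℝ, S.Countable ∧ ∀ t ∉ S, DifferentiableAt ℝ x t
  sa : ∀ t, IsSelfAdjoint (x t)

variable {x : ℝ → A}

theorem PLPath.continuous (hx : PLPath x) : Continuous x := by
  obtain ⟨C, hC⟩ := hx.lip
  exact hC.continuous

theorem PLPath.sa_deriv (hx : PLPath x) (t : ℝ) : IsSelfAdjoint (deriv x t) := by
  have h : deriv (fun t => star (x t)) t = star (deriv x t) := deriv.star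
  have e : (fun t => star (x t)) = x := funext fun t => hx.sa t
  rw [e] at h
  exact h.symm

/-- The velocity is only measurable and bounded. Every integrand below is linear in it, with a
coefficient that is a continuous function of time. -/
theorem PLPath.intervalIntegrable (hx : PLPath x) {E : Type*} [NormedAddCommGroup E]
    [NormedSpace ℂ E] {Φ : ℝ → A →L[ℂ] E} (hΦ : Continuous Φ) (a b : ℝ) :
    IntervalIntegrable (fun u => Φ u (deriv x u)) volume a b := by
  obtain ⟨C, hC⟩ := hx.lip
  obtain ⟨M, hM⟩ := (isCompact_uIcc (a := a) (b := b)).exists_bound_of_continuousOn hΦ.continuousOn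
  rw [intervalIntegrable_iff]
  have hmeas : AEStronglyMeasurable (fun u => Φ u (deriv x u)) volume := by
    have h1 : Continuous fun p : (A →L[ℂ] E) × A => p.1 p.2 := by fun_prop
    exact h1.comp_aestronglyMeasurable (hΦ.aestronglyMeasurable.prodMk
      (stronglyMeasurable_deriv x).aestronglyMeasurable)
  refine Measure.integrableOn_of_bounded (M := M * C) (by simp [uIoc]) hmeas ?_
  filter_upwards [ae_restrict_mem measurableSet_uIoc] with u hu
  exact (Φ u).le_of_opNorm_le_of_le (hM u (uIoc_subset_uIcc hu))
    (norm_deriv_le_of_lipschitz hC)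

theorem PLPath.integral_deriv (hx : PLPath x) (s t : ℝ) :
    ∫ u in s..t, deriv x u = x t - x s := by
  obtain ⟨S, hS, hd⟩ := hx.diff
  refine integral_eq_of_hasDerivAt_off_countable x (deriv x) hS hx.continuous.continuousOn
    (fun u hu => (hd u hu.2).hasDerivAt) ?_
  exact hx.intervalIntegrable (Φ := fun _ => ContinuousLinearMap.id ℂ A) continuous_const s t

/-- `d ↦ (U ↦ (U ♯ v) d)` as a continuous linear map depending continuously on `v`. -/
theorem exists_sharpMul_clm (S : StarSubalgebra ℂ A) :
    ∃ Φ : A → A →L[ℂ] PTensor 2 S →L[ℂ] A, Continuous Φ ∧ ∀ v d, Φ v d = sharpMul S v d := by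
  refine ⟨fun v => ((ContinuousLinearMap.compL ℂ (PTensor 2 S) A A).flip
    ((sharpL A v).comp (tmap 2 (subIncl S)))).comp (ContinuousLinearMap.mul ℂ A).flip, ?_,
    fun v d => rfl⟩
  have h1 : Continuous fun v => (sharpL A v).comp (tmap 2 (subIncl S)) :=
    ((ContinuousLinearMap.compL ℂ (PTensor 2 S) (PTensor 2 A) A).flip
      (tmap 2 (subIncl S))).continuous.comp (sharpL A).continuous
  have h2 : Continuous fun v => (ContinuousLinearMap.compL ℂ (PTensor 2 S) A A).flip
    ((sharpL A v).comp (tmap 2 (subIncl S))) :=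
    (ContinuousLinearMap.compL ℂ (PTensor 2 S) A A).flip.continuous.comp h1
  exact (((ContinuousLinearMap.compL ℂ A (A →L[ℂ] A) (PTensor 2 S →L[ℂ] A)).flip
    (ContinuousLinearMap.mul ℂ A).flip).continuous).comp h2

theorem PLPath.intervalIntegrable_sharpMul (hx : PLPath x) (S : StarSubalgebra ℂ A) (r s t : ℝ) :
    IntervalIntegrable (fun u => sharpMul S (x u - x r) (deriv x u)) volume s t := by
  obtain ⟨Φ, hΦ, hΦ'⟩ := exists_sharpMul_clm S
  simpa only [hΦ'] using hx.intervalIntegrable (Φ := fun u => Φ (x u - x r))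
    (hΦ.comp (hx.continuous.sub continuous_const)) s t

theorem PLPath.intervalIntegrable_sharp (hx : PLPath x) {Y : ℝ → PTensor 2 A}
    (hY : Continuous Y) (s t : ℝ) :
    IntervalIntegrable (fun u => sharp (deriv x u) (Y u)) volume s t :=
  hx.intervalIntegrable (Φ := fun u => (sharpL A).flip (Y u))
    ((sharpL A).flip.continuous.comp hY) s t

/-- The smooth area as an operator on the projective tensor square of a subalgebra. -/
def areaOn (S : StarSubalgebra ℂ A) (x : ℝ → A) (s t : ℝ) : PTensor 2 S →L[ℂ] A :=
  ∫ u in s..t, sharpMul S (x u - x s) (deriv x u)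

/-- The operators `L × Id` and `Id × L⋆` require a bounded operator as input. The operator-valued
Bochner integral provides one, and evaluation commutes with it. -/
theorem PLPath.areaOn_apply (hx : PLPath x) (S : StarSubalgebra ℂ A) (s t : ℝ) (U : PTensor 2 S) :
    areaOn S x s t U = smoothArea x s t (tmap 2 (subIncl S) U) := by
  unfold areaOn smoothArea
  rw [ContinuousLinearMap.intervalIntegral_apply (hx.intervalIntegrable_sharpMul S s s t)]
  rfl

theorem tmap_subIncl_subInclLE {n : ℕ} {S S' : StarSubalgebra ℂ A} (h : S ≤ S')
    (U : PTensor n S) : tmap n (subIncl S') (tmap n (subInclLE h) U) = tmap n (subIncl S) U :=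
  tmap_comp (subIncl S') (subInclLE h) U

theorem PLPath.smoothArea_chen (hx : PLPath x) (s u t : ℝ) (V : PTensor 2 A) :
    smoothArea x s t V - smoothArea x s u V - smoothArea x u t V =
      sharp (x u - x s) V * (x t - x u) := by
  have h0 : ∀ r, Continuous fun w => sharp (x w - x r) V := fun r =>
    ((sharpL A).flip V).continuous.comp (hx.continuous.sub continuous_const)
  have hi : ∀ r a b, IntervalIntegrable (fun w => sharp (x w - x r) V * deriv x w) volume a b := by
    intro r a b
    have h1 : Continuous fun w => ContinuousLinearMap.mul ℂ A (sharp (x w - x r) V) :=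
      (ContinuousLinearMap.mul ℂ A).continuous.comp
        (h0 r)
    simpa only [ContinuousLinearMap.mul_apply'] using hx.intervalIntegrable h1 a b
  unfold smoothArea
  rw [intervalIntegral.integral_interval_sub_left (hi s s t) (hi s s u),
    ← intervalIntegral.integral_sub (hi s u t) (hi u u t), ← hx.integral_deriv u t]
  have hid : IntervalIntegrable (deriv x) volume u t :=
    hx.intervalIntegrable (Φ := fun _ => ContinuousLinearMap.id ℂ A) continuous_const u t
  have hc : ∫ w in u..t, sharp (x u - x s) V * deriv x w =
      sharp (x u - x s) V * ∫ w in u..t, deriv x w := by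
    simpa only [ContinuousLinearMap.mul_apply'] using
      (ContinuousLinearMap.mul ℂ A (sharp (x u - x s) V)).intervalIntegral_comp_comm hid
  rw [← hc]
  refine intervalIntegral.integral_congr fun w _ => ?_
  have e : sharp (x w - x s) V - sharp (x w - x u) V = sharp (x u - x s) V := by
    rw [← sharp_sub, sub_sub_sub_cancel_left]
  simp only [← sub_mul, e]

theorem PLPath.areaOn_chen (hx : PLPath x) {S S' : StarSubalgebra ℂ A} (h : S ≤ S') (s u t : ℝ)
    (U : PTensor 2 S) :
    areaOn S x s t U - areaOn S x s u U - areaOn S' x u t (tmap 2 (subInclLE h) U) =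
      sharp (x u - x s) (tmap 2 (subIncl S) U) * (x t - x u) := by
  rw [hx.areaOn_apply, hx.areaOn_apply, hx.areaOn_apply, tmap_subIncl_subInclLE]
  exact hx.smoothArea_chen s u t _

theorem continuous_of_areaBound {S : StarSubalgebra ℂ A} {g : (PTensor 2 S →L[ℂ] A) → A} {C : ℝ}
    (hsub : ∀ L L', g (L - L') = g L - g L') (hb : ∀ L, ‖g L‖ ≤ C * ‖L‖) : Continuous g := by
  have hC : 0 ≤ max C 0 := le_max_right _ _
  refine (LipschitzWith.of_dist_le_mul (K := ⟨max C 0, hC⟩) fun L L' => ?_).continuous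
  rw [dist_eq_norm, dist_eq_norm, ← hsub]
  exact (hb _).trans (mul_le_mul_of_nonneg_right (le_max_left _ _) (norm_nonneg _))

/-- Interchange of an additive operation on areas with the integral. -/
theorem PLPath.areaOn_comm (hx : PLPath x) {S : StarSubalgebra ℂ A}
    {g : (PTensor 2 S →L[ℂ] A) → A} {C : ℝ}
    (hsub : ∀ L L', g (L - L') = g L - g L') (hb : ∀ L, ‖g L‖ ≤ C * ‖L‖) (s t : ℝ) :
    g (areaOn S x s t) = ∫ u in s..t, g (sharpMul S (x u - x s) (deriv x u)) := by
  have h0 : g 0 = 0 := by simpa using hsub 0 0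
  -- The map `L ↦ (Id × L⋆)(V)` is conjugate-linear, so only real linearity is available; a
  -- continuous additive map has it.
  let G : (PTensor 2 S →L[ℂ] A) →+ A :=
    { toFun := g
      map_zero' := h0
      map_add' := fun L L' => by
        have h1 := hsub L (-L')
        have h2 := hsub 0 L'
        rw [sub_neg_eq_add] at h1
        rw [h1, ← zero_sub, h2, h0, zero_sub, sub_neg_eq_add] }
  let G' : (PTensor 2 S →L[ℂ] A) →L[ℝ] A :=
    G.toRealLinearMap (continuous_of_areaBound hsub hb)
  exact (G'.intervalIntegral_comp_comm (hx.intervalIntegrable_sharpMul S s s t)).symm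

theorem PLPath.areaTimesId_areaOn (hx : PLPath x) {S : StarSubalgebra ℂ A} (s t : ℝ)
    (V : PTensor 3 S) :
    areaTimesId (areaOn S x s t) V =
      ∫ u in s..t, sharp (deriv x u) (sharpLeft (x u - x s) (tmap 3 (subIncl S) V)) := by
  rw [hx.areaOn_comm (g := fun L => areaTimesId L V) (C := ‖V‖)
    (fun L L' => by rw [areaTimesId_sub]; rfl)
    (fun L => (norm_areaTimesId_le L (norm_nonneg _) L.le_opNorm V).trans_eq (mul_comm _ _))]
  simp only [areaTimesId_sharpMul]

theorem PLPath.idTimesAreaStar_areaOn (hx : PLPath x) {S : StarSubalgebra ℂ A} (s t : ℝ)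
    (V : PTensor 3 S) :
    idTimesAreaStar (areaOn S x s t) V =
      ∫ u in s..t, sharp (deriv x u) (sharpRight (x u - x s) (tmap 3 (subIncl S) V)) := by
  rw [hx.areaOn_comm (g := fun L => idTimesAreaStar L V) (C := ‖V‖)
    (fun L L' => by rw [idTimesAreaStar_sub]; rfl)
    (fun L => (norm_idTimesAreaStar_le L (norm_nonneg _) L.le_opNorm V).trans_eq (mul_comm _ _))]
  refine intervalIntegral.integral_congr fun u _ => ?_
  exact idTimesAreaStar_sharpMul ((hx.sa u).sub (hx.sa s)) (hx.sa_deriv u) V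

/-- On an interval where `x` is affine its derivative may be replaced by the slope. -/
theorem integral_deriv_eq_of_affine {E : Type*} [NormedAddCommGroup E] [NormedSpace ℝ E]
    {s t : ℝ} (hst : s ≤ t) {d : A} (hlin : ∀ u ∈ Icc s t, x u = x s + (u - s) • d)
    (Φ : ℝ → A → E) : ∫ u in s..t, Φ u (deriv x u) = ∫ u in s..t, Φ u d := by
  refine intervalIntegral.integral_congr_ae ?_
  -- The path may have a corner at `t`, so this point is discarded; `s` does not belong to the
  -- half-open interval.
  have hne : ∀ᵐ u : ℝ, u ≠ t := by simp [ae_iff]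
  filter_upwards [hne] with u hu hmem
  rw [uIoc_of_le hst] at hmem
  have hu' : u ∈ Ioo s t := ⟨hmem.1, lt_of_le_of_ne hmem.2 hu⟩
  have hd : HasDerivAt (fun u : ℝ => x s + (u - s) • d) d u := by
    simpa using (((hasDerivAt_id u).sub_const s).smul_const d).const_add (x s)
  have : HasDerivAt x d u := hd.congr_of_eventuallyEq <| by
    filter_upwards [Ioo_mem_nhds hu'.1 hu'.2] with w hw
    exact hlin w ⟨hw.1.le, hw.2.le⟩
  rw [this.deriv]

/-- On an affine piece, speed times length is the increment of the path. The bound thus avoids the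
Lipschitz constant of the interpolation, which is not uniform in the mesh. -/
theorem norm_integral_sharp_le_of_affine {s t : ℝ} (hst : s ≤ t) {d : A}
    (hlin : ∀ u ∈ Icc s t, x u = x s + (u - s) • d) {Y : ℝ → PTensor 2 A} {C : ℝ}
    (hY : ∀ u ∈ Icc s t, ‖Y u‖ ≤ C) :
    ‖∫ u in s..t, sharp (deriv x u) (Y u)‖ ≤ ‖x t - x s‖ * C := by
  rw [integral_deriv_eq_of_affine hst hlin fun u d => sharp d (Y u)]
  have hv : x t - x s = (t - s) • d := by rw [hlin t ⟨hst, le_rfl⟩, add_sub_cancel_left]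
  have hb : ∀ u ∈ uIoc s t, ‖sharp d (Y u)‖ ≤ ‖d‖ * C := fun u hu => by
    rw [uIoc_of_le hst] at hu
    exact (norm_sharp_le _ _).trans
      (mul_le_mul_of_nonneg_left (hY u ⟨hu.1.le, hu.2⟩) (norm_nonneg _))
  refine (intervalIntegral.norm_integral_le_of_norm_le_const hb).trans_eq ?_
  rw [hv, norm_smul, Real.norm_eq_abs]; ring

theorem norm_sub_le_of_affine {s t : ℝ} {d : A}
    (hlin : ∀ u ∈ Icc s t, x u = x s + (u - s) • d) {u : ℝ} (hu : u ∈ Icc s t) :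
    ‖x u - x s‖ ≤ ‖x t - x s‖ := by
  have hst : s ≤ t := hu.1.trans hu.2
  rw [hlin t ⟨hst, le_rfl⟩, hlin u hu, add_sub_cancel_left, add_sub_cancel_left, norm_smul,
    norm_smul, Real.norm_of_nonneg (sub_nonneg.2 hu.1), Real.norm_of_nonneg (sub_nonneg.2 hst)]
  gcongr
  exact hu.2

theorem PLPath.integral_sharp_const (hx : PLPath x) (U : PTensor 2 A) (s t : ℝ) :
    ∫ u in s..t, sharp (deriv x u) U = sharp (x t - x s) U := by
  rw [← hx.integral_deriv s t]
  exact ((sharpL A).flip U).intervalIntegral_comp_comm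
    (hx.intervalIntegrable (Φ := fun _ => ContinuousLinearMap.id ℂ A) continuous_const s t)

end Paths

/-! ### Partitions and linear interpolation. -/

section Interpolation

variable {A : Type*} [CStarAlgebra A] {T : ℝ} (D : TimePartition T)

theorem TimePartition.pt_mono {i j : ℕ} (hij : i ≤ j) (hj : j ≤ D.k) : D.pt i ≤ D.pt j := by
  induction hij with
  | refl => exact le_rfl
  | step _ ih => exact (ih (by omega)).trans (D.pt_lt _ (by omega)).le

theorem TimePartition.pt_mem {i : ℕ} (hi : i ≤ D.k) : D.pt i ∈ Icc 0 T :=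
  ⟨D.pt_zero ▸ D.pt_mono (Nat.zero_le i) hi, (D.pt_mono hi le_rfl).trans_eq D.pt_last⟩

theorem TimePartition.k_pos (hT : 0 < T) : 0 < D.k := by
  rcases Nat.eq_zero_or_pos D.k with h | h
  · have := D.pt_last
    rw [h, D.pt_zero] at this
    exact absurd this hT.ne
  · exact h

theorem TimePartition.step_le_mesh {i : ℕ} (hi : i < D.k) : D.pt (i + 1) - D.pt i ≤ D.mesh :=
  le_ciSup (f := fun i : Fin D.k => D.pt (i + 1) - D.pt i) (Set.finite_range _).bddAbove ⟨i, hi⟩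

theorem TimePartition.exists_cell (hT : 0 < T) {t : ℝ} (ht : t ∈ Icc 0 T) :
    ∃ i < D.k, t ∈ Icc (D.pt i) (D.pt (i + 1)) := by
  classical
  have hk := D.k_pos hT
  let P : ℕ → Prop := fun i => D.pt i ≤ t
  have hP0 : P 0 := by simpa [P, D.pt_zero] using ht.1
  have hsp := Nat.findGreatest_spec (P := P) (Nat.zero_le (D.k - 1)) hP0
  have hle := Nat.findGreatest_le (P := P) (D.k - 1)
  refine ⟨Nat.findGreatest P (D.k - 1), by omega, hsp, ?_⟩
  by_cases h : Nat.findGreatest P (D.k - 1) + 1 ≤ D.k - 1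
  · have := Nat.findGreatest_is_greatest (P := P) (Nat.lt_succ_self _) h
    exact (not_le.1 this).le
  · have : Nat.findGreatest P (D.k - 1) + 1 = D.k := by omega
    rw [this, D.pt_last]; exact ht.2

variable (X : ℝ → A)

theorem interp_pt {i : ℕ} (hi : i ≤ D.k) (hT : 0 < T) : interp X D (D.pt i) = X (D.pt i) := by
  rcases hi.lt_or_eq with h | rfl
  · rw [interp_apply X D h ⟨le_rfl, (D.pt_lt i h).le⟩]; simp
  · obtain ⟨n, hn⟩ : ∃ n, D.k = n + 1 := ⟨D.k - 1, by have := D.k_pos hT; omega⟩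
    have hlt : n < D.k := by omega
    have hp := sub_pos.2 (D.pt_lt n hlt)
    rw [hn, interp_apply X D hlt ⟨(D.pt_lt n hlt).le, le_rfl⟩, div_self hp.ne', one_smul,
      add_sub_cancel]

theorem interp_zero : interp X D 0 = X 0 := by
  unfold interp
  rw [Finset.sum_eq_zero, add_zero]
  intro i hi
  have hi' := Finset.mem_range.1 hi
  have h1 : 0 ≤ D.pt i := D.pt_zero ▸ D.pt_mono (Nat.zero_le i) hi'.le
  have h2 : (0 - D.pt i) / (D.pt (i + 1) - D.pt i) ≤ 0 :=
    div_nonpos_of_nonpos_of_nonneg (by linarith) (sub_pos.2 (D.pt_lt i hi')).le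
  rw [max_eq_left ((min_le_right _ _).trans h2), zero_smul]

theorem interp_affine {i : ℕ} (hi : i < D.k) {s t : ℝ} (hs : D.pt i ≤ s) (ht : t ≤ D.pt (i + 1)) :
    ∀ u ∈ Icc s t, interp X D u = interp X D s +
      (u - s) • ((D.pt (i + 1) - D.pt i)⁻¹ • (X (D.pt (i + 1)) - X (D.pt i))) := by
  intro u hu
  rw [interp_apply X D hi ⟨hs.trans hu.1, hu.2.trans ht⟩,
    interp_apply X D hi ⟨hs, (hu.1.trans hu.2).trans ht⟩, smul_smul, add_assoc, ← add_smul]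
  congr 2
  ring

theorem plPath_interp (hX : ∀ t ∈ Icc 0 T, IsSelfAdjoint (X t)) (hT : 0 < T) :
    PLPath (interp X D) := by
  refine ⟨?_, ?_, fun t => ?_⟩
  · have h : ∀ i ∈ Finset.range D.k, ∃ C, LipschitzWith C fun t : ℝ =>
        (max 0 (min 1 ((t - D.pt i) / (D.pt (i + 1) - D.pt i)))) •
          (X (D.pt (i + 1)) - X (D.pt i)) := by
      intro i _
      have h1 : LipschitzWith ‖(D.pt (i + 1) - D.pt i)⁻¹‖₊ fun t : ℝ =>
          (t - D.pt i) / (D.pt (i + 1) - D.pt i) := by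
        refine LipschitzWith.of_dist_le_mul fun a b => ?_
        rw [Real.dist_eq, Real.dist_eq, ← sub_div, sub_sub_sub_cancel_right, div_eq_mul_inv,
          abs_mul, mul_comm]
        rfl
      have h2 := (h1.const_min 1).const_max 0
      refine ⟨‖X (D.pt (i + 1)) - X (D.pt i)‖₊ * ‖(D.pt (i + 1) - D.pt i)⁻¹‖₊,
        LipschitzWith.of_dist_le_mul fun a b => ?_⟩
      rw [dist_eq_norm, ← sub_smul, norm_smul, mul_comm, NNReal.coe_mul, mul_assoc]
      exact mul_le_mul_of_nonneg_left (by simpa [dist_eq_norm] using h2.dist_le_mul a b)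
        (norm_nonneg _)
    choose! C hC using h
    refine ⟨∑ i ∈ Finset.range D.k, C i, LipschitzWith.of_dist_le_mul fun a b => ?_⟩
    simp only [interp, dist_eq_norm, add_sub_add_left_eq_sub, ← Finset.sum_sub_distrib,
      NNReal.coe_sum, Finset.sum_mul]
    exact norm_sum_le_of_le _ fun i hi => by simpa [dist_eq_norm] using (hC i hi).dist_le_mul a b
  -- Corners can only occur at the points `D.pt i`; the values with `i > D.k` are harmless, since a
  -- countable exceptional set is allowed.
  · refine ⟨range D.pt, countable_range _, fun t ht => ?_⟩
    have hne : ∀ i, t ≠ D.pt i := fun i h => ht ⟨i, h.symm⟩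
    unfold interp
    refine DifferentiableAt.const_add _ (DifferentiableAt.fun_sum fun i hi => ?_)
    have hp := sub_pos.2 (D.pt_lt i (Finset.mem_range.1 hi))
    refine DifferentiableAt.smul_const ?_ _
    rcases lt_or_gt_of_ne (hne i) with h | h
    · have : (fun t : ℝ => max 0 (min 1 ((t - D.pt i) / (D.pt (i + 1) - D.pt i)))) =ᶠ[𝓝 t]
          fun _ => (0 : ℝ) := by
        filter_upwards [Iio_mem_nhds h] with u hu
        exact max_eq_left ((min_le_right _ _).trans
          (div_nonpos_of_nonpos_of_nonneg (sub_nonpos.2 (mem_Iio.1 hu).le) hp.le))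
      exact (differentiableAt_const _).congr_of_eventuallyEq this
    rcases lt_or_gt_of_ne (hne (i + 1)) with h' | h'
    · have : (fun t : ℝ => max 0 (min 1 ((t - D.pt i) / (D.pt (i + 1) - D.pt i)))) =ᶠ[𝓝 t]
          fun t => (t - D.pt i) / (D.pt (i + 1) - D.pt i) := by
        filter_upwards [Ioo_mem_nhds h h'] with u hu
        rw [min_eq_right ((div_le_one hp).2 (by linarith [hu.2])),
          max_eq_right (div_nonneg (by linarith [hu.1]) hp.le)]
      exact ((differentiableAt_id.sub_const _).div_const _).congr_of_eventuallyEq this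
    · have : (fun t : ℝ => max 0 (min 1 ((t - D.pt i) / (D.pt (i + 1) - D.pt i)))) =ᶠ[𝓝 t]
          fun _ => (1 : ℝ) := by
        filter_upwards [Ioi_mem_nhds h'] with u hu
        rw [min_eq_left ((one_le_div hp).2 (by linarith [mem_Ioi.1 hu])),
          max_eq_right zero_le_one]
      exact (differentiableAt_const _).congr_of_eventuallyEq this
  · unfold interp
    refine (hX 0 ⟨le_rfl, hT.le⟩).add (isSelfAdjoint_sum _ fun i hi => ?_)
    have hi' := Finset.mem_range.1 hi
    exact IsSelfAdjoint.smul (IsSelfAdjoint.all _)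
      ((hX _ (D.pt_mem hi')).sub (hX _ (D.pt_mem hi'.le)))

/-- A bound on the whole line, not uniform in `D`. It serves the continuity of the integrands and
the fundamental theorem of calculus, not the convergence estimates. -/
theorem exists_norm_interp_le : ∃ R, ∀ t, ‖interp X D t‖ ≤ R := by
  refine ⟨‖X 0‖ + ∑ i ∈ Finset.range D.k, ‖X (D.pt (i + 1)) - X (D.pt i)‖, fun t => ?_⟩
  refine norm_add_le_of_le le_rfl (norm_sum_le_of_le _ fun i _ => ?_)
  rw [norm_smul]
  refine mul_le_of_le_one_left (norm_nonneg _) ?_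
  rw [Real.norm_of_nonneg (le_max_left _ _)]
  exact max_le zero_le_one (min_le_left _ _)

/-- For the degenerate range `γ > 1`, in which Hölder paths are constant. -/
theorem interp_const {c : A} (hX : ∀ t ∈ Icc 0 T, X t = c) (hT : 0 < T) : interp X D = fun _ => c := by
  funext t
  unfold interp
  rw [Finset.sum_eq_zero, add_zero, hX 0 ⟨le_rfl, hT.le⟩]
  intro i hi
  have hi' := Finset.mem_range.1 hi
  rw [hX _ (D.pt_mem hi'), hX _ (D.pt_mem hi'.le), sub_self, smul_zero]

end Interpolation

/-! ### Hölder paths. -/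

section HolderMem

variable {E : Type*} [NormedAddCommGroup E] {T κ : ℝ}

theorem continuousOn_of_holder (hκ : 0 < κ) {g : ℝ → E} {C : ℝ}
    (hC : ∀ s t, 0 ≤ s → s ≤ t → t ≤ T → ‖g t - g s‖ ≤ C * (t - s) ^ κ) :
    ContinuousOn g (Icc 0 T) := by
  intro s hs
  rw [ContinuousWithinAt, tendsto_iff_norm_sub_tendsto_zero]
  have h1 : Tendsto (fun t => C * |t - s| ^ κ) (𝓝[Icc 0 T] s) (𝓝 0) := by
    have : Continuous fun t : ℝ => C * |t - s| ^ κ := by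
      have h2 : Continuous fun t : ℝ => |t - s| := by fun_prop
      exact continuous_const.mul (h2.rpow_const fun _ => Or.inr hκ.le)
    have h3 := (this.tendsto s).mono_left (nhdsWithin_le_nhds (s := Icc 0 T))
    simpa [Real.zero_rpow hκ.ne'] using h3
  refine squeeze_zero' (Eventually.of_forall fun _ => norm_nonneg _) ?_ h1
  filter_upwards [self_mem_nhdsWithin] with t ht
  rcases le_total s t with h | h
  · rw [abs_of_nonneg (sub_nonneg.2 h)]; exact hC s t hs.1 h ht.2
  · rw [abs_of_nonpos (sub_nonpos.2 h), norm_sub_rev, neg_sub]; exact hC t s ht.1 h hs.2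

theorem memC₁_of_holder (hκ : 0 < κ) {g : ℝ → E} {C : ℝ}
    (hC : ∀ s t, 0 ≤ s → s ≤ t → t ≤ T → ‖g t - g s‖ ≤ C * (t - s) ^ κ) : MemC₁ T κ g :=
  ⟨continuousOn_of_holder hκ hC, holder₂_lt_top fun s t h0 hst ht => hC s t h0 hst.le ht⟩

theorem exists_holder_bound (hκ : 0 < κ) {g : ℝ → E} (hg : MemC₁ T κ g) :
    ∃ C, 0 ≤ C ∧ ∀ s t, 0 ≤ s → s ≤ t → t ≤ T → ‖g t - g s‖ ≤ C * (t - s) ^ κ := by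
  obtain ⟨C, hC, h⟩ := exists_bound_of_holder₂_lt_top hg.2
  refine ⟨C, hC, fun s t h0 hst ht => ?_⟩
  rcases hst.eq_or_lt with rfl | hst
  · simp [Real.zero_rpow hκ.ne']
  · exact h s t h0 hst ht

theorem rpow_le_mul_rpow {a b h : ℝ} (ha : 0 ≤ a) (hb : 0 < b) (hh : 0 ≤ h) (hT : h ≤ T) :
    h ^ (a + b) ≤ T ^ a * h ^ b := by
  rcases hh.eq_or_lt with rfl | hh
  · rw [Real.zero_rpow (by positivity), Real.zero_rpow hb.ne', mul_zero]
  · rw [Real.rpow_add hh]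
    gcongr

end HolderMem

/-! ### Chen's relation tensored with the identity. -/

section Chen

variable {A : Type*} [CStarAlgebra A] {S S' : StarSubalgebra ℂ A} (h : S ≤ S')
  {L₁ L₂ : PTensor 2 S →L[ℂ] A} {L₃ : PTensor 2 S' →L[ℂ] A} {x y : A}

theorem sub_comp_eq_sharpMul (hL : ∀ U, L₁ U - L₂ U - L₃ (tmap 2 (subInclLE h) U) =
    sharp x (tmap 2 (subIncl S) U) * y) :
    L₁ - L₂ - L₃.comp (tmap 2 (subInclLE h)) = sharpMul S x y :=
  ContinuousLinearMap.ext hL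

/-- The elements `x`, `y` are left free because the relation is used twice: with the increments of
`X` for the area itself, and with `x = y = 0` for the difference of two areas at partition points.
-/
theorem areaTimesId_of_chen (hL : ∀ U, L₁ U - L₂ U - L₃ (tmap 2 (subInclLE h) U) =
    sharp x (tmap 2 (subIncl S) U) * y) (V : PTensor 3 S) :
    areaTimesId L₁ V - areaTimesId L₂ V - areaTimesId L₃ (tmap 3 (subInclLE h) V) =
      sharp y (sharpLeft x (tmap 3 (subIncl S) V)) := by
  rw [← areaTimesId_sharpMul, ← sub_comp_eq_sharpMul h hL, areaTimesId_sub, areaTimesId_sub,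
    ← areaTimesId_comp_tmap]
  rfl

theorem idTimesAreaStar_of_chen (hx : IsSelfAdjoint x) (hy : IsSelfAdjoint y)
    (hL : ∀ U, L₁ U - L₂ U - L₃ (tmap 2 (subInclLE h) U) =
      sharp x (tmap 2 (subIncl S) U) * y) (V : PTensor 3 S) :
    idTimesAreaStar L₁ V - idTimesAreaStar L₂ V - idTimesAreaStar L₃ (tmap 3 (subInclLE h) V) =
      sharp y (sharpRight x (tmap 3 (subIncl S) V)) := by
  rw [← idTimesAreaStar_sharpMul hx hy, ← sub_comp_eq_sharpMul h hL, idTimesAreaStar_sub,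
    idTimesAreaStar_sub, ← idTimesAreaStar_comp_tmap]
  rfl

end Chen

/-! ### Rough drivers and integrands. -/

section Rough

variable {A : Type*} [CStarAlgebra A]

/-- A self-adjoint `γ`-Hölder path with a product Lévy area, both with constant `H`. -/
structure RoughDriver (T γ H : ℝ) (X : ℝ → A) (L : AreaFamily X) : Prop where
  pos : 0 < T
  lt_exp : 1 / 3 < γ
  nonneg : 0 ≤ H
  sa : ∀ t ∈ Icc 0 T, IsSelfAdjoint (X t)
  holder : ∀ s t, 0 ≤ s → s ≤ t → t ≤ T → ‖X t - X s‖ ≤ H * (t - s) ^ γ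
  area : ∀ s t, 0 ≤ s → s < t → t ≤ T → ∀ U : PTensor 2 (filt X s),
    ‖L s t U‖ ≤ H * (t - s) ^ (2 * γ) * ‖U‖
  chen : ∀ (s u t : ℝ) (_ : 0 ≤ s) (hsu : s < u) (_ : u < t) (_ : t ≤ T) (U : PTensor 2 (filt X s)),
    (L s t U : A) - L s u U - L u t (tmap 2 (subInclLE (filt_mono X hsu.le)) U) =
      sharp (X u - X s) (toAmbient 2 X s U) * (X t - X u)

/-- `F` is bounded and Lipschitz on self-adjoint elements of norm at most `R`, with first order
expansion given by the Lipschitz functions `F1`, `F2`. -/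
structure Expansion (F : A → PTensor 2 A) (F1 F2 : A → PTensor 3 A) (R K : ℝ) : Prop where
  nonneg : 0 ≤ K
  norm : ∀ x, IsSelfAdjoint x → ‖x‖ ≤ R → ‖F x‖ ≤ K
  lip : ∀ x y, IsSelfAdjoint x → IsSelfAdjoint y → ‖x‖ ≤ R → ‖y‖ ≤ R →
    ‖F y - F x‖ ≤ K * ‖y - x‖
  lip₁ : ∀ x y, IsSelfAdjoint x → IsSelfAdjoint y → ‖x‖ ≤ R → ‖y‖ ≤ R →
    ‖F1 y - F1 x‖ ≤ K * ‖y - x‖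
  lip₂ : ∀ x y, IsSelfAdjoint x → IsSelfAdjoint y → ‖x‖ ≤ R → ‖y‖ ≤ R →
    ‖F2 y - F2 x‖ ≤ K * ‖y - x‖
  taylor : ∀ x y, IsSelfAdjoint x → IsSelfAdjoint y → ‖x‖ ≤ R → ‖y‖ ≤ R →
    ‖F y - F x - sharpLeft (y - x) (F1 x) - sharpRight (y - x) (F2 x)‖ ≤ K * ‖y - x‖ ^ 2

/-- Adapted processes `U`, `U1`, `U2` that represent `F(X)`, `F1(X)`, `F2(X)`. -/
structure Represents (T : ℝ) (X : ℝ → A) (U : (s : ℝ) → PTensor 2 (filt X s))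
    (U1 U2 : (s : ℝ) → PTensor 3 (filt X s)) (F : A → PTensor 2 A) (F1 F2 : A → PTensor 3 A)
    (K : ℝ) : Prop where
  coe : ∀ s ∈ Icc 0 T, toAmbient 2 X s (U s) = F (X s)
  coe₁ : ∀ s ∈ Icc 0 T, toAmbient 3 X s (U1 s) = F1 (X s)
  coe₂ : ∀ s ∈ Icc 0 T, toAmbient 3 X s (U2 s) = F2 (X s)
  -- These bounds are taken in the tensor powers of `𝒜_s` and `𝒜_t`, where the areas act. The
  -- projective norm is not inherited by subspaces, so they do not follow from bounds over `𝒜`.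
  norm₁ : ∀ s ∈ Icc 0 T, ‖U1 s‖ ≤ K
  norm₂ : ∀ s ∈ Icc 0 T, ‖U2 s‖ ≤ K
  lip₁ : ∀ (s t : ℝ) (_ : 0 ≤ s) (hst : s ≤ t) (_ : t ≤ T),
    ‖U1 t - tmap 3 (subInclLE (filt_mono X hst)) (U1 s)‖ ≤ K * ‖X t - X s‖
  lip₂ : ∀ (s t : ℝ) (_ : 0 ≤ s) (hst : s ≤ t) (_ : t ≤ T),
    ‖U2 t - tmap 3 (subInclLE (filt_mono X hst)) (U2 s)‖ ≤ K * ‖X t - X s‖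

/-- The area `L_{st}` with values in the whole algebra. -/
def ambientArea {X : ℝ → A} (L : AreaFamily X) (s t : ℝ) : PTensor 2 (filt X s) →L[ℂ] A :=
  (subIncl (filt X t)).comp (L s t)

variable {T γ H R K : ℝ} {X : ℝ → A} {L : AreaFamily X} {U : (s : ℝ) → PTensor 2 (filt X s)}
  {U1 U2 : (s : ℝ) → PTensor 3 (filt X s)} {F : A → PTensor 2 A} {F1 F2 : A → PTensor 3 A}

theorem germ_of_lt {s t : ℝ} (hst : s < t) : germ X L U U1 U2 s t =
    sharp (X t - X s) (toAmbient 2 X s (U s)) + areaTimesId (ambientArea L s t) (U1 s)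
      + idTimesAreaStar (ambientArea L s t) (U2 s) := if_pos hst

theorem germ_self (t : ℝ) : germ X L U U1 U2 t t = 0 := if_neg (lt_irrefl t)

section Estimates

variable (hX : RoughDriver T γ H X L)
include hX

theorem RoughDriver.norm_areaTimesId_le {s t : ℝ} (hs : 0 ≤ s) (hst : s < t) (ht : t ≤ T)
    (V : PTensor 3 (filt X s)) :
    ‖areaTimesId (ambientArea L s t) V‖ ≤ H * (t - s) ^ (2 * γ) * ‖V‖ :=
  RoughNC.norm_areaTimesId_le _ (mul_nonneg hX.nonneg (Real.rpow_nonneg (sub_nonneg.2 hst.le) _))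
    (hX.area s t hs hst ht) V

theorem RoughDriver.norm_idTimesAreaStar_le {s t : ℝ} (hs : 0 ≤ s) (hst : s < t) (ht : t ≤ T)
    (V : PTensor 3 (filt X s)) :
    ‖idTimesAreaStar (ambientArea L s t) V‖ ≤ H * (t - s) ^ (2 * γ) * ‖V‖ :=
  RoughNC.norm_idTimesAreaStar_le _
    (mul_nonneg hX.nonneg (Real.rpow_nonneg (sub_nonneg.2 hst.le) _)) (hX.area s t hs hst ht) V

end Estimates

end Rough

/-! ### Existence and properties of the rough integral. -/

section Integral

variable {A : Type*} [CStarAlgebra A]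

theorem continuousOn_remainder_aux {M N P : Type*} [TopologicalSpace M] [TopologicalSpace N]
    [AddCommGroup P] [TopologicalSpace P] [IsTopologicalAddGroup P] {q q' : M → N → P}
    (hq : Continuous fun p : M × N => q p.1 p.2) (hq' : Continuous fun p : M × N => q' p.1 p.2)
    {T : ℝ} [AddCommGroup M] [IsTopologicalAddGroup M] {X : ℝ → M} {a : ℝ → P} {b c : ℝ → N}
    (hX : ContinuousOn X (Icc 0 T)) (ha : ContinuousOn a (Icc 0 T)) (hb : ContinuousOn b (Icc 0 T))
    (hc : ContinuousOn c (Icc 0 T)) :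
    ContinuousOn (fun p : ℝ × ℝ => a p.2 - a p.1 - q (X p.2 - X p.1) (b p.1)
      - q' (X p.2 - X p.1) (c p.1)) (simplex T) := by
  have hf : ContinuousOn (fun p : ℝ × ℝ => p.1) (simplex T) := continuous_fst.continuousOn
  have hs : ContinuousOn (fun p : ℝ × ℝ => p.2) (simplex T) := continuous_snd.continuousOn
  have mf : MapsTo (fun p : ℝ × ℝ => p.1) (simplex T) (Icc 0 T) :=
    fun p hp => ⟨hp.1, hp.2.1.trans hp.2.2⟩
  have mse : MapsTo (fun p : ℝ × ℝ => p.2) (simplex T) (Icc 0 T) :=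
    fun p hp => ⟨hp.1.trans hp.2.1, hp.2.2⟩
  have hd : ContinuousOn (fun p : ℝ × ℝ => X p.2 - X p.1) (simplex T) :=
    (hX.comp hs mse).sub (hX.comp hf mf)
  have hb' : ContinuousOn (fun p : ℝ × ℝ => b p.1) (simplex T) := hb.comp hf mf
  have hc' : ContinuousOn (fun p : ℝ × ℝ => c p.1) (simplex T) := hc.comp hf mf
  exact (((ha.comp hs mse).sub (ha.comp hf mf)).sub (hq.comp_continuousOn (hd.prodMk hb'))).sub
    (hq'.comp_continuousOn (hd.prodMk hc'))

theorem continuousOn_remainder {T : ℝ} {X : ℝ → A} {a : ℝ → PTensor 2 A} {b c : ℝ → PTensor 3 A}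
    (hX : ContinuousOn X (Icc 0 T)) (ha : ContinuousOn a (Icc 0 T)) (hb : ContinuousOn b (Icc 0 T))
    (hc : ContinuousOn c (Icc 0 T)) :
    ContinuousOn (fun p : ℝ × ℝ => a p.2 - a p.1 - sharpLeft (X p.2 - X p.1) (b p.1)
      - sharpRight (X p.2 - X p.1) (c p.1)) (simplex T) :=
  continuousOn_remainder_aux (q := fun x U => sharpLeft x U) (q' := fun x U => sharpRight x U)
    continuous_sharpLeft continuous_sharpRight hX ha hb hc

theorem memC₂_remainder {T κ : ℝ} {X : ℝ → A} {a : ℝ → PTensor 2 A} {b c : ℝ → PTensor 3 A}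
    (hX : ContinuousOn X (Icc 0 T)) (ha : ContinuousOn a (Icc 0 T)) (hb : ContinuousOn b (Icc 0 T))
    (hc : ContinuousOn c (Icc 0 T)) {C : ℝ}
    (hC : ∀ s t, 0 ≤ s → s < t → t ≤ T → ‖a t - a s - sharpLeft (X t - X s) (b s)
      - sharpRight (X t - X s) (c s)‖ ≤ C * (t - s) ^ κ) :
    MemC₂ T κ fun s t => a t - a s - sharpLeft (X t - X s) (b s)
      - sharpRight (X t - X s) (c s) := by
  refine ⟨continuousOn_remainder hX ha hb hc, fun t _ => ?_, holder₂_lt_top hC⟩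
  have e1 : sharpLeft (0 : A) (b t) = 0 :=
    norm_le_zero_iff.1 ((norm_sharpLeft_le _ _).trans_eq (by simp))
  have e2 : sharpRight (0 : A) (c t) = 0 :=
    norm_le_zero_iff.1 ((norm_sharpRight_le _ _).trans_eq (by simp))
  simp only [sub_self, e1, e2]

/-- A rough driver together with an integrand `F(X)` that has an expansion near `X`. -/
structure RoughSetting (T γ H R K : ℝ) (X : ℝ → A) (L : AreaFamily X)
    (U : (s : ℝ) → PTensor 2 (filt X s)) (U1 U2 : (s : ℝ) → PTensor 3 (filt X s))
    (F : A → PTensor 2 A) (F1 F2 : A → PTensor 3 A) : Prop where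
  drv : RoughDriver T γ H X L
  norm_le : ∀ s ∈ Icc 0 T, ‖X s‖ ≤ R
  exp : Expansion F F1 F2 R K
  rep : Represents T X U U1 U2 F F1 F2 K

variable {T γ H R K : ℝ} {X : ℝ → A} {L : AreaFamily X} {U : (s : ℝ) → PTensor 2 (filt X s)}
  {U1 U2 : (s : ℝ) → PTensor 3 (filt X s)} {F : A → PTensor 2 A} {F1 F2 : A → PTensor 3 A}

namespace RoughSetting

variable (hS : RoughSetting T γ H R K X L U U1 U2 F F1 F2)
include hS

theorem exp_pos : 0 < γ := lt_trans (by norm_num) hS.drv.lt_exp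

theorem norm_germ_sub_le {s t : ℝ} (hs : 0 ≤ s) (hst : s ≤ t) (ht : t ≤ T) :
    ‖germ X L U U1 U2 s t - sharp (X t - X s) (F (X s))‖ ≤ 2 * H * K * (t - s) ^ (2 * γ) := by
  have hmem : s ∈ Icc 0 T := ⟨hs, hst.trans ht⟩
  rcases hst.eq_or_lt with rfl | hlt
  · have : sharp (0 : A) (F (X s)) = 0 := by simpa using sharp_sub (0 : A) 0 (F (X s))
    have hγ := hS.exp_pos
    rw [germ_self, sub_self, this, sub_self, sub_self, norm_zero, Real.zero_rpow (by positivity),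
      mul_zero]
  have hp : 0 ≤ H * (t - s) ^ (2 * γ) :=
    mul_nonneg hS.drv.nonneg (Real.rpow_nonneg (sub_nonneg.2 hst) _)
  rw [germ_of_lt hlt, hS.rep.coe s hmem, add_assoc, add_sub_cancel_left]
  calc ‖areaTimesId (ambientArea L s t) (U1 s) + idTimesAreaStar (ambientArea L s t) (U2 s)‖
      ≤ H * (t - s) ^ (2 * γ) * K + H * (t - s) ^ (2 * γ) * K :=
        norm_add_le_of_le
          ((hS.drv.norm_areaTimesId_le hs hlt ht _).trans
            (mul_le_mul_of_nonneg_left (hS.rep.norm₁ s hmem) hp))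
          ((hS.drv.norm_idTimesAreaStar_le hs hlt ht _).trans
            (mul_le_mul_of_nonneg_left (hS.rep.norm₂ s hmem) hp))
    _ = 2 * H * K * (t - s) ^ (2 * γ) := by ring

theorem norm_germ_le {s t : ℝ} (hs : 0 ≤ s) (hst : s ≤ t) (ht : t ≤ T) :
    ‖germ X L U U1 U2 s t‖ ≤ (2 * H * K * T ^ γ + H * K) * (t - s) ^ γ := by
  have hγ := hS.exp_pos
  have hH := hS.drv.nonneg
  have hK := hS.exp.nonneg
  have hmem : s ∈ Icc 0 T := ⟨hs, hst.trans ht⟩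
  have h1 := hS.norm_germ_sub_le hs hst ht
  have h2 : ‖sharp (X t - X s) (F (X s))‖ ≤ H * (t - s) ^ γ * K :=
    (RoughNC.norm_sharp_le _ _).trans (mul_le_mul (hS.drv.holder s t hs hst ht)
      (hS.exp.norm _ (hS.drv.sa s hmem) (hS.norm_le s hmem)) (norm_nonneg _)
      (mul_nonneg hH (Real.rpow_nonneg (sub_nonneg.2 hst) _)))
  have h3 : (t - s) ^ (2 * γ) ≤ T ^ γ * (t - s) ^ γ := by
    rw [two_mul]
    exact rpow_le_mul_rpow hγ.le hγ (sub_nonneg.2 hst) (by linarith)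
  calc ‖germ X L U U1 U2 s t‖
      ≤ ‖germ X L U U1 U2 s t - sharp (X t - X s) (F (X s))‖ + ‖sharp (X t - X s) (F (X s))‖ := by
        simpa using norm_add_le (germ X L U U1 U2 s t - sharp (X t - X s) (F (X s)))
          (sharp (X t - X s) (F (X s)))
    _ ≤ 2 * H * K * (T ^ γ * (t - s) ^ γ) + H * (t - s) ^ γ * K :=
        add_le_add (h1.trans (mul_le_mul_of_nonneg_left h3 (by positivity))) h2
    _ = (2 * H * K * T ^ γ + H * K) * (t - s) ^ γ := by ring

/-- The Chen defects of the two area terms equal the first order terms of `F(X_u) - F(X_s)` tested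
against `X_t - X_u`. After this cancellation every remaining term has total order `3γ`. -/
theorem delta_germ_eq {s u t : ℝ} (hs : 0 ≤ s) (hsu : s < u) (hut : u < t) (ht : t ≤ T) :
    delta (germ X L U U1 U2) s u t =
      -sharp (X t - X u) (F (X u) - F (X s) - sharpLeft (X u - X s) (F1 (X s))
        - sharpRight (X u - X s) (F2 (X s)))
      - areaTimesId (ambientArea L u t)
        (U1 u - tmap 3 (subInclLE (filt_mono X hsu.le)) (U1 s))
      - idTimesAreaStar (ambientArea L u t)
        (U2 u - tmap 3 (subInclLE (filt_mono X hsu.le)) (U2 s)) := by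
  have ms : s ∈ Icc 0 T := ⟨hs, (hsu.trans hut).le.trans ht⟩
  have mu : u ∈ Icc 0 T := ⟨hs.trans hsu.le, hut.le.trans ht⟩
  have mt : t ∈ Icc 0 T := ⟨mu.1.trans hut.le, ht⟩
  have hL : ∀ V, ambientArea L s t V - ambientArea L s u V
      - ambientArea L u t (tmap 2 (subInclLE (filt_mono X hsu.le)) V) =
      sharp (X u - X s) (tmap 2 (subIncl (filt X s)) V) * (X t - X u) :=
    hS.drv.chen s u t hs hsu hut ht
  have e1 := areaTimesId_of_chen (filt_mono X hsu.le) hL (U1 s)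
  have e2 := idTimesAreaStar_of_chen (filt_mono X hsu.le)
    ((hS.drv.sa u mu).sub (hS.drv.sa s ms)) ((hS.drv.sa t mt).sub (hS.drv.sa u mu)) hL (U2 s)
  have c1 : tmap 3 (subIncl (filt X s)) (U1 s) = F1 (X s) := hS.rep.coe₁ s ms
  have c2 : tmap 3 (subIncl (filt X s)) (U2 s) = F2 (X s) := hS.rep.coe₂ s ms
  rw [c1] at e1
  rw [c2] at e2
  have e0 : sharp (X t - X s) (F (X s)) = sharp (X u - X s) (F (X s))
      + sharp (X t - X u) (F (X s)) := by
    rw [← sharp_add]; congr 2; abel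
  have e3 := (areaTimesId (ambientArea L u t)).map_sub (U1 u)
    (tmap 3 (subInclLE (filt_mono X hsu.le)) (U1 s))
  have e4 := (idTimesAreaStar (ambientArea L u t)).map_sub (U2 u)
    (tmap 3 (subInclLE (filt_mono X hsu.le)) (U2 s))
  have e5 : sharp (X t - X u) (F (X u) - F (X s) - sharpLeft (X u - X s) (F1 (X s))
      - sharpRight (X u - X s) (F2 (X s))) =
      sharp (X t - X u) (F (X u)) - sharp (X t - X u) (F (X s))
      - sharp (X t - X u) (sharpLeft (X u - X s) (F1 (X s)))
      - sharp (X t - X u) (sharpRight (X u - X s) (F2 (X s))) := by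
    rw [(sharp (X t - X u)).map_sub, (sharp (X t - X u)).map_sub, (sharp (X t - X u)).map_sub]
  have g1 := germ_of_lt (L := L) (U := U) (U1 := U1) (U2 := U2) (hsu.trans hut)
  have g2 := germ_of_lt (L := L) (U := U) (U1 := U1) (U2 := U2) hsu
  have g3 := germ_of_lt (L := L) (U := U) (U1 := U1) (U2 := U2) hut
  rw [hS.rep.coe s ms, e0] at g1
  rw [hS.rep.coe s ms] at g2
  rw [hS.rep.coe u mu] at g3
  rw [delta, g1, g2, g3, e3, e4, e5, ← e1, ← e2]
  clear * -
  abel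

/-- The Taylor remainder contributes `K H³` and the two area terms `2 H² K`. The lengths `u - s` and
`t - u` are kept apart because the continuity argument needs a bound that vanishes as soon as one of
them does. -/
theorem norm_delta_germ_le {s u t : ℝ} (hs : 0 ≤ s) (hsu : s ≤ u) (hut : u ≤ t) (ht : t ≤ T) :
    ‖delta (germ X L U U1 U2) s u t‖ ≤ (K * H ^ 3 + 2 * H ^ 2 * K) *
      ((u - s) ^ (2 * γ) * (t - u) ^ γ + (u - s) ^ γ * (t - u) ^ (2 * γ)) := by
  have hγ := hS.exp_pos
  have hH := hS.drv.nonneg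
  have hK := hS.exp.nonneg
  have p1 := sub_nonneg.2 hsu
  have p2 := sub_nonneg.2 hut
  have hnn : 0 ≤ (K * H ^ 3 + 2 * H ^ 2 * K) *
      ((u - s) ^ (2 * γ) * (t - u) ^ γ + (u - s) ^ γ * (t - u) ^ (2 * γ)) := by positivity
  rcases hsu.eq_or_lt with rfl | hsu'
  · simpa [delta, germ_self] using hnn
  rcases hut.eq_or_lt with rfl | hut'
  · simpa [delta, germ_self] using hnn
  have ms : s ∈ Icc 0 T := ⟨hs, (hsu.trans hut).trans ht⟩
  have mu : u ∈ Icc 0 T := ⟨hs.trans hsu, hut.trans ht⟩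
  have d1 := hS.drv.holder s u hs hsu (hut.trans ht)
  have d2 := hS.drv.holder u t mu.1 hut ht
  have b1 : ‖sharp (X t - X u) (F (X u) - F (X s) - sharpLeft (X u - X s) (F1 (X s))
      - sharpRight (X u - X s) (F2 (X s)))‖ ≤
      (H * (t - u) ^ γ) * (K * (H * (u - s) ^ γ) ^ 2) := by
    refine (RoughNC.norm_sharp_le _ _).trans (mul_le_mul d2 ?_ (norm_nonneg _) (by positivity))
    refine (hS.exp.taylor _ _ (hS.drv.sa s ms) (hS.drv.sa u mu) (hS.norm_le s ms)
      (hS.norm_le u mu)).trans ?_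
    gcongr
  have bU : ∀ V : PTensor 3 (filt X u), ‖V‖ ≤ K * ‖X u - X s‖ →
      H * (t - u) ^ (2 * γ) * ‖V‖ ≤ H * (t - u) ^ (2 * γ) * (K * (H * (u - s) ^ γ)) :=
    fun V hV => mul_le_mul_of_nonneg_left (hV.trans (mul_le_mul_of_nonneg_left d1 hK))
      (by positivity)
  have b2 := (hS.drv.norm_areaTimesId_le mu.1 hut' ht _).trans
    (bU _ (hS.rep.lip₁ s u hs hsu (hut.trans ht)))
  have b3 := (hS.drv.norm_idTimesAreaStar_le mu.1 hut' ht _).trans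
    (bU _ (hS.rep.lip₂ s u hs hsu (hut.trans ht)))
  rw [hS.delta_germ_eq hs hsu' hut' ht]
  have hsq : ((u - s) ^ γ) ^ 2 = (u - s) ^ (2 * γ) := by
    rw [mul_comm, Real.rpow_mul p1, Real.rpow_two]
  refine (norm_sub_le_of_le (norm_sub_le_of_le ((norm_neg _).trans_le b1) b2) b3).trans ?_
  rw [mul_pow, hsq]
  have q1 : 0 ≤ (u - s) ^ (2 * γ) * (t - u) ^ γ := by positivity
  have q2 : 0 ≤ (u - s) ^ γ * (t - u) ^ (2 * γ) := by positivity
  have k1 : 0 ≤ K * H ^ 3 := by positivity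
  have k2 : 0 ≤ 2 * H ^ 2 * K := by positivity
  calc _ = K * H ^ 3 * ((u - s) ^ (2 * γ) * (t - u) ^ γ)
        + 2 * H ^ 2 * K * ((u - s) ^ γ * (t - u) ^ (2 * γ)) := by ring
    _ ≤ _ := by nlinarith [mul_nonneg k1 q2, mul_nonneg k2 q1]

theorem norm_delta_germ_le' {s u t : ℝ} (hs : 0 ≤ s) (hsu : s ≤ u) (hut : u ≤ t) (ht : t ≤ T) :
    ‖delta (germ X L U U1 U2) s u t‖ ≤
      (2 * (K * H ^ 3 + 2 * H ^ 2 * K)) * (t - s) ^ (3 * γ) := by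
  have hγ := hS.exp_pos
  have hH := hS.drv.nonneg
  have hK := hS.exp.nonneg
  have p1 := sub_nonneg.2 hsu
  have p2 := sub_nonneg.2 hut
  have p3 := sub_nonneg.2 (hsu.trans hut)
  have e : (t - s) ^ (3 * γ) = (t - s) ^ (2 * γ) * (t - s) ^ γ := by
    rw [← Real.rpow_add_of_nonneg p3 (by positivity) hγ.le]; ring_nf
  refine (hS.norm_delta_germ_le hs hsu hut ht).trans ?_
  calc _ ≤ (K * H ^ 3 + 2 * H ^ 2 * K) *
        ((t - s) ^ (2 * γ) * (t - s) ^ γ + (t - s) ^ γ * (t - s) ^ (2 * γ)) := by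
          gcongr
    _ = _ := by rw [e]; ring

/-- Nothing is assumed about the dependence of `L s t` on `(s, t)`: continuity is forced by the size
of the germ and of its coboundary. -/
theorem continuousOn_germ : ContinuousOn (Function.uncurry (germ X L U U1 U2)) (simplex T) := by
  have hγ := hS.exp_pos
  have hH := hS.drv.nonneg
  have hK := hS.exp.nonneg
  have hT := hS.drv.pos.le
  set C₁ := 2 * H * K * T ^ γ + H * K
  set C₂ := K * H ^ 3 + 2 * H ^ 2 * K
  refine continuousOn_simplex_of_delta (a := 2 * γ) (b := γ) (c := γ) (C := max C₁ C₂) hT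
    (by positivity) hγ hγ (le_max_of_le_left (by positivity)) (fun s t hs hst ht => ?_)
    (fun s u t hs hsu hut ht => ?_)
  · exact (hS.norm_germ_le hs hst ht).trans (mul_le_mul_of_nonneg_right (le_max_left _ _)
      (Real.rpow_nonneg (sub_nonneg.2 hst) _))
  · refine (hS.norm_delta_germ_le hs hsu hut ht).trans
      (mul_le_mul_of_nonneg_right (le_max_right _ _) ?_)
    have p1 := sub_nonneg.2 hsu
    have p2 := sub_nonneg.2 hut
    positivity

/-- The sewing lemma supplies a path `J` whose increments are close to the germ. The difference
between the germ and these increments is the required element, since increments of a path have zero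
coboundary. -/
theorem exists_isSewing : ∃ r, IsSewing T (3 * γ) (delta (germ X L U U1 U2)) r := by
  have hγ := hS.exp_pos
  have hH := hS.drv.nonneg
  have hK := hS.exp.nonneg
  have hT := hS.drv.pos.le
  have hθ : 1 < 3 * γ := by linarith [hS.drv.lt_exp]
  set C₂ := K * H ^ 3 + 2 * H ^ 2 * K with hC₂
  have hC₂0 : 0 ≤ C₂ := by positivity
  obtain ⟨J, hJ⟩ := exists_sewing_path hθ (K := 2 * C₂) (by positivity) hT (germ X L U U1 U2)
    germ_self fun s u t hs hsu hut ht => hS.norm_delta_germ_le' hs hsu hut ht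
  set r : ℝ → ℝ → A := fun s t => germ X L U U1 U2 s t - (J t - J s) with hr
  have hδ : ∀ s u t, delta r s u t = delta (germ X L U U1 U2) s u t := fun s u t => by
    simp only [delta, hr]; abel
  have hb : ∀ s t, 0 ≤ s → s ≤ t → t ≤ T → ‖r s t‖ ≤ sewConst (3 * γ) * (2 * C₂) * (t - s) ^ (3 * γ) :=
    fun s t hs hst ht => by
      have := hJ s t hs hst ht
      rwa [norm_sub_rev] at this
  have hpos := (sewConst_pos hθ).le
  refine ⟨r, ⟨?_, fun t _ => by simp [hr, germ_self],
    holder₂_lt_top fun s t hs hst ht => hb s t hs hst.le ht⟩, fun s u t _ _ _ _ => hδ s u t⟩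
  refine continuousOn_simplex_of_delta (a := 2 * γ) (b := γ) (c := 3 * γ)
    (C := max (sewConst (3 * γ) * (2 * C₂)) C₂) hT (by positivity) hγ (by positivity)
    (le_max_of_le_right hC₂0) (fun s t hs hst ht => ?_) (fun s u t hs hsu hut ht => ?_)
  · exact (hb s t hs hst ht).trans (mul_le_mul_of_nonneg_right (le_max_left _ _)
      (Real.rpow_nonneg (sub_nonneg.2 hst) _))
  · rw [hδ]
    refine (hS.norm_delta_germ_le hs hsu hut ht).trans
      (mul_le_mul_of_nonneg_right (le_max_right _ _) ?_)
    have p1 := sub_nonneg.2 hsu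
    have p2 := sub_nonneg.2 hut
    positivity

/-- `sewing` is a choice. Everything that follows rests on this specification alone; uniqueness is
not needed. -/
theorem isSewing_sewing : IsSewing T (3 * γ) (delta (germ X L U U1 U2))
    (sewing T (3 * γ) (delta (germ X L U U1 U2))) := by
  unfold sewing
  rw [dif_pos hS.exists_isSewing]
  exact hS.exists_isSewing.choose_spec

theorem roughIntegral_self {t : ℝ} (ht : t ∈ Icc 0 T) : roughIntegral T γ X L U U1 U2 t t = 0 := by
  rw [roughIntegral, germ_self, hS.isSewing_sewing.1.2.1 t ht, sub_zero]

theorem roughIntegral_add {s u t : ℝ} (hs : 0 ≤ s) (hsu : s ≤ u) (hut : u ≤ t) (ht : t ≤ T) :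
    roughIntegral T γ X L U U1 U2 s u + roughIntegral T γ X L U U1 U2 u t =
      roughIntegral T γ X L U U1 U2 s t := by
  rcases hsu.eq_or_lt with rfl | hsu'
  · rw [hS.roughIntegral_self ⟨hs, hut.trans ht⟩, zero_add]
  rcases hut.eq_or_lt with rfl | hut'
  · rw [hS.roughIntegral_self ⟨hs.trans hsu, ht⟩, add_zero]
  have h := hS.isSewing_sewing.2 s u t hs hsu' hut' ht
  unfold roughIntegral
  generalize sewing (E := A) T (3 * γ) (delta (germ X L U U1 U2)) = r at h ⊢
  unfold delta at h
  have : r s t = germ X L U U1 U2 s t - germ X L U U1 U2 s u - germ X L U U1 U2 u t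
    + r s u + r u t := by rw [← h]; abel
  rw [this]; abel

theorem exists_norm_roughIntegral_sub_germ_le : ∃ C, 0 ≤ C ∧ ∀ s t, 0 ≤ s → s ≤ t → t ≤ T →
    ‖roughIntegral T γ X L U U1 U2 s t - germ X L U U1 U2 s t‖ ≤ C * (t - s) ^ (3 * γ) := by
  obtain ⟨C, hC, h⟩ := exists_bound_of_holder₂_lt_top hS.isSewing_sewing.1.2.2
  refine ⟨C, hC, fun s t hs hst ht => ?_⟩
  rcases hst.eq_or_lt with rfl | hlt
  · rw [hS.roughIntegral_self ⟨hs, ht⟩, germ_self, sub_zero, norm_zero]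
    exact mul_nonneg hC (Real.rpow_nonneg (sub_nonneg.2 hst) _)
  · rw [roughIntegral, sub_sub_cancel_left, norm_neg]
    exact h s t hs hlt ht

theorem exists_norm_roughIntegral_sub_sharp_le : ∃ C, 0 ≤ C ∧ ∀ s t, 0 ≤ s → s ≤ t → t ≤ T →
    ‖roughIntegral T γ X L U U1 U2 s t - sharp (X t - X s) (F (X s))‖ ≤
      C * (t - s) ^ (2 * γ) := by
  have hγ := hS.exp_pos
  have hH := hS.drv.nonneg
  have hK := hS.exp.nonneg
  have hT := hS.drv.pos.le
  obtain ⟨C, hC, h⟩ := hS.exists_norm_roughIntegral_sub_germ_le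
  refine ⟨C * T ^ γ + 2 * H * K, by positivity, fun s t hs hst ht => ?_⟩
  have h1 := h s t hs hst ht
  have h2 := hS.norm_germ_sub_le hs hst ht
  have h3 : (t - s) ^ (3 * γ) ≤ T ^ γ * (t - s) ^ (2 * γ) := by
    rw [show 3 * γ = γ + 2 * γ by ring]
    exact rpow_le_mul_rpow hγ.le (by positivity) (sub_nonneg.2 hst) (by linarith)
  rw [← sub_add_sub_cancel _ (germ X L U U1 U2 s t)]
  refine (norm_add_le_of_le (h1.trans (mul_le_mul_of_nonneg_left h3 hC)) h2).trans_eq ?_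
  ring

theorem memC₂_roughIntegral : MemC₂ T γ (roughIntegral T γ X L U U1 U2) := by
  have hγ := hS.exp_pos
  have hH := hS.drv.nonneg
  have hK := hS.exp.nonneg
  have hT := hS.drv.pos.le
  refine ⟨hS.continuousOn_germ.sub hS.isSewing_sewing.1.1, fun t ht => hS.roughIntegral_self ht, ?_⟩
  obtain ⟨C, hC, h⟩ := hS.exists_norm_roughIntegral_sub_germ_le
  refine holder₂_lt_top (C := C * T ^ (2 * γ) + (2 * H * K * T ^ γ + H * K))
    fun s t hs hst ht => ?_
  have h3 : (t - s) ^ (3 * γ) ≤ T ^ (2 * γ) * (t - s) ^ γ := by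
    rw [show 3 * γ = 2 * γ + γ by ring]
    exact rpow_le_mul_rpow (by positivity) hγ (sub_nonneg.2 hst.le) (by linarith)
  rw [← sub_add_cancel (roughIntegral T γ X L U U1 U2 s t) (germ X L U U1 U2 s t)]
  refine (norm_add_le_of_le ((h s t hs hst.le ht).trans (mul_le_mul_of_nonneg_left h3 hC))
    (hS.norm_germ_le hs hst.le ht)).trans_eq ?_
  ring

theorem isControlledBiprocess : IsControlledBiprocess T γ X U U1 U2 := by
  have hγ := hS.exp_pos
  have hH := hS.drv.nonneg
  have hK := hS.exp.nonneg
  have hT := hS.drv.pos.le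
  have comp : ∀ {n : ℕ} (V : ∀ s, PTensor n (filt X s)) (G : A → PTensor n A),
      (∀ s ∈ Icc 0 T, toAmbient n X s (V s) = G (X s)) →
      (∀ x y, IsSelfAdjoint x → IsSelfAdjoint y → ‖x‖ ≤ R → ‖y‖ ≤ R →
        ‖G y - G x‖ ≤ K * ‖y - x‖) → MemC₁ T γ fun s => toAmbient n X s (V s) := by
    intro n V G hV hG
    refine memC₁_of_holder hγ (C := K * H) fun s t hs hst ht => ?_
    have ms : s ∈ Icc 0 T := ⟨hs, hst.trans ht⟩
    have mt : t ∈ Icc 0 T := ⟨hs.trans hst, ht⟩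
    rw [hV s ms, hV t mt, mul_assoc]
    exact (hG _ _ (hS.drv.sa s ms) (hS.drv.sa t mt) (hS.norm_le s ms) (hS.norm_le t mt)).trans
      (mul_le_mul_of_nonneg_left (hS.drv.holder s t hs hst ht) hK)
  have m0 := comp U F hS.rep.coe hS.exp.lip
  have m1 := comp U1 F1 hS.rep.coe₁ hS.exp.lip₁
  have m2 := comp U2 F2 hS.rep.coe₂ hS.exp.lip₂
  have mX : ContinuousOn X (Icc 0 T) := continuousOn_of_holder hγ hS.drv.holder
  have hC : ∀ s t, 0 ≤ s → s < t → t ≤ T → ‖toAmbient 2 X t (U t) - toAmbient 2 X s (U s)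
      - sharpLeft (X t - X s) (toAmbient 3 X s (U1 s))
      - sharpRight (X t - X s) (toAmbient 3 X s (U2 s))‖ ≤ K * H ^ 2 * (t - s) ^ (2 * γ) := by
    intro s t hs hst ht
    have ms : s ∈ Icc 0 T := ⟨hs, hst.le.trans ht⟩
    have mt : t ∈ Icc 0 T := ⟨hs.trans hst.le, ht⟩
    rw [hS.rep.coe s ms, hS.rep.coe t mt, hS.rep.coe₁ s ms, hS.rep.coe₂ s ms]
    have hsq : ((t - s) ^ γ) ^ 2 = (t - s) ^ (2 * γ) := by
      rw [mul_comm, Real.rpow_mul (sub_nonneg.2 hst.le), Real.rpow_two]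
    rw [mul_assoc, ← hsq, ← mul_pow]
    refine (hS.exp.taylor _ _ (hS.drv.sa s ms) (hS.drv.sa t mt) (hS.norm_le s ms)
      (hS.norm_le t mt)).trans ?_
    have := hS.drv.holder s t hs hst.le ht
    gcongr
  exact ⟨m0, m1, m2, memC₂_remainder (a := fun s => toAmbient 2 X s (U s))
    (b := fun s => toAmbient 3 X s (U1 s)) (c := fun s => toAmbient 3 X s (U2 s))
    mX m0.1 m1.1 m2.1 hC⟩

theorem roughIntegrable : RoughIntegrable T γ X L U U1 U2 :=
  ⟨hS.isControlledBiprocess, hS.exists_isSewing⟩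

end RoughSetting

end Integral

/-! ### Expansions of the classical integral on one cell. -/

section Approximation

variable {A : Type*} [CStarAlgebra A]

/-- Of the exponent `q + m`, the part `q` is absorbed by the mesh, the part `m - 1` by the total
length, and the last power telescopes. -/
theorem sum_rpow_le {p : ℕ → ℝ} {m q η : ℝ} (hm : 1 ≤ m) (hq : 0 < q) {i j : ℕ}
    (hij : i ≤ j) (hp : ∀ l, i ≤ l → l < j → p l ≤ p (l + 1) ∧ p (l + 1) - p l ≤ η) :
    ∑ l ∈ Finset.Ico i j, (p (l + 1) - p l) ^ (q + m) ≤ η ^ q * (p j - p i) ^ m := by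
  have hmono : ∀ b, i ≤ b → b ≤ j → p i ≤ p b := by
    intro b hb
    induction hb with
    | refl => intro _; exact le_rfl
    | step hb ih => intro hj; exact (ih (by omega)).trans (hp _ hb (by omega)).1
  have hmono' : ∀ b, b ≤ j → i ≤ b → p b ≤ p j := by
    intro b hb
    induction hb using Nat.decreasingInduction with
    | self => intro _; exact le_rfl
    | of_succ l hl ih => intro hi; exact (hp _ hi (by omega)).1.trans (ih (by omega))
  have hΔ : 0 ≤ p j - p i := sub_nonneg.2 (hmono j hij le_rfl)
  have hb : ∀ l ∈ Finset.Ico i j, (p (l + 1) - p l) ^ (q + m) ≤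
      η ^ q * (p j - p i) ^ (m - 1) * (p (l + 1) - p l) := by
    intro l hl
    obtain ⟨h1, h2⟩ := Finset.mem_Ico.1 hl
    obtain ⟨h3, h4⟩ := hp l h1 h2
    have h0 := sub_nonneg.2 h3
    have h5 : p (l + 1) - p l ≤ p j - p i :=
      sub_le_sub (hmono' _ h2 (by omega)) (hmono _ h1 h2.le)
    have e : (p (l + 1) - p l) ^ (q + m) =
        (p (l + 1) - p l) ^ q * (p (l + 1) - p l) ^ (m - 1) * (p (l + 1) - p l) := by
      rcases h0.eq_or_lt with h | h
      · rw [← h, mul_zero, Real.zero_rpow (by linarith)]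
      · rw [mul_assoc, ← Real.rpow_add_one h.ne', sub_add_cancel, Real.rpow_add h]
    rw [e]
    have hm1 : 0 ≤ m - 1 := sub_nonneg.2 hm
    have hη : 0 ≤ η := h0.trans h4
    gcongr
  refine (Finset.sum_le_sum hb).trans_eq ?_
  rw [← Finset.mul_sum, Finset.sum_Ico_sub p hij, mul_assoc]
  congr 1
  rcases hΔ.eq_or_lt with h | h
  · rw [← h, mul_zero, Real.zero_rpow (by linarith)]
  · rw [← Real.rpow_add_one h.ne', sub_add_cancel]

theorem norm_interp_le {T R : ℝ} (hT : 0 < T) {X : ℝ → A} (D : TimePartition T)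
    (hX : ∀ s ∈ Icc 0 T, ‖X s‖ ≤ R) {t : ℝ} (ht : t ∈ Icc 0 T) : ‖interp X D t‖ ≤ R := by
  obtain ⟨i, hi, hti⟩ := D.exists_cell hT ht
  have hp := sub_pos.2 (D.pt_lt i hi)
  rw [interp_apply X D hi hti, ← mem_closedBall_zero_iff]
  refine (convex_closedBall (0 : A) R).add_smul_sub_mem
    (mem_closedBall_zero_iff.2 (hX _ (D.pt_mem hi.le)))
    (mem_closedBall_zero_iff.2 (hX _ (D.pt_mem hi)))
    ⟨div_nonneg (sub_nonneg.2 hti.1) hp.le, (div_le_one hp).2 (by linarith [hti.2])⟩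

/-- The interpolation of `X` along `D` and its area are `ε`-close to `X` and `L`, and the mesh
of `D` is at most `η`. -/
structure CloseInterp (T γ ε η : ℝ) (X : ℝ → A) (L : AreaFamily X) (D : TimePartition T) :
    Prop where
  eps_nonneg : 0 ≤ ε
  eps_le : ε ≤ 1
  step_le : ∀ i < D.k, D.pt (i + 1) - D.pt i ≤ η
  path : ∀ s t, 0 ≤ s → s < t → t ≤ T →
    ‖interp X D t - X t - (interp X D s - X s)‖ ≤ ε * (t - s) ^ γ
  area : ∀ s t, 0 ≤ s → s < t → t ≤ T → ∀ V : PTensor 2 (filt X s),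
    ‖areaOn (filt X s) (interp X D) s t V - ambientArea L s t V‖ ≤
      ε * (t - s) ^ (2 * γ) * ‖V‖

open Classical in
/-- The contribution of the difference of two families of areas to the second order terms. -/
def areaError (X : ℝ → A) (L : AreaFamily X) (x : ℝ → A) (U1 U2 : (s : ℝ) → PTensor 3 (filt X s))
    (s t : ℝ) : A :=
  if s < t then
    areaTimesId (areaOn (filt X s) x s t - ambientArea L s t) (U1 s)
      + idTimesAreaStar (areaOn (filt X s) x s t - ambientArea L s t) (U2 s)
  else 0

/-- The classical integral of `F` along a path. -/
def pathIntegral (x : ℝ → A) (F : A → PTensor 2 A) (s t : ℝ) : A :=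
  ∫ u in s..t, sharp (deriv x u) (F (x u))

variable {T γ H R K ε η : ℝ} {X : ℝ → A} {L : AreaFamily X} {U : (s : ℝ) → PTensor 2 (filt X s)}
  {U1 U2 : (s : ℝ) → PTensor 3 (filt X s)} {F : A → PTensor 2 A} {F1 F2 : A → PTensor 3 A}
  {D : TimePartition T} {x : ℝ → A}

theorem PLPath.pathIntegral_add (hx : PLPath x) (hF : Continuous fun u => F (x u)) (s u t : ℝ) :
    pathIntegral x F s u + pathIntegral x F u t = pathIntegral x F s t :=
  intervalIntegral.integral_add_adjacent_intervals (hx.intervalIntegrable_sharp hF s u)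
    (hx.intervalIntegrable_sharp hF u t)

/-- First order expansion of the classical integral on an interval where the path is affine. -/
theorem PLPath.norm_pathIntegral_sub_le (hx : PLPath x) (hE : Expansion F F1 F2 R K)
    (hF : Continuous fun u => F (x u)) {s t : ℝ} (hst : s ≤ t) {d : A}
    (hlin : ∀ u ∈ Icc s t, x u = x s + (u - s) • d) (hR : ∀ u ∈ Icc s t, ‖x u‖ ≤ R) :
    ‖pathIntegral x F s t - sharp (x t - x s) (F (x s))‖ ≤ K * ‖x t - x s‖ ^ 2 := by
  have hs : s ∈ Icc s t := ⟨le_rfl, hst⟩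
  have e : pathIntegral x F s t - sharp (x t - x s) (F (x s)) =
      ∫ u in s..t, sharp (deriv x u) (F (x u) - F (x s)) := by
    rw [pathIntegral, ← hx.integral_sharp_const, ← intervalIntegral.integral_sub
      (hx.intervalIntegrable_sharp hF s t) (hx.intervalIntegrable_sharp continuous_const s t)]
    exact intervalIntegral.integral_congr fun u _ => ((sharp (deriv x u)).map_sub _ _).symm
  rw [e]
  refine (norm_integral_sharp_le_of_affine hst hlin (C := K * ‖x t - x s‖)
    fun u hu => ?_).trans_eq (by ring)
  exact (hE.lip _ _ (hx.sa s) (hx.sa u) (hR s hs) (hR u hu)).trans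
    (mul_le_mul_of_nonneg_left (norm_sub_le_of_affine hlin hu) hE.nonneg)

/-- Second order expansion of the classical integral on an interval where the path is affine. -/
theorem PLPath.norm_pathIntegral_sub_sub_le (hx : PLPath x) (hE : Expansion F F1 F2 R K)
    (hF : Continuous fun u => F (x u)) {s t : ℝ} (hst : s ≤ t) {d : A}
    (hlin : ∀ u ∈ Icc s t, x u = x s + (u - s) • d) (hR : ∀ u ∈ Icc s t, ‖x u‖ ≤ R) :
    ‖pathIntegral x F s t - sharp (x t - x s) (F (x s))
      - (∫ u in s..t, sharp (deriv x u) (sharpLeft (x u - x s) (F1 (x s))))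
      - ∫ u in s..t, sharp (deriv x u) (sharpRight (x u - x s) (F2 (x s)))‖ ≤
      K * ‖x t - x s‖ ^ 3 := by
  have hs : s ∈ Icc s t := ⟨le_rfl, hst⟩
  have c1 : Continuous fun u => sharpLeft (x u - x s) (F1 (x s)) :=
    ((sharpLeftL A).flip (F1 (x s))).continuous.comp (hx.continuous.sub continuous_const)
  have c2 : Continuous fun u => sharpRight (x u - x s) (F2 (x s)) :=
    ((sharpRightL A).flip (F2 (x s))).continuous.comp (hx.continuous.sub continuous_const)
  have e : pathIntegral x F s t - sharp (x t - x s) (F (x s))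
      - (∫ u in s..t, sharp (deriv x u) (sharpLeft (x u - x s) (F1 (x s))))
      - (∫ u in s..t, sharp (deriv x u) (sharpRight (x u - x s) (F2 (x s)))) =
      ∫ u in s..t, sharp (deriv x u) (F (x u) - F (x s) - sharpLeft (x u - x s) (F1 (x s))
        - sharpRight (x u - x s) (F2 (x s))) := by
    rw [pathIntegral, ← hx.integral_sharp_const, ← intervalIntegral_sub_sub_sub
      (hx.intervalIntegrable_sharp hF s t) (hx.intervalIntegrable_sharp continuous_const s t)
      (hx.intervalIntegrable_sharp c1 s t) (hx.intervalIntegrable_sharp c2 s t)]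
    refine intervalIntegral.integral_congr fun u _ => ?_
    have h1 := (sharp (deriv x u)).map_sub (F (x u)) (F (x s))
    have h2 := (sharp (deriv x u)).map_sub (F (x u) - F (x s)) (sharpLeft (x u - x s) (F1 (x s)))
    have h3 := (sharp (deriv x u)).map_sub (F (x u) - F (x s) - sharpLeft (x u - x s) (F1 (x s)))
      (sharpRight (x u - x s) (F2 (x s)))
    simp only [h3, h2, h1]
  rw [e]
  refine (norm_integral_sharp_le_of_affine hst hlin (C := K * ‖x t - x s‖ ^ 2)
    fun u hu => ?_).trans_eq (by ring)
  refine (hE.taylor _ _ (hx.sa s) (hx.sa u) (hR s hs) (hR u hu)).trans ?_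
  have := norm_sub_le_of_affine hlin hu
  have := hE.nonneg
  gcongr

end Approximation

/-! ### Comparison on a cell, and the coboundary of the area error. -/

section Convergence

variable {A : Type*} [CStarAlgebra A]
variable {T γ H R K ε η : ℝ} {X : ℝ → A} {L : AreaFamily X} {U : (s : ℝ) → PTensor 2 (filt X s)}
  {U1 U2 : (s : ℝ) → PTensor 3 (filt X s)} {F : A → PTensor 2 A} {F1 F2 : A → PTensor 3 A}
  {D : TimePartition T} {x : ℝ → A}

theorem areaError_self (t : ℝ) : areaError X L x U1 U2 t t = 0 := if_neg (lt_irrefl t)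

theorem areaError_of_lt {s t : ℝ} (hst : s < t) : areaError X L x U1 U2 s t =
    areaTimesId (areaOn (filt X s) x s t - ambientArea L s t) (U1 s)
      + idTimesAreaStar (areaOn (filt X s) x s t - ambientArea L s t) (U2 s) := if_pos hst

namespace RoughSetting

variable (hS : RoughSetting T γ H R K X L U U1 U2 F F1 F2)
include hS

/-- At partition points `X` and its interpolation agree, so the Chen defects of the two areas
coincide and cancel. The zero on the right has the shape that `areaTimesId_of_chen` expects. -/
theorem areaDiff_chen (hx : PLPath (interp X D)) {s u t : ℝ} (hs : 0 ≤ s) (hsu : s < u)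
    (hut : u < t) (ht : t ≤ T) (es : interp X D s = X s) (eu : interp X D u = X u)
    (et : interp X D t = X t) (V : PTensor 2 (filt X s)) :
    (areaOn (filt X s) (interp X D) s t - ambientArea L s t) V
      - (areaOn (filt X s) (interp X D) s u - ambientArea L s u) V
      - (areaOn (filt X u) (interp X D) u t - ambientArea L u t)
        (tmap 2 (subInclLE (filt_mono X hsu.le)) V) =
      sharp 0 (tmap 2 (subIncl (filt X s)) V) * 0 := by
  have h1 := hx.areaOn_chen (filt_mono X hsu.le) s u t V
  have h2 : ambientArea L s t V - ambientArea L s u V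
      - ambientArea L u t (tmap 2 (subInclLE (filt_mono X hsu.le)) V) =
      sharp (X u - X s) (tmap 2 (subIncl (filt X s)) V) * (X t - X u) :=
    hS.drv.chen s u t hs hsu hut ht V
  rw [es, eu, et, ← h2] at h1
  rw [mul_zero]
  simp only [sub_apply]
  rw [← sub_eq_zero] at h1
  rw [← h1]
  abel

/-- On a cell of the partition, the two integrals differ by the area error up to higher order. -/
theorem norm_cell_le (hx : PLPath (interp X D)) (hF : Continuous fun u => F (interp X D u))
    {C : ℝ} (hC : ∀ s t, 0 ≤ s → s ≤ t → t ≤ T →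
      ‖roughIntegral T γ X L U U1 U2 s t - germ X L U U1 U2 s t‖ ≤ C * (t - s) ^ (3 * γ))
    {i : ℕ} (hi : i < D.k) :
    ‖pathIntegral (interp X D) F (D.pt i) (D.pt (i + 1))
      - roughIntegral T γ X L U U1 U2 (D.pt i) (D.pt (i + 1))
      - areaError X L (interp X D) U1 U2 (D.pt i) (D.pt (i + 1))‖ ≤
      (K * H ^ 3 + C) * (D.pt (i + 1) - D.pt i) ^ (3 * γ) := by
  have hγ := hS.exp_pos
  have hK := hS.exp.nonneg
  have hT := hS.drv.pos
  set s := D.pt i with hs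
  set t := D.pt (i + 1) with ht
  have hst : s < t := D.pt_lt i hi
  have ms : s ∈ Icc 0 T := D.pt_mem hi.le
  have mt : t ∈ Icc 0 T := D.pt_mem hi
  have es : interp X D s = X s := interp_pt D X hi.le hT
  have et : interp X D t = X t := interp_pt D X hi hT
  have h1 := hx.norm_pathIntegral_sub_sub_le hS.exp hF hst.le (interp_affine D X hi le_rfl le_rfl)
    fun u hu => norm_interp_le hT D hS.norm_le ⟨ms.1.trans hu.1, hu.2.trans mt.2⟩
  -- At a partition point `F1` and `F2` of the interpolation are images of the adapted `U1 s` and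
  -- `U2 s`. The second order integrals are therefore values of `areaOn (filt X s)`, which can be
  -- compared with `L`.
  have c1 : F1 (interp X D s) = tmap 3 (subIncl (filt X s)) (U1 s) := by
    rw [es]; exact (hS.rep.coe₁ s ms).symm
  have c2 : F2 (interp X D s) = tmap 3 (subIncl (filt X s)) (U2 s) := by
    rw [es]; exact (hS.rep.coe₂ s ms).symm
  rw [c1, c2, ← hx.areaTimesId_areaOn, ← hx.idTimesAreaStar_areaOn, es, et] at h1
  have h2 := hC s t ms.1 hst.le mt.2
  have g := germ_of_lt (L := L) (U := U) (U1 := U1) (U2 := U2) hst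
  rw [hS.rep.coe s ms] at g
  have a1 : areaTimesId (areaOn (filt X s) (interp X D) s t - ambientArea L s t) (U1 s) =
      areaTimesId (areaOn (filt X s) (interp X D) s t) (U1 s)
        - areaTimesId (ambientArea L s t) (U1 s) := by rw [areaTimesId_sub]; rfl
  have a2 : idTimesAreaStar (areaOn (filt X s) (interp X D) s t - ambientArea L s t) (U2 s) =
      idTimesAreaStar (areaOn (filt X s) (interp X D) s t) (U2 s)
        - idTimesAreaStar (ambientArea L s t) (U2 s) := by rw [idTimesAreaStar_sub]; rfl
  have h3 : K * ‖X t - X s‖ ^ 3 ≤ K * H ^ 3 * (t - s) ^ (3 * γ) := by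
    have e : (t - s) ^ (3 * γ) = ((t - s) ^ γ) ^ 3 := by
      rw [mul_comm, Real.rpow_mul (sub_nonneg.2 hst.le)]; norm_cast
    rw [e, mul_assoc, ← mul_pow]
    have := hS.drv.holder s t ms.1 hst.le mt.2
    gcongr
  have key : pathIntegral (interp X D) F s t - roughIntegral T γ X L U U1 U2 s t
      - areaError X L (interp X D) U1 U2 s t =
      (pathIntegral (interp X D) F s t - sharp (X t - X s) (F (X s))
        - areaTimesId (areaOn (filt X s) (interp X D) s t) (U1 s)
        - idTimesAreaStar (areaOn (filt X s) (interp X D) s t) (U2 s))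
      - (roughIntegral T γ X L U U1 U2 s t - germ X L U U1 U2 s t) := by
    rw [areaError_of_lt hst, g, a1, a2]
    clear * -
    abel
  rw [key]
  exact (norm_sub_le_of_le (h1.trans h3) h2).trans_eq (by ring)

end RoughSetting

namespace CloseInterp

variable (hD : CloseInterp T γ ε η X L D)
include hD

theorem norm_areaTimesId_le {s t : ℝ} (hs : 0 ≤ s) (hst : s < t) (ht : t ≤ T)
    (V : PTensor 3 (filt X s)) :
    ‖areaTimesId (areaOn (filt X s) (interp X D) s t - ambientArea L s t) V‖ ≤
      ε * (t - s) ^ (2 * γ) * ‖V‖ :=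
  RoughNC.norm_areaTimesId_le _
    (mul_nonneg hD.eps_nonneg (Real.rpow_nonneg (sub_nonneg.2 hst.le) _))
    (hD.area s t hs hst ht) V

theorem norm_idTimesAreaStar_le {s t : ℝ} (hs : 0 ≤ s) (hst : s < t) (ht : t ≤ T)
    (V : PTensor 3 (filt X s)) :
    ‖idTimesAreaStar (areaOn (filt X s) (interp X D) s t - ambientArea L s t) V‖ ≤
      ε * (t - s) ^ (2 * γ) * ‖V‖ :=
  RoughNC.norm_idTimesAreaStar_le _
    (mul_nonneg hD.eps_nonneg (Real.rpow_nonneg (sub_nonneg.2 hst.le) _))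
    (hD.area s t hs hst ht) V

variable (hS : RoughSetting T γ H R K X L U U1 U2 F F1 F2)
include hS

theorem norm_areaError_le {s t : ℝ} (hs : 0 ≤ s) (hst : s ≤ t) (ht : t ≤ T) :
    ‖areaError X L (interp X D) U1 U2 s t‖ ≤ 2 * ε * K * (t - s) ^ (2 * γ) := by
  have hε := hD.eps_nonneg
  have hK := hS.exp.nonneg
  have p := sub_nonneg.2 hst
  rcases hst.eq_or_lt with rfl | hlt
  · rw [areaError_self, norm_zero]; positivity
  have ms : s ∈ Icc 0 T := ⟨hs, hst.trans ht⟩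
  have hp : 0 ≤ ε * (t - s) ^ (2 * γ) := by positivity
  rw [areaError_of_lt hlt]
  exact (norm_add_le_of_le
    ((hD.norm_areaTimesId_le hs hlt ht _).trans
      (mul_le_mul_of_nonneg_left (hS.rep.norm₁ s ms) hp))
    ((hD.norm_idTimesAreaStar_le hs hlt ht _).trans
      (mul_le_mul_of_nonneg_left (hS.rep.norm₂ s ms) hp))).trans_eq (by ring)

/-- The difference of the areas contributes no defect at partition points. Only the increments of
`U1` and `U2` over `[s, u]` remain, and they add the order `γ` to the `ε`-small operators of order
`2γ`. -/
theorem norm_delta_areaError_le (hx : PLPath (interp X D)) {s u t : ℝ} (hs : 0 ≤ s) (hsu : s ≤ u)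
    (hut : u ≤ t) (ht : t ≤ T) (es : interp X D s = X s) (eu : interp X D u = X u)
    (et : interp X D t = X t) :
    ‖areaError X L (interp X D) U1 U2 s t - areaError X L (interp X D) U1 U2 s u
      - areaError X L (interp X D) U1 U2 u t‖ ≤ 2 * ε * K * H * (t - s) ^ (3 * γ) := by
  have hγ := hS.exp_pos
  have hε := hD.eps_nonneg
  have hK := hS.exp.nonneg
  have hH := hS.drv.nonneg
  have p1 := sub_nonneg.2 hsu
  have p2 := sub_nonneg.2 hut
  have p3 := sub_nonneg.2 (hsu.trans hut)
  have hnn : 0 ≤ 2 * ε * K * H * (t - s) ^ (3 * γ) := by positivity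
  rcases hsu.eq_or_lt with rfl | hsu'
  · simpa [areaError_self] using hnn
  rcases hut.eq_or_lt with rfl | hut'
  · simpa [areaError_self] using hnn
  have mu : 0 ≤ u := hs.trans hsu
  have hL := hS.areaDiff_chen hx hs hsu' hut' ht es eu et
  have e1 := areaTimesId_of_chen (filt_mono X hsu) hL (U1 s)
  have e2 := idTimesAreaStar_of_chen (filt_mono X hsu) (IsSelfAdjoint.zero A)
    (IsSelfAdjoint.zero A) hL (U2 s)
  have z : ∀ V : PTensor 2 A, sharp (0 : A) V = 0 := fun V =>
    norm_le_zero_iff.1 ((norm_sharp_le _ _).trans_eq (by simp))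
  rw [z] at e1 e2
  have e3 := (areaTimesId (areaOn (filt X u) (interp X D) u t - ambientArea L u t)).map_sub (U1 u)
    (tmap 3 (subInclLE (filt_mono X hsu)) (U1 s))
  have e4 := (idTimesAreaStar (areaOn (filt X u) (interp X D) u t - ambientArea L u t)).map_sub
    (U2 u) (tmap 3 (subInclLE (filt_mono X hsu)) (U2 s))
  have b1 := hD.norm_areaTimesId_le mu hut' ht
    (U1 u - tmap 3 (subInclLE (filt_mono X hsu)) (U1 s))
  have b2 := hD.norm_idTimesAreaStar_le mu hut' ht
    (U2 u - tmap 3 (subInclLE (filt_mono X hsu)) (U2 s))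
  have d1 := (hS.rep.lip₁ s u hs hsu (hut.trans ht)).trans
    (mul_le_mul_of_nonneg_left (hS.drv.holder s u hs hsu (hut.trans ht)) hK)
  have d2 := (hS.rep.lip₂ s u hs hsu (hut.trans ht)).trans
    (mul_le_mul_of_nonneg_left (hS.drv.holder s u hs hsu (hut.trans ht)) hK)
  have hp : 0 ≤ ε * (t - u) ^ (2 * γ) := by positivity
  have b1' := b1.trans (mul_le_mul_of_nonneg_left d1 hp)
  have b2' := b2.trans (mul_le_mul_of_nonneg_left d2 hp)
  have key : areaError X L (interp X D) U1 U2 s t - areaError X L (interp X D) U1 U2 s u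
      - areaError X L (interp X D) U1 U2 u t =
      -areaTimesId (areaOn (filt X u) (interp X D) u t - ambientArea L u t)
        (U1 u - tmap 3 (subInclLE (filt_mono X hsu)) (U1 s))
      - idTimesAreaStar (areaOn (filt X u) (interp X D) u t - ambientArea L u t)
        (U2 u - tmap 3 (subInclLE (filt_mono X hsu)) (U2 s)) := by
    rw [areaError_of_lt (hsu'.trans hut'), areaError_of_lt hsu', areaError_of_lt hut', e3, e4]
    rw [sub_eq_zero, sub_eq_iff_eq_add] at e1 e2
    rw [e1, e2]
    clear * -
    abel
  have e : (t - s) ^ (3 * γ) = (t - s) ^ (2 * γ) * (t - s) ^ γ := by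
    rw [← Real.rpow_add_of_nonneg p3 (by positivity) hγ.le]; ring_nf
  rw [key]
  refine (norm_sub_le_of_le ((norm_neg _).trans_le b1') b2').trans ?_
  calc _ = 2 * ε * K * H * ((t - u) ^ (2 * γ) * (u - s) ^ γ) := by ring
    _ ≤ 2 * ε * K * H * ((t - s) ^ (2 * γ) * (t - s) ^ γ) := by gcongr
    _ = _ := by rw [e]

end CloseInterp

end Convergence

/-! ### Comparison of the two integrals on all intervals. -/

section Global

variable {A : Type*} [CStarAlgebra A]
variable {T γ H R K ε η : ℝ} {X : ℝ → A} {L : AreaFamily X} {U : (s : ℝ) → PTensor 2 (filt X s)}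
  {U1 U2 : (s : ℝ) → PTensor 3 (filt X s)} {F : A → PTensor 2 A} {F1 F2 : A → PTensor 3 A}
  {D : TimePartition T}

theorem sub_eq_sum_Ico {E : Type*} [AddCommGroup E] {k : ℕ} {g : ℕ → ℕ → E}
    (h0 : ∀ i ≤ k, g i i = 0)
    (hg : ∀ i j l, i ≤ j → j ≤ l → l ≤ k → g i j + g j l = g i l) {i j : ℕ} (hij : i ≤ j)
    (hj : j ≤ k) : g i j = ∑ l ∈ Finset.Ico i j, g l (l + 1) := by
  induction hij with
  | refl => simp [h0 i hj]
  | @step m hm ih =>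
    have hm' : i ≤ m := hm
    rw [Finset.sum_Ico_succ_top hm', ← ih (by omega), hg i m (m + 1) hm' (by omega) hj]

/-- The rate at which cells of length at most `η` contribute. -/
def meshRate (γ η : ℝ) : ℝ := η ^ (3 * γ - max γ 1) + η ^ γ

theorem meshRate_nonneg (γ : ℝ) (hη : 0 ≤ η) : 0 ≤ meshRate γ η := by
  unfold meshRate; positivity

/-- With `m = max γ 1`, the telescoping in `sum_rpow_le` needs `m ≥ 1`, and the final `γ`-Hölder
bound needs `m ≥ γ`; the exponent `3γ - m` left for the mesh is positive exactly because `γ > 1/3`.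
-/
theorem tendsto_meshRate (hγ : 1 / 3 < γ) : Tendsto (meshRate γ) (𝓝 0) (𝓝 0) := by
  have h1 : 0 < 3 * γ - max γ 1 := by
    rcases max_cases γ 1 with h | h <;> linarith
  have h2 : 0 < γ := by linarith
  have h : Continuous (meshRate γ) :=
    (Real.continuous_rpow_const h1.le).add (Real.continuous_rpow_const h2.le)
  have h3 := h.tendsto 0
  rwa [meshRate, Real.zero_rpow h1.ne', Real.zero_rpow h2.ne', add_zero] at h3

/-- Between partition points both integrals are sums over cells. The area errors have order `2γ`,
which does not suffice for a termwise sum, but by `discrete_sewing` their sum is the area error of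
the whole interval up to a term of order `3γ` with a factor `ε`. The remaining errors have order
`3γ` on each cell and sum to a power of the mesh. -/
theorem CloseInterp.exists_points_bound (hS : RoughSetting T γ H R K X L U U1 U2 F F1 F2) :
    ∃ C, 0 ≤ C ∧ ∀ (ε η : ℝ) (D : TimePartition T), CloseInterp T γ ε η X L D →
      Continuous (fun u => F (interp X D u)) → ∀ i j, i ≤ j → j ≤ D.k →
      ‖pathIntegral (interp X D) F (D.pt i) (D.pt j)
        - roughIntegral T γ X L U U1 U2 (D.pt i) (D.pt j)‖ ≤
        C * (ε + meshRate γ η) * (D.pt j - D.pt i) ^ γ := by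
  have hγ := hS.exp_pos
  have hK := hS.exp.nonneg
  have hH := hS.drv.nonneg
  have hT := hS.drv.pos
  have hθ : 1 < 3 * γ := by linarith [hS.drv.lt_exp]
  obtain ⟨C, hC, hC'⟩ := hS.exists_norm_roughIntegral_sub_germ_le
  set m := max γ 1 with hm
  have hmγ : 0 ≤ m - γ := sub_nonneg.2 (le_max_left _ _)
  have hq : 0 < 3 * γ - m := by
    rcases max_cases γ 1 with h | h <;> linarith
  have hw := (sewConst_pos hθ).le
  set C₁ := sewConst (3 * γ) * (2 * K * H) * T ^ (2 * γ) + 2 * K * T ^ γ with hC₁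
  set C₂ := (K * H ^ 3 + C) * T ^ (m - γ) with hC₂
  have hC₁0 : 0 ≤ C₁ := by positivity
  have hC₂0 : 0 ≤ C₂ := by positivity
  refine ⟨C₁ + C₂, by positivity, fun ε η D hD hF i j hij hj => ?_⟩
  have hx := plPath_interp D X hS.drv.sa hT
  have hε := hD.eps_nonneg
  have hη : 0 ≤ η := (sub_pos.2 (D.pt_lt 0 (D.k_pos hT))).le.trans (hD.step_le 0 (D.k_pos hT))
  have mi := D.pt_mem (hij.trans hj)
  have mj := D.pt_mem hj
  have hpij := D.pt_mono hij hj
  have hΔ : 0 ≤ D.pt j - D.pt i := sub_nonneg.2 hpij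
  have hΔT : D.pt j - D.pt i ≤ T := by linarith [mi.1, mj.2]
  have r1 : (D.pt j - D.pt i) ^ (3 * γ) ≤ T ^ (2 * γ) * (D.pt j - D.pt i) ^ γ := by
    rw [show 3 * γ = 2 * γ + γ by ring]
    exact rpow_le_mul_rpow (by positivity) hγ hΔ hΔT
  have r2 : (D.pt j - D.pt i) ^ (2 * γ) ≤ T ^ γ * (D.pt j - D.pt i) ^ γ := by
    rw [two_mul]
    exact rpow_le_mul_rpow hγ.le hγ hΔ hΔT
  have r3 : (D.pt j - D.pt i) ^ m ≤ T ^ (m - γ) * (D.pt j - D.pt i) ^ γ := by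
    have := rpow_le_mul_rpow hmγ hγ hΔ hΔT
    rwa [sub_add_cancel] at this
  -- the area errors, summed over the cells
  have hsew := discrete_sewing hθ (K := 2 * ε * K * H) (by positivity) D.pt D.k
    (fun a b hab hb => D.pt_mono hab hb)
    (fun a b => areaError X L (interp X D) U1 U2 (D.pt a) (D.pt b))
    (fun a _ => areaError_self _)
    (fun a b c hab hbc hc => hD.norm_delta_areaError_le hS hx (D.pt_mem (by omega)).1
      (D.pt_mono hab (by omega)) (D.pt_mono hbc hc) (D.pt_mem hc).2
      (interp_pt D X (by omega) hT) (interp_pt D X (by omega) hT) (interp_pt D X hc hT))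
    (j - i) i (by omega)
  have hN := hD.norm_areaError_le hS mi.1 hpij mj.2
  have hji : i + (j - i) = j := by omega
  rw [hji] at hsew
  have hsum : ∑ l ∈ Finset.Ico i j, areaError X L (interp X D) U1 U2 (D.pt l) (D.pt (l + 1)) =
      ∑ l ∈ Finset.range (j - i),
        areaError X L (interp X D) U1 U2 (D.pt (i + l)) (D.pt (i + l + 1)) :=
    Finset.sum_Ico_eq_sum_range _ _ _
  have b1 : ‖∑ l ∈ Finset.Ico i j, areaError X L (interp X D) U1 U2 (D.pt l) (D.pt (l + 1))‖ ≤
      C₁ * ε * (D.pt j - D.pt i) ^ γ := by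
    rw [hsum, ← sub_sub_cancel (areaError X L (interp X D) U1 U2 (D.pt i) (D.pt j))
      (∑ l ∈ Finset.range (j - i), _)]
    refine (norm_sub_le_of_le hN hsew).trans ?_
    calc _ ≤ 2 * ε * K * (T ^ γ * (D.pt j - D.pt i) ^ γ)
          + sewConst (3 * γ) * (2 * ε * K * H) * (T ^ (2 * γ) * (D.pt j - D.pt i) ^ γ) := by
            gcongr
      _ = _ := by rw [hC₁]; ring
  -- the higher order terms
  have b2 : ∑ l ∈ Finset.Ico i j, (K * H ^ 3 + C) * (D.pt (l + 1) - D.pt l) ^ (3 * γ) ≤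
      C₂ * meshRate γ η * (D.pt j - D.pt i) ^ γ := by
    have h1 := sum_rpow_le (p := D.pt) (m := m) (η := η) (le_max_right γ 1) hq hij
      fun l _ hl => ⟨(D.pt_lt l (by omega)).le, hD.step_le l (by omega)⟩
    rw [sub_add_cancel] at h1
    have h2 : η ^ (3 * γ - m) ≤ meshRate γ η := le_add_of_nonneg_right (by positivity)
    rw [← Finset.mul_sum]
    calc _ ≤ (K * H ^ 3 + C) * (meshRate γ η * (T ^ (m - γ) * (D.pt j - D.pt i) ^ γ)) := by
            refine mul_le_mul_of_nonneg_left (h1.trans ?_) (by positivity)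
            exact mul_le_mul h2 r3 (by positivity) (meshRate_nonneg γ hη)
      _ = _ := by rw [hC₂]; ring
  have e1 := sub_eq_sum_Ico (k := D.k)
    (g := fun a b => pathIntegral (interp X D) F (D.pt a) (D.pt b)
      - roughIntegral T γ X L U U1 U2 (D.pt a) (D.pt b))
    (fun a ha => by
      rw [hS.roughIntegral_self (D.pt_mem ha), pathIntegral, intervalIntegral.integral_same,
        sub_zero])
    (fun a b c hab hbc hc => by
      rw [← hx.pathIntegral_add hF (D.pt a) (D.pt b) (D.pt c),
        ← hS.roughIntegral_add (D.pt_mem (hab.trans (hbc.trans hc))).1 (D.pt_mono hab (hbc.trans hc))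
          (D.pt_mono hbc hc) (D.pt_mem hc).2]
      abel) hij hj
  rw [e1, ← sub_add_cancel (∑ l ∈ Finset.Ico i j, _)
    (∑ l ∈ Finset.Ico i j, areaError X L (interp X D) U1 U2 (D.pt l) (D.pt (l + 1))),
    ← Finset.sum_sub_distrib]
  have b3 := norm_sum_le_of_le (Finset.Ico i j) fun l hl =>
    hS.norm_cell_le hx hF hC' (i := l) (lt_of_lt_of_le (Finset.mem_Ico.1 hl).2 hj)
  refine (norm_add_le_of_le (b3.trans b2) b1).trans ?_
  have hr := meshRate_nonneg γ hη
  have hp : 0 ≤ (D.pt j - D.pt i) ^ γ := by positivity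
  nlinarith [mul_nonneg (mul_nonneg hC₁0 hr) hp, mul_nonneg (mul_nonneg hC₂0 hε) hp]

/-- Both paths start at `X 0`, so the Hölder seminorm of the difference controls its supremum. -/
theorem CloseInterp.norm_interp_sub_le (hS : RoughSetting T γ H R K X L U U1 U2 F F1 F2)
    (hD : CloseInterp T γ ε η X L D) {s : ℝ} (hs : s ∈ Icc 0 T) :
    ‖interp X D s - X s‖ ≤ ε * T ^ γ := by
  have hε := hD.eps_nonneg
  have hT := hS.drv.pos
  have hγ := hS.exp_pos
  rcases hs.1.eq_or_lt with rfl | h0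
  · rw [interp_zero, sub_self, norm_zero]; positivity
  · have h := hD.path 0 s le_rfl h0 hs.2
    rw [interp_zero, sub_self, sub_zero, sub_zero] at h
    refine h.trans ?_
    have := hs.2
    gcongr

/-- Inside a cell the interpolation need not be adapted, so the areas cannot be compared as on whole
cells. First order expansions suffice: their errors are `O((t - s)^{2γ})`, one factor `(t - s)^γ` is
at most `η^γ`, and the first order terms themselves are `ε`-close. -/
theorem CloseInterp.exists_cell_bound (hS : RoughSetting T γ H R K X L U U1 U2 F F1 F2) :
    ∃ C, 0 ≤ C ∧ ∀ (ε η : ℝ) (D : TimePartition T), CloseInterp T γ ε η X L D →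
      Continuous (fun u => F (interp X D u)) → ∀ i < D.k, ∀ s t, D.pt i ≤ s → s ≤ t →
      t ≤ D.pt (i + 1) →
      ‖pathIntegral (interp X D) F s t - roughIntegral T γ X L U U1 U2 s t‖ ≤
        C * (ε + meshRate γ η) * (t - s) ^ γ := by
  have hγ := hS.exp_pos
  have hK := hS.exp.nonneg
  have hH := hS.drv.nonneg
  have hT := hS.drv.pos
  obtain ⟨C, hC, hC'⟩ := hS.exists_norm_roughIntegral_sub_sharp_le
  set C₁ := K * (H + 1) ^ 2 + C with hC₁
  set C₂ := K + H * (K * T ^ γ) with hC₂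
  have hC₁0 : 0 ≤ C₁ := by positivity
  have hC₂0 : 0 ≤ C₂ := by positivity
  refine ⟨C₁ + C₂, by positivity, fun ε η D hD hF i hi s t his hst hti => ?_⟩
  have hx := plPath_interp D X hS.drv.sa hT
  have hε := hD.eps_nonneg
  have hε1 := hD.eps_le
  have hη : 0 ≤ η := (sub_pos.2 (D.pt_lt i hi)).le.trans (hD.step_le i hi)
  rcases hst.eq_or_lt with rfl | hlt
  · rw [hS.roughIntegral_self ⟨(D.pt_mem hi.le).1.trans his, hti.trans (D.pt_mem hi).2⟩,
      pathIntegral, intervalIntegral.integral_same, sub_zero, norm_zero, sub_self,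
      Real.zero_rpow hγ.ne', mul_zero]
  have hs0 : 0 ≤ s := (D.pt_mem hi.le).1.trans his
  have htT : t ≤ T := hti.trans (D.pt_mem hi).2
  have ms : s ∈ Icc 0 T := ⟨hs0, hst.trans htT⟩
  have mt : t ∈ Icc 0 T := ⟨hs0.trans hst, htT⟩
  have p := sub_nonneg.2 hst
  have hrx : ∀ u ∈ Icc s t, ‖interp X D u‖ ≤ R := fun u hu =>
    norm_interp_le hT D hS.norm_le ⟨hs0.trans hu.1, hu.2.trans htT⟩
  have hpath := hD.path s t hs0 hlt htT
  have hhol := hS.drv.holder s t hs0 hst htT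
  have e0 : interp X D t - interp X D s = (X t - X s)
      + (interp X D t - X t - (interp X D s - X s)) := by abel
  have hv : ‖interp X D t - interp X D s‖ ≤ (H + 1) * (t - s) ^ γ := by
    -- Since `ε ≤ 1`, the interpolation has Hölder constant at most `H + 1`, uniformly in the
    -- partition.
    rw [e0, add_mul, one_mul]
    exact norm_add_le_of_le hhol
      (hpath.trans (mul_le_of_le_one_left (Real.rpow_nonneg p _) hε1))
  have h1 := hx.norm_pathIntegral_sub_le hS.exp hF hst (interp_affine D X hi his hti) hrx
  have h2 := hC' s t hs0 hst htT
  have h3 : ‖sharp (interp X D t - X t - (interp X D s - X s)) (F (interp X D s))‖ ≤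
      ε * (t - s) ^ γ * K :=
    (norm_sharp_le _ _).trans (mul_le_mul hpath
      (hS.exp.norm _ (hx.sa s) (hrx s ⟨le_rfl, hst⟩)) (norm_nonneg _) (by positivity))
  have h4 : ‖sharp (X t - X s) (F (interp X D s) - F (X s))‖ ≤
      H * (t - s) ^ γ * (K * (ε * T ^ γ)) := by
    refine (norm_sharp_le _ _).trans (mul_le_mul hhol ?_ (norm_nonneg _) (by positivity))
    exact (hS.exp.lip _ _ (hS.drv.sa s ms) (hx.sa s) (hS.norm_le s ms) (hrx s ⟨le_rfl, hst⟩)).trans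
      (mul_le_mul_of_nonneg_left (hD.norm_interp_sub_le hS ms) hK)
  have hsq : (t - s) ^ (2 * γ) = ((t - s) ^ γ) ^ 2 := by
    rw [mul_comm, Real.rpow_mul p, Real.rpow_two]
  have h5 : (t - s) ^ (2 * γ) ≤ meshRate γ η * (t - s) ^ γ := by
    rw [hsq, sq]
    refine mul_le_mul_of_nonneg_right ?_ (by positivity)
    have : t - s ≤ η := by linarith [hD.step_le i hi]
    exact (Real.rpow_le_rpow p this hγ.le).trans (le_add_of_nonneg_left (by positivity))
  have h6 : K * ‖interp X D t - interp X D s‖ ^ 2 ≤ K * (H + 1) ^ 2 * (t - s) ^ (2 * γ) := by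
    rw [hsq, mul_assoc, ← mul_pow]
    gcongr
  have key : pathIntegral (interp X D) F s t - roughIntegral T γ X L U U1 U2 s t =
      (pathIntegral (interp X D) F s t
        - sharp (interp X D t - interp X D s) (F (interp X D s)))
      - (roughIntegral T γ X L U U1 U2 s t - sharp (X t - X s) (F (X s)))
      + sharp (interp X D t - X t - (interp X D s - X s)) (F (interp X D s))
      + sharp (X t - X s) (F (interp X D s) - F (X s)) := by
    have k1 : sharp (interp X D t - interp X D s) (F (interp X D s)) =
        sharp (X t - X s) (F (interp X D s))
          + sharp (interp X D t - X t - (interp X D s - X s)) (F (interp X D s)) := by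
      rw [← sharp_add, ← e0]
    have k2 := (sharp (X t - X s)).map_sub (F (interp X D s)) (F (X s))
    rw [k1, k2]
    clear * -
    abel
  rw [key]
  refine (norm_add_le_of_le (norm_add_le_of_le (norm_sub_le_of_le (h1.trans h6) h2) h3) h4).trans ?_
  have hr := meshRate_nonneg γ hη
  have hp : 0 ≤ (t - s) ^ γ := by positivity
  calc _ = C₁ * (t - s) ^ (2 * γ) + C₂ * ε * (t - s) ^ γ := by rw [hC₁, hC₂]; ring
    _ ≤ C₁ * (meshRate γ η * (t - s) ^ γ) + C₂ * ε * (t - s) ^ γ := by gcongr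
    _ ≤ _ := by
      nlinarith [mul_nonneg (mul_nonneg hC₂0 hr) hp, mul_nonneg (mul_nonneg hC₁0 hε) hp]

/-- An interval that is not inside one cell splits into the end of a cell, a block of whole cells
and the beginning of a cell. -/
theorem CloseInterp.exists_bound (hS : RoughSetting T γ H R K X L U U1 U2 F F1 F2) :
    ∃ C, 0 ≤ C ∧ ∀ (ε η : ℝ) (D : TimePartition T), CloseInterp T γ ε η X L D →
      Continuous (fun u => F (interp X D u)) → ∀ s t, 0 ≤ s → s ≤ t → t ≤ T →
      ‖pathIntegral (interp X D) F s t - roughIntegral T γ X L U U1 U2 s t‖ ≤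
        C * (ε + meshRate γ η) * (t - s) ^ γ := by
  have hγ := hS.exp_pos
  have hT := hS.drv.pos
  obtain ⟨C₁, hC₁, h₁⟩ := CloseInterp.exists_points_bound hS
  obtain ⟨C₂, hC₂, h₂⟩ := CloseInterp.exists_cell_bound hS
  refine ⟨C₂ + C₁ + C₂, by positivity, fun ε η D hD hF s t hs hst ht => ?_⟩
  have hx := plPath_interp D X hS.drv.sa hT
  have hη : 0 ≤ η := (sub_pos.2 (D.pt_lt 0 (D.k_pos hT))).le.trans (hD.step_le 0 (D.k_pos hT))
  have hw : 0 ≤ ε + meshRate γ η := add_nonneg hD.eps_nonneg (meshRate_nonneg γ hη)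
  have hp : 0 ≤ (t - s) ^ γ := Real.rpow_nonneg (sub_nonneg.2 hst) _
  obtain ⟨i, hi, hsi⟩ := D.exists_cell hT ⟨hs, hst.trans ht⟩
  obtain ⟨j, hj, htj⟩ := D.exists_cell hT ⟨hs.trans hst, ht⟩
  by_cases htc : t ≤ D.pt (i + 1)
  · refine (h₂ ε η D hD hF i hi s t hsi.1 hst htc).trans ?_
    gcongr
    linarith
  push Not at htc
  have hij : i + 1 ≤ j := by
    by_contra hcon
    have : j + 1 ≤ i + 1 := by omega
    exact absurd ((htj.2.trans (D.pt_mono this hi)).trans_lt htc) (lt_irrefl _)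
  have hpp := D.pt_mono hij hj.le
  have a1 := h₂ ε η D hD hF i hi s (D.pt (i + 1)) hsi.1 hsi.2 le_rfl
  have a2 := h₁ ε η D hD hF (i + 1) j hij hj.le
  have a3 := h₂ ε η D hD hF j hj (D.pt j) t le_rfl htj.1 htj.2
  have m1 := D.pt_mem (i := i + 1) hi
  have m2 := D.pt_mem hj.le
  have hI := hx.pathIntegral_add hF s (D.pt (i + 1)) t
  have hI' := hx.pathIntegral_add hF (D.pt (i + 1)) (D.pt j) t
  have hJ := hS.roughIntegral_add hs hsi.2 htc.le ht
  have hJ' := hS.roughIntegral_add m1.1 hpp htj.1 ht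
  rw [← hI, ← hI', ← hJ, ← hJ', show ∀ a b c a' b' c' : A, a + (b + c) - (a' + (b' + c')) =
    (a - a') + (b - b') + (c - c') by intros; abel]
  have q1 : C₂ * (ε + meshRate γ η) * (D.pt (i + 1) - s) ^ γ ≤
      C₂ * (ε + meshRate γ η) * (t - s) ^ γ := by
    have := sub_nonneg.2 hsi.2
    gcongr
  have q2 : C₁ * (ε + meshRate γ η) * (D.pt j - D.pt (i + 1)) ^ γ ≤
      C₁ * (ε + meshRate γ η) * (t - s) ^ γ := by
    have h1 := sub_nonneg.2 hpp
    have h2 := htj.1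
    have h3 := hsi.2
    gcongr
  have q3 : C₂ * (ε + meshRate γ η) * (t - D.pt j) ^ γ ≤
      C₂ * (ε + meshRate γ η) * (t - s) ^ γ := by
    have h1 := sub_nonneg.2 htj.1
    have h2 := hsi.2.trans hpp
    gcongr
  exact (norm_add_le_of_le (norm_add_le_of_le (a1.trans q1) (a2.trans q2))
    (a3.trans q3)).trans_eq (by ring)

end Global

/-! ### The seminorm of operator families as a pointwise bound. -/

section Operators

variable {A : Type*} [CStarAlgebra A] {T κ : ℝ} {X : ℝ → A}

/-- The supremum omits `U = 0` and the family is not required to be linear, so its vanishing at `0`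
is a separate input. -/
theorem norm_le_of_holderOp_le {L : (s t : ℝ) → PTensor 2 (filt X s) → A} {C : ℝ} (hC0 : 0 ≤ C)
    (hC : holderOp T κ X L ≤ ENNReal.ofReal C) (h0 : ∀ s t, L s t 0 = 0) {s t : ℝ} (hs : 0 ≤ s)
    (hst : s < t) (ht : t ≤ T) (U : PTensor 2 (filt X s)) :
    ‖L s t U‖ ≤ C * (t - s) ^ κ * ‖U‖ := by
  by_cases hU : U = 0
  · rw [hU, h0, norm_zero, norm_zero, mul_zero]
  have hp : 0 < (t - s) ^ κ := Real.rpow_pos_of_pos (sub_pos.2 hst) _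
  have h1 : ‖L s t U‖ₑ / (ENNReal.ofReal ((t - s) ^ κ) * ‖U‖ₑ) ≤ ENNReal.ofReal C := by
    refine le_trans ?_ hC
    unfold holderOp
    exact le_iSup_of_le s (le_iSup_of_le t (le_iSup_of_le ⟨hs, hst, ht⟩
      (le_iSup_of_le U (le_iSup_of_le hU le_rfl))))
  have hU' : 0 < ‖U‖ := norm_pos_iff.2 hU
  have e : ENNReal.ofReal ((t - s) ^ κ) * ‖U‖ₑ = ENNReal.ofReal ((t - s) ^ κ * ‖U‖) := by
    rw [ENNReal.ofReal_mul hp.le, ofReal_norm]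
  rw [e, ENNReal.div_le_iff (by simpa using mul_pos hp hU') ENNReal.ofReal_ne_top,
    ← ENNReal.ofReal_mul hC0, ← ofReal_norm,
    ENNReal.ofReal_le_ofReal_iff (by positivity)] at h1
  rwa [mul_assoc]

theorem eventually_of_tendsto_holderOp {L : ℕ → (s t : ℝ) → PTensor 2 (filt X s) → A}
    (hL : Tendsto (fun n => holderOp T κ X (L n)) atTop (𝓝 0)) (h0 : ∀ n s t, L n s t 0 = 0)
    {ε : ℝ} (hε : 0 < ε) : ∀ᶠ n in atTop, ∀ s t, 0 ≤ s → s < t → t ≤ T →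
      ∀ U, ‖L n s t U‖ ≤ ε * (t - s) ^ κ * ‖U‖ := by
  filter_upwards [hL.eventually_le_const (ENNReal.ofReal_pos.2 hε)] with n hn s t hs hst ht U
  exact norm_le_of_holderOp_le hε.le hn (h0 n) hs hst ht U

end Operators

/-! ### Classical integrals as elements of the Hölder space, and the fundamental theorem of
calculus. -/

section PathIntegral

variable {A : Type*} [CStarAlgebra A] {T γ H R K : ℝ} {X : ℝ → A}
  {F : A → PTensor 2 A} {F1 F2 : A → PTensor 3 A} {x : ℝ → A}

/-- The difference quotients are `O((t - s)^{γ - 1})`, so the right derivative vanishes. -/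
theorem eq_const_of_holder {E : Type*} [NormedAddCommGroup E] [NormedSpace ℝ E] (hγ : 1 < γ)
    {g : ℝ → E} {C : ℝ} (hg : ∀ s t, 0 ≤ s → s ≤ t → t ≤ T → ‖g t - g s‖ ≤ C * (t - s) ^ γ) :
    ∀ t ∈ Icc 0 T, g t = g 0 := by
  refine constant_of_has_deriv_right_zero (continuousOn_of_holder (by linarith) hg) fun s hs => ?_
  rw [hasDerivWithinAt_iff_isLittleO]
  refine Asymptotics.IsLittleO.of_bound fun c hc => ?_
  have h1 : Tendsto (fun t : ℝ => C * |t - s| ^ (γ - 1)) (𝓝[Ici s] s) (𝓝 0) := by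
    have h2 : Continuous fun t : ℝ => C * |t - s| ^ (γ - 1) := by
      have h2 : Continuous fun t : ℝ => |t - s| := by fun_prop
      exact continuous_const.mul (h2.rpow_const fun _ => Or.inr (by linarith))
    have h3 := (h2.tendsto s).mono_left (nhdsWithin_le_nhds (s := Ici s))
    simpa [Real.zero_rpow (show γ - 1 ≠ 0 by linarith)] using h3
  filter_upwards [h1.eventually_le_const hc, self_mem_nhdsWithin,
    nhdsWithin_le_nhds (Iio_mem_nhds hs.2)] with t h3 h4 h5
  have hst : s ≤ t := h4
  rw [abs_of_nonneg (sub_nonneg.2 hst)] at h3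
  rw [smul_zero, sub_zero, Real.norm_of_nonneg (sub_nonneg.2 hst)]
  refine (hg s t hs.1 hst (le_of_lt h5)).trans ?_
  rcases hst.eq_or_lt with rfl | hlt
  · simp [Real.zero_rpow (show γ ≠ 0 by linarith)]
  · rw [show γ = γ - 1 + 1 by ring, Real.rpow_add_one (sub_pos.2 hlt).ne', ← mul_assoc]
    exact mul_le_mul_of_nonneg_right h3 (sub_nonneg.2 hst)

theorem PLPath.memC₂_pathIntegral (hx : PLPath x) (hT : 0 ≤ T) (hγ : 0 < γ) (hγ1 : γ ≤ 1)
    (hF : Continuous fun u => F (x u)) : MemC₂ T γ (pathIntegral x F) := by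
  obtain ⟨C, hC⟩ := hx.lip
  obtain ⟨M, hM⟩ := (isCompact_Icc (a := (0 : ℝ)) (b := T)).exists_bound_of_continuousOn
    hF.continuousOn
  have hb : ∀ s t, 0 ≤ s → s ≤ t → t ≤ T → ‖pathIntegral x F s t‖ ≤ C * M * (t - s) := by
    intro s t hs hst ht
    have h1 : ∀ u ∈ uIoc s t, ‖sharp (deriv x u) (F (x u))‖ ≤ C * M := fun u hu => by
      rw [uIoc_of_le hst] at hu
      exact (norm_sharp_le _ _).trans (mul_le_mul (norm_deriv_le_of_lipschitz hC)
        (hM u ⟨hs.trans hu.1.le, hu.2.trans ht⟩) (norm_nonneg _) C.2)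
    refine (intervalIntegral.norm_integral_le_of_norm_le_const h1).trans_eq ?_
    rw [abs_of_nonneg (sub_nonneg.2 hst)]
  have hM0 : 0 ≤ M := (norm_nonneg _).trans (hM 0 ⟨le_rfl, hT⟩)
  have e : ∀ s t, pathIntegral x F s t = pathIntegral x F 0 t - pathIntegral x F 0 s :=
    fun s t => by rw [← hx.pathIntegral_add hF 0 s t, add_sub_cancel_left]
  have hc : ContinuousOn (fun t => pathIntegral x F 0 t) (Icc 0 T) :=
    continuousOn_of_holder (κ := 1) (C := C * M) one_pos fun s t hs hst ht => by
      rw [← e, Real.rpow_one]; exact hb s t hs hst ht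
  refine ⟨?_, fun t _ => intervalIntegral.integral_same, ?_⟩
  · have h1 : ContinuousOn (fun p : ℝ × ℝ => pathIntegral x F 0 p.2 - pathIntegral x F 0 p.1)
        (simplex T) :=
      (hc.comp continuous_snd.continuousOn fun p hp => ⟨hp.1.trans hp.2.1, hp.2.2⟩).sub
        (hc.comp continuous_fst.continuousOn fun p hp => ⟨hp.1, hp.2.1.trans hp.2.2⟩)
    exact h1.congr fun p _ => e p.1 p.2
  · refine holder₂_lt_top (C := C * M * T ^ (1 - γ)) fun s t hs hst ht => ?_
    refine (hb s t hs hst.le ht).trans ?_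
    have := rpow_le_mul_rpow (T := T) (sub_nonneg.2 hγ1) hγ (sub_nonneg.2 hst.le) (by linarith)
    rw [sub_add_cancel, Real.rpow_one] at this
    rw [mul_assoc _ (T ^ (1 - γ))]
    exact mul_le_mul_of_nonneg_left this (by positivity)

theorem memC₂_zero : MemC₂ T γ fun _ _ => (0 : A) :=
  ⟨continuousOn_const, fun _ _ => rfl, holder₂_lt_top (C := 0) fun s t _ _ _ => by simp⟩

/-- The integral is Lipschitz in time, hence `γ`-Hölder only for `γ ≤ 1`. For `γ > 1` the path `X`
is constant and the integral is zero. -/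
theorem memC₂_pathIntegral_interp (hT : 0 < T) (hγ : 0 < γ)
    (hX : ∀ t ∈ Icc 0 T, IsSelfAdjoint (X t))
    (hH : ∀ s t, 0 ≤ s → s ≤ t → t ≤ T → ‖X t - X s‖ ≤ H * (t - s) ^ γ)
    (D : TimePartition T) (hF : Continuous fun u => F (interp X D u)) :
    MemC₂ T γ (pathIntegral (interp X D) F) := by
  rcases le_or_gt γ 1 with h | h
  · exact (plPath_interp D X hX hT).memC₂_pathIntegral hT.le hγ h hF
  · have h1 := interp_const D X (eq_const_of_holder h hH) hT
    have h2 : pathIntegral (interp X D) F = fun _ _ => 0 := by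
      funext s t
      have hz : ∀ V : PTensor 2 A, sharp (0 : A) V = 0 := fun V =>
        norm_le_zero_iff.1 ((norm_sharp_le _ _).trans_eq (by simp))
      simp [pathIntegral, h1, hz]
    rw [h2]
    exact memC₂_zero

theorem PLPath.continuous_comp (hx : PLPath x) (hR : ∀ t, ‖x t‖ ≤ R)
    (hE : Expansion F F1 F2 R K) : Continuous fun u => F (x u) := by
  obtain ⟨C, hC⟩ := hx.lip
  refine (LipschitzWith.of_dist_le_mul (K := K.toNNReal * C) fun s t => ?_).continuous
  rw [dist_eq_norm, NNReal.coe_mul, Real.coe_toNNReal _ hE.nonneg, mul_assoc]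
  refine (hE.lip _ _ (hx.sa t) (hx.sa s) (hR t) (hR s)).trans ?_
  refine mul_le_mul_of_nonneg_left ?_ hE.nonneg
  rw [← dist_eq_norm]
  exact hC.dist_le_mul s t

theorem continuous_comp_interp (hT : 0 < T) (hX : ∀ t ∈ Icc 0 T, IsSelfAdjoint (X t))
    (D : TimePartition T) (hE : ∀ R, ∃ K, Expansion F F1 F2 R K) :
    Continuous fun u => F (interp X D u) := by
  obtain ⟨R, hR⟩ := exists_norm_interp_le D X
  obtain ⟨K, hK⟩ := hE R
  exact (plPath_interp D X hX hT).continuous_comp hR hK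

theorem hasDerivAt_zero_of_sq {E : Type*} [NormedAddCommGroup E] [NormedSpace ℝ E] {g : ℝ → E}
    {u C : ℝ} (h : ∀ w, ‖g w - g u‖ ≤ C * |w - u| ^ 2) : HasDerivAt g 0 u := by
  rw [hasDerivAt_iff_isLittleO]
  refine Asymptotics.IsLittleO.of_bound fun c hc => ?_
  have h1 : Tendsto (fun w : ℝ => C * |w - u|) (𝓝 u) (𝓝 0) := by
    have h2 : Continuous fun w : ℝ => C * |w - u| := by fun_prop
    simpa using h2.tendsto u
  filter_upwards [h1.eventually_le_const hc] with w hw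
  rw [smul_zero, sub_zero, Real.norm_eq_abs]
  refine (h w).trans ?_
  rw [sq, ← mul_assoc]
  exact mul_le_mul_of_nonneg_right hw (abs_nonneg _)

/-- The fundamental theorem of calculus for `f(x)` along a piecewise linear path. -/
theorem PLPath.pathIntegral_deriv₁ (hx : PLPath x) {k : ℕ} {f : TestFn k} (hK : 0 ≤ K)
    (hf : ∀ s t, f.Bounds K (x s) (x t)) (hF : Continuous fun u => f.deriv₁ (x u)) (s t : ℝ) :
    pathIntegral x f.deriv₁ s t = f.eval (x t) - f.eval (x s) := by
  obtain ⟨N, hN, hd⟩ := hx.diff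
  obtain ⟨C, hC⟩ := hx.lip
  have hlip : ∀ u w, ‖x w - x u‖ ≤ C * |w - u| := fun u w => by
    have := hC.dist_le_mul w u
    rwa [dist_eq_norm, Real.dist_eq] at this
  refine integral_eq_of_hasDerivAt_off_countable (fun u => f.eval (x u))
    (fun u => sharp (deriv x u) (f.deriv₁ (x u))) hN ?_ (fun u hu => ?_)
    (hx.intervalIntegrable_sharp hF s t)
  · have h1 : LipschitzWith (K.toNNReal * C) fun u => f.eval (x u) :=
      LipschitzWith.of_dist_le_mul fun a b => by
        rw [dist_eq_norm, Real.dist_eq, NNReal.coe_mul, Real.coe_toNNReal _ hK, mul_assoc]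
        exact ((hf b a).lip_eval).trans (mul_le_mul_of_nonneg_left (hlip b a) hK)
    exact h1.continuous.continuousOn
  · have h1 : HasDerivAt (fun w => (sharpL A).flip (f.deriv₁ (x u)) (x w))
        ((sharpL A).flip (f.deriv₁ (x u)) (deriv x u)) u :=
      (((sharpL A).flip (f.deriv₁ (x u))).restrictScalars ℝ).hasFDerivAt.comp_hasDerivAt u
        (hd u hu.2).hasDerivAt
    -- Minus its linearization at `x u`, the composition moves by `O(|w - u|²)`; the linearization
    -- is differentiated through the derivative of `x`.
    have h2 : HasDerivAt (fun w => f.eval (x w) - (sharpL A).flip (f.deriv₁ (x u)) (x w)) 0 u := by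
      refine hasDerivAt_zero_of_sq (C := K * C ^ 2) fun w => ?_
      have e : f.eval (x w) - (sharpL A).flip (f.deriv₁ (x u)) (x w)
          - (f.eval (x u) - (sharpL A).flip (f.deriv₁ (x u)) (x u)) =
          f.eval (x w) - f.eval (x u) - sharp (x w - x u) (f.deriv₁ (x u)) := by
        rw [sharp_sub]
        change f.eval (x w) - sharp (x w) (f.deriv₁ (x u))
          - (f.eval (x u) - sharp (x u) (f.deriv₁ (x u))) = _
        abel
      rw [e, mul_assoc, ← mul_pow]
      refine ((hf u w).taylor_eval).trans ?_
      have := hlip u w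
      gcongr
    have h3 := h2.add h1
    rw [zero_add] at h3
    refine h3.congr_of_eventuallyEq (Eventually.of_forall fun w => ?_)
    simp

end PathIntegral

/-! ### Passage to the limit along the partitions. -/

section Limits

variable {A : Type*} [CStarAlgebra A]
variable {T γ H R K : ℝ} {X : ℝ → A} {L : AreaFamily X} {U : (s : ℝ) → PTensor 2 (filt X s)}
  {U1 U2 : (s : ℝ) → PTensor 3 (filt X s)} {F : A → PTensor 2 A} {F1 F2 : A → PTensor 3 A}
  {D : ℕ → TimePartition T}

theorem tendsto_of_eventually_norm_sub_le {E : Type*} [NormedAddCommGroup E] {a : ℕ → E} {l : E}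
    (c : ℝ) (h : ∀ ε > 0, ∀ᶠ n in atTop, ‖a n - l‖ ≤ ε * c) : Tendsto a atTop (𝓝 l) := by
  rw [Metric.tendsto_nhds]
  intro ε hε
  have hc : 0 < |c| + 1 := by positivity
  filter_upwards [h (ε / 2 / (|c| + 1)) (by positivity)] with n hn
  rw [dist_eq_norm]
  refine hn.trans_lt ?_
  calc ε / 2 / (|c| + 1) * c ≤ ε / 2 / (|c| + 1) * (|c| + 1) := by
        have := le_abs_self c
        gcongr
        linarith
    _ = ε / 2 := by field_simp
    _ < ε := half_lt_self hε

theorem tendsto_interp (hγ : 0 < γ)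
    (hconv : Tendsto (fun n => holder₁ T γ fun t => interp X (D n) t - X t) atTop (𝓝 0))
    {t : ℝ} (ht : t ∈ Icc 0 T) : Tendsto (fun n => interp X (D n) t) atTop (𝓝 (X t)) := by
  refine tendsto_of_eventually_norm_sub_le (t ^ γ) fun ε hε => ?_
  filter_upwards [eventually_of_tendsto_holder₂ hconv hε] with n hn
  rcases ht.1.eq_or_lt with rfl | h0
  · rw [interp_zero, sub_self, norm_zero, Real.zero_rpow hγ.ne', mul_zero]
  · have h := hn 0 t le_rfl h0 ht.2
    rwa [interp_zero, sub_self, sub_zero, sub_zero] at h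

variable (hconv₂ : Tendsto (fun n => holderOp T (2 * γ) X fun s t V =>
  smoothArea (interp X (D n)) s t (toAmbient 2 X s V) - (L s t V : A)) atTop (𝓝 0))

theorem smoothArea_zero (x : ℝ → A) (s t : ℝ) : smoothArea x s t 0 = 0 := by
  simp [smoothArea]

include hconv₂

theorem eventually_smoothArea {ε : ℝ} (hε : 0 < ε) : ∀ᶠ n in atTop, ∀ s t, 0 ≤ s → s < t → t ≤ T →
    ∀ V, ‖smoothArea (interp X (D n)) s t (toAmbient 2 X s V) - (L s t V : A)‖ ≤
      ε * (t - s) ^ (2 * γ) * ‖V‖ :=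
  eventually_of_tendsto_holderOp hconv₂ (fun n s t => by
    rw [map_zero, map_zero, smoothArea_zero]; simp) hε

theorem tendsto_smoothArea {s t : ℝ} (hs : 0 ≤ s) (hst : s < t) (ht : t ≤ T)
    (V : PTensor 2 (filt X s)) :
    Tendsto (fun n => smoothArea (interp X (D n)) s t (toAmbient 2 X s V)) atTop
      (𝓝 (L s t V : A)) :=
  tendsto_of_eventually_norm_sub_le ((t - s) ^ (2 * γ) * ‖V‖) fun ε hε => by
    filter_upwards [eventually_smoothArea hconv₂ hε] with n hn
    exact (hn s t hs hst ht V).trans_eq (mul_assoc _ _ _)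

/-- Chen's relation passes to the limit. -/
theorem chen_of_tendsto (hT : 0 < T) (hγ : 0 < γ) (hXsa : ∀ t ∈ Icc 0 T, IsSelfAdjoint (X t))
    (hconv₁ : Tendsto (fun n => holder₁ T γ fun t => interp X (D n) t - X t) atTop (𝓝 0))
    (s u t : ℝ) (hs : 0 ≤ s) (hsu : s < u) (hut : u < t) (ht : t ≤ T) (V : PTensor 2 (filt X s)) :
    (L s t V : A) - L s u V - L u t (tmap 2 (subInclLE (filt_mono X hsu.le)) V) =
      sharp (X u - X s) (toAmbient 2 X s V) * (X t - X u) := by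
  have hu : 0 ≤ u := hs.trans hsu.le
  have l1 := tendsto_smoothArea hconv₂ hs (hsu.trans hut) ht V
  have l2 := tendsto_smoothArea hconv₂ hs hsu (hut.le.trans ht) V
  have l3 := tendsto_smoothArea hconv₂ hu hut ht (tmap 2 (subInclLE (filt_mono X hsu.le)) V)
  have e : toAmbient 2 X u (tmap 2 (subInclLE (filt_mono X hsu.le)) V) = toAmbient 2 X s V :=
    tmap_subIncl_subInclLE _ V
  rw [e] at l3
  have x1 := tendsto_interp hγ hconv₁ (t := s) ⟨hs, (hsu.trans hut).le.trans ht⟩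
  have x2 := tendsto_interp hγ hconv₁ (t := u) ⟨hu, hut.le.trans ht⟩
  have x3 := tendsto_interp hγ hconv₁ (t := t) ⟨hu.trans hut.le, ht⟩
  have l4 := (((sharpL A).flip (toAmbient 2 X s V)).continuous.tendsto _).comp (x2.sub x1)
  have l5 : Tendsto (fun n => sharp (interp X (D n) u - interp X (D n) s) (toAmbient 2 X s V)
      * (interp X (D n) t - interp X (D n) u)) atTop
      (𝓝 (sharp (X u - X s) (toAmbient 2 X s V) * (X t - X u))) := l4.mul (x3.sub x2)
  refine tendsto_nhds_unique ((l1.sub l2).sub l3) (l5.congr fun n => ?_)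
  exact ((plPath_interp (D n) X hXsa hT).smoothArea_chen s u t (toAmbient 2 X s V)).symm

theorem eventually_closeInterp (hT : 0 < T) (hXsa : ∀ t ∈ Icc 0 T, IsSelfAdjoint (X t))
    (hD : Tendsto (fun n => (D n).mesh) atTop (𝓝 0))
    (hconv₁ : Tendsto (fun n => holder₁ T γ fun t => interp X (D n) t - X t) atTop (𝓝 0))
    {ε η : ℝ} (hε : 0 < ε) (hε1 : ε ≤ 1) (hη : 0 < η) :
    ∀ᶠ n in atTop, CloseInterp T γ ε η X L (D n) := by
  filter_upwards [eventually_smoothArea hconv₂ hε, eventually_of_tendsto_holder₂ hconv₁ hε,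
    hD.eventually_le_const hη] with n h1 h2 h3
  refine ⟨hε.le, hε1, fun i hi => ((D n).step_le_mesh hi).trans h3, h2,
    fun s t hs hst ht V => ?_⟩
  rw [(plPath_interp (D n) X hXsa hT).areaOn_apply]
  exact h1 s t hs hst ht V

/-- The classical integrals along the interpolations converge to the rough integral. -/
theorem RoughSetting.tendstoC₂ (hS : RoughSetting T γ H R K X L U U1 U2 F F1 F2)
    (hE : ∀ R, ∃ K, Expansion F F1 F2 R K) (hD : Tendsto (fun n => (D n).mesh) atTop (𝓝 0))
    (hconv₁ : Tendsto (fun n => holder₁ T γ fun t => interp X (D n) t - X t) atTop (𝓝 0)) :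
    TendstoC₂ T γ (fun n => pathIntegral (interp X (D n)) F) (roughIntegral T γ X L U U1 U2) := by
  have hT := hS.drv.pos
  have hF : ∀ n, Continuous fun u => F (interp X (D n) u) := fun n =>
    continuous_comp_interp hT hS.drv.sa (D n) hE
  refine ⟨fun n => memC₂_pathIntegral_interp hT hS.exp_pos hS.drv.sa hS.drv.holder (D n) (hF n),
    hS.memC₂_roughIntegral, tendsto_holder₂_zero fun ε hε => ?_⟩
  obtain ⟨C, hC, h⟩ := CloseInterp.exists_bound hS
  -- Half of `ε` is reserved for the distance to the limit and half for the mesh rate. `C + 1`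
  -- avoids a division by zero, and the minimum with `1` meets `CloseInterp.eps_le`.
  have hδ : 0 < min 1 (ε / (2 * (C + 1))) := lt_min one_pos (by positivity)
  have hδε : C * (min 1 (ε / (2 * (C + 1))) + min 1 (ε / (2 * (C + 1)))) ≤ ε := by
    have h1 : min 1 (ε / (2 * (C + 1))) ≤ ε / (2 * (C + 1)) := min_le_right _ _
    calc _ ≤ (C + 1) * (ε / (2 * (C + 1)) + ε / (2 * (C + 1))) := by gcongr; linarith
      _ = ε := by field_simp; ring
  set δ := min 1 (ε / (2 * (C + 1)))
  obtain ⟨η, hη1, hη⟩ : ∃ η, meshRate γ η ≤ δ ∧ 0 < η := by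
    have h1 := ((tendsto_meshRate hS.drv.lt_exp).mono_left
      (nhdsWithin_le_nhds (s := Ioi 0))).eventually_le_const hδ
    exact (h1.and self_mem_nhdsWithin).exists
  filter_upwards [eventually_closeInterp hconv₂ hT hS.drv.sa hD hconv₁ hδ (min_le_left _ _) hη]
    with n hn s t hs hst ht
  refine (h δ η (D n) hn (hF n) s t hs hst.le ht).trans ?_
  refine mul_le_mul_of_nonneg_right (le_trans ?_ hδε) (Real.rpow_nonneg (sub_nonneg.2 hst.le) _)
  gcongr

end Limits

/-! ### Common constants for the driver. -/

section Drivers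

variable {A : Type*} [CStarAlgebra A] {T γ : ℝ} {X : ℝ → A} {L : AreaFamily X}

theorem exists_roughDriver (hT : 0 < T) (hγ : 1 / 3 < γ)
    (hXsa : ∀ t ∈ Icc 0 T, IsSelfAdjoint (X t)) (hX : MemC₁ T γ X)
    (hL : IsProductLevyArea T γ X L) : ∃ H, RoughDriver T γ H X L := by
  obtain ⟨C₁, hC₁, h₁⟩ := exists_holder_bound (lt_trans (by norm_num) hγ) hX
  have hfin := hL.1.ne
  have h₂ : ∀ s t, 0 ≤ s → s < t → t ≤ T → ∀ V : PTensor 2 (filt X s),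
      ‖(L s t V : A)‖ ≤ (holderOp T (2 * γ) X fun s t U => (L s t U : A)).toReal
        * (t - s) ^ (2 * γ) * ‖V‖ := fun s t hs hst ht V =>
    norm_le_of_holderOp_le (L := fun s t U => (L s t U : A)) ENNReal.toReal_nonneg
      (ENNReal.ofReal_toReal hfin).ge (fun s t => by simp) hs hst ht V
  refine ⟨max C₁ (holderOp T (2 * γ) X fun s t U => (L s t U : A)).toReal, hT, hγ,
    le_max_of_le_left hC₁, hXsa, fun s t hs hst ht => ?_, fun s t hs hst ht V => ?_, hL.2⟩
  · exact (h₁ s t hs hst ht).trans (mul_le_mul_of_nonneg_right (le_max_left _ _)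
      (Real.rpow_nonneg (sub_nonneg.2 hst) _))
  · refine (h₂ s t hs hst ht V).trans (mul_le_mul_of_nonneg_right
      (mul_le_mul_of_nonneg_right (le_max_right _ _) (Real.rpow_nonneg (sub_nonneg.2 hst.le) _))
      (norm_nonneg _))

theorem exists_norm_le_of_memC₁ (hX : MemC₁ T γ X) : ∃ R, ∀ s ∈ Icc 0 T, ‖X s‖ ≤ R :=
  isCompact_Icc.exists_bound_of_continuousOn hX.1

end Drivers

/-! ### The value `X_s` inside its own algebra `𝒜_s`. -/

section Filtration

variable {A : Type*} [CStarAlgebra A] {X : ℝ → A}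

instance (X : ℝ → A) (s : ℝ) : CompleteSpace (filt X s) :=
  (StarSubalgebra.isClosed_topologicalClosure _).completeSpace_coe

theorem subIncl_one (S : StarSubalgebra ℂ A) : subIncl S 1 = 1 := rfl

theorem subIncl_mul (S : StarSubalgebra ℂ A) (a b : S) :
    subIncl S (a * b) = subIncl S a * subIncl S b := rfl

theorem subInclLE_one {S S' : StarSubalgebra ℂ A} (h : S ≤ S') : subInclLE h 1 = 1 := rfl

theorem subInclLE_mul {S S' : StarSubalgebra ℂ A} (h : S ≤ S') (a b : S) :
    subInclLE h (a * b) = subInclLE h a * subInclLE h b := rfl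

theorem subIncl_filtElem {s : ℝ} (hs : 0 ≤ s) : subIncl (filt X s) (filtElem X s) = X s :=
  coe_filtElem X hs

theorem subIncl_expI (S : StarSubalgebra ℂ A) [CompleteSpace S] (r : ℝ) (x : S) :
    subIncl S (TestFn.expI r x) = TestFn.expI r (subIncl S x) :=
  map_expI (subIncl S) (subIncl_one S) (subIncl_mul S) r x

/-- The inclusion of `𝒜_s` is isometric and carries the exponentials formed in `𝒜_s` to those formed
in `𝒜`, which are unitary there. -/
theorem hermitian_filtElem {s : ℝ} (hs : 0 ≤ s) (hX : IsSelfAdjoint (X s)) :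
    Hermitian (filtElem X s) := by
  intro r
  have h := subIncl_expI (filt X s) r (filtElem X s)
  rw [subIncl_filtElem hs] at h
  have h2 := hX.hermitian r
  rw [← h] at h2
  exact h2

theorem norm_filtElem {s : ℝ} (hs : 0 ≤ s) : ‖filtElem X s‖ = ‖X s‖ := by
  have h := norm_subIncl (filt X s) (filtElem X s)
  rw [subIncl_filtElem hs] at h
  exact h.symm

theorem norm_sub_subInclLE {S S' : StarSubalgebra ℂ A} (h : S ≤ S') (a : S) (b : S') :
    ‖b - subInclLE h a‖ = ‖(b : A) - a‖ := rfl

theorem norm_filtElem_sub {s t : ℝ} (hs : 0 ≤ s) (hst : s ≤ t) :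
    ‖filtElem X t - subInclLE (filt_mono X hst) (filtElem X s)‖ = ‖X t - X s‖ := by
  rw [norm_sub_subInclLE, coe_filtElem X hs, coe_filtElem X (hs.trans hst)]

end Filtration

/-! ### The integrands `f ⊗ g` and `∂f` satisfy the requirements. -/

section Integrands

/-- `f(x) ⊗ g(x)`. -/
def prodFun {B : Type*} [NormedRing B] [NormedAlgebra ℂ B] (f g : TestFn 3) (x : B) :
    PTensor 2 B := tmul ![f.eval x, g.eval x]

/-- `∂f(x) ⊗ g(x)`. -/
def prodFun₁ {B : Type*} [NormedRing B] [NormedAlgebra ℂ B] (f g : TestFn 3) (x : B) :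
    PTensor 3 B := tensRight (g.eval x) (f.deriv₁ x)

/-- `f(x) ⊗ ∂g(x)`. -/
def prodFun₂ {B : Type*} [NormedRing B] [NormedAlgebra ℂ B] (f g : TestFn 3) (x : B) :
    PTensor 3 B := tensLeft (f.eval x) (g.deriv₁ x)

section TensorMaps

variable {B C : Type*} [NormedRing B] [NormedAlgebra ℂ B] [NormedRing C] [NormedAlgebra ℂ C]

theorem tmap_tensRight (φ : B →L[ℂ] C) (y : B) (V : PTensor 2 B) :
    tmap 3 φ (tensRight y V) = tensRight (φ y) (tmap 2 φ V) := by
  have : (tmap 3 φ).comp (tensRight y) = (tensRight (φ y)).comp (tmap 2 φ) :=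
    ptensor_ext₂ fun a b => by
      rw [ContinuousLinearMap.comp_apply, ContinuousLinearMap.comp_apply, tensRight_tmul,
        tmap_tmul₃, tmap_tmul₂, tensRight_tmul]
  exact DFunLike.congr_fun this V

theorem tmap_tensLeft (φ : B →L[ℂ] C) (y : B) (V : PTensor 2 B) :
    tmap 3 φ (tensLeft y V) = tensLeft (φ y) (tmap 2 φ V) := by
  have : (tmap 3 φ).comp (tensLeft y) = (tensLeft (φ y)).comp (tmap 2 φ) :=
    ptensor_ext₂ fun a b => by
      rw [ContinuousLinearMap.comp_apply, ContinuousLinearMap.comp_apply, tensLeft_tmul,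
        tmap_tmul₃, tmap_tmul₂, tensLeft_tmul]
  exact DFunLike.congr_fun this V

end TensorMaps

section Bounds

variable {B : Type*} [NormedRing B] [NormedAlgebra ℂ B] [CompleteSpace B] {f g : TestFn 3} {a b : ℝ} {x y : B}

theorem norm_prodFun₁_le (ha : 0 ≤ a) (hb : 0 ≤ b) (hf : f.Bounds a x y) (hg : g.Bounds b x y) :
    ‖prodFun₁ f g x‖ ≤ 3 * a * b :=
  (norm_tensRight_le _ _).trans <|
    (mul_le_mul hg.norm_eval hf.norm_deriv₁ (norm_nonneg _) hb).trans (by nlinarith [mul_nonneg ha hb])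

theorem norm_prodFun₂_le (ha : 0 ≤ a) (hb : 0 ≤ b) (hf : f.Bounds a x y) (hg : g.Bounds b x y) :
    ‖prodFun₂ f g x‖ ≤ 3 * a * b :=
  (norm_tensLeft_le _ _).trans <|
    (mul_le_mul hf.norm_eval hg.norm_deriv₁ (norm_nonneg _) ha).trans (by nlinarith [mul_nonneg ha hb])

theorem norm_prodFun₁_sub_le (ha : 0 ≤ a) (hb : 0 ≤ b) (hf : f.Bounds a x y)
    (hf' : f.Bounds a y x) (hg : g.Bounds b x y) :
    ‖prodFun₁ f g y - prodFun₁ f g x‖ ≤ 3 * a * b * ‖y - x‖ := by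
  refine (norm_tensRight_sub_le _ _ _ _).trans ((add_le_add
    (mul_le_mul hg.lip_eval hf'.norm_deriv₁ (norm_nonneg _) (by positivity))
    (mul_le_mul hg.norm_eval hf.lip_deriv₁ (norm_nonneg _) hb)).trans ?_)
  nlinarith [mul_nonneg (mul_nonneg ha hb) (norm_nonneg (y - x))]

theorem norm_prodFun₂_sub_le (ha : 0 ≤ a) (hb : 0 ≤ b) (hf : f.Bounds a x y)
    (hg : g.Bounds b x y) (hg' : g.Bounds b y x) :
    ‖prodFun₂ f g y - prodFun₂ f g x‖ ≤ 3 * a * b * ‖y - x‖ := by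
  refine (norm_tensLeft_sub_le _ _ _ _).trans ((add_le_add
    (mul_le_mul hf.lip_eval hg'.norm_deriv₁ (norm_nonneg _) (by positivity))
    (mul_le_mul hf.norm_eval hg.lip_deriv₁ (norm_nonneg _) ha)).trans ?_)
  nlinarith [mul_nonneg (mul_nonneg ha hb) (norm_nonneg (y - x))]

theorem norm_prodFun_sub_le (ha : 0 ≤ a) (hb : 0 ≤ b) (hf : f.Bounds a x y)
    (hg : g.Bounds b x y) (hg' : g.Bounds b y x) :
    ‖prodFun f g y - prodFun f g x‖ ≤ 3 * a * b * ‖y - x‖ := by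
  refine (norm_tmul₂_sub_le _ _ _ _).trans ((add_le_add
    (mul_le_mul hf.lip_eval hg'.norm_eval (norm_nonneg _) (by positivity))
    (mul_le_mul hf.norm_eval hg.lip_eval (norm_nonneg _) ha)).trans ?_)
  nlinarith [mul_nonneg (mul_nonneg ha hb) (norm_nonneg (y - x))]

/-- The product rule leaves three terms, each at most `a b ‖y - x‖²`. The resulting factor `3` is
adopted in the neighbouring bounds, so that one constant serves for all. -/
theorem norm_prodFun_taylor_le (ha : 0 ≤ a) (hf : f.Bounds a x y)
    (hg : g.Bounds b x y) :
    ‖prodFun f g y - prodFun f g x - sharpLeft (y - x) (prodFun₁ f g x)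
      - sharpRight (y - x) (prodFun₂ f g x)‖ ≤ 3 * a * b * ‖y - x‖ ^ 2 := by
  unfold prodFun prodFun₁ prodFun₂
  rw [sharpLeft_tensRight, sharpRight_tensLeft]
  refine (norm_tmul₂_taylor_le _ _ _ _ _ _).trans ((add_le_add (add_le_add
    (mul_le_mul hf.taylor_eval hg.norm_eval (norm_nonneg _) (by positivity))
    (mul_le_mul hf.norm_eval hg.taylor_eval (norm_nonneg _) ha))
    (mul_le_mul hf.lip_eval hg.lip_eval (norm_nonneg _) (by positivity))).trans_eq ?_)
  ring

end Bounds

variable {A : Type*} [CStarAlgebra A] {T R : ℝ} {X : ℝ → A}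

theorem TestFn.bounds_of_isSelfAdjoint (f : TestFn 3) {x y : A} (hx : IsSelfAdjoint x)
    (hy : IsSelfAdjoint y) (hxR : ‖x‖ ≤ R) (hyR : ‖y‖ ≤ R) : f.Bounds (f.const R) x y :=
  f.bounds hx.hermitian hy.hermitian hxR hyR

theorem expansion_deriv₁ (f : TestFn 3) (R : ℝ) :
    Expansion (A := A) f.deriv₁ f.deriv₂ f.deriv₂ R (f.const R) where
  nonneg := f.const_nonneg R
  norm _ hx hR := (f.bounds_of_isSelfAdjoint hx hx hR hR).norm_deriv₁
  lip _ _ hx hy hxR hyR := (f.bounds_of_isSelfAdjoint hx hy hxR hyR).lip_deriv₁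
  lip₁ _ _ hx hy hxR hyR := (f.bounds_of_isSelfAdjoint hx hy hxR hyR).lip_deriv₂
  lip₂ _ _ hx hy hxR hyR := (f.bounds_of_isSelfAdjoint hx hy hxR hyR).lip_deriv₂
  taylor _ _ hx hy hxR hyR := (f.bounds_of_isSelfAdjoint hx hy hxR hyR).taylor_deriv₁

theorem expansion_prodFun (f g : TestFn 3) (R : ℝ) :
    Expansion (A := A) (prodFun f g) (prodFun₁ f g) (prodFun₂ f g) R
      (3 * f.const R * g.const R) := by
  have ha := f.const_nonneg R
  have hb := g.const_nonneg R
  have hf : ∀ x y : A, IsSelfAdjoint x → IsSelfAdjoint y → ‖x‖ ≤ R → ‖y‖ ≤ R →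
      f.Bounds (f.const R) x y := fun x y => f.bounds_of_isSelfAdjoint
  have hg : ∀ x y : A, IsSelfAdjoint x → IsSelfAdjoint y → ‖x‖ ≤ R → ‖y‖ ≤ R →
      g.Bounds (g.const R) x y := fun x y => g.bounds_of_isSelfAdjoint
  refine ⟨by positivity, fun x hx hxR => ?_, fun x y hx hy hxR hyR => ?_,
    fun x y hx hy hxR hyR => ?_, fun x y hx hy hxR hyR => ?_, fun x y hx hy hxR hyR => ?_⟩
  · refine (norm_tmul₂_le _ _).trans ((mul_le_mul (hf x x hx hx hxR hxR).norm_eval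
      (hg x x hx hx hxR hxR).norm_eval (norm_nonneg _) ha).trans ?_)
    nlinarith [mul_nonneg ha hb]
  · exact norm_prodFun_sub_le ha hb (hf x y hx hy hxR hyR) (hg x y hx hy hxR hyR)
      (hg y x hy hx hyR hxR)
  · exact norm_prodFun₁_sub_le ha hb (hf x y hx hy hxR hyR) (hf y x hy hx hyR hxR)
      (hg x y hx hy hxR hyR)
  · exact norm_prodFun₂_sub_le ha hb (hf x y hx hy hxR hyR) (hg x y hx hy hxR hyR)
      (hg y x hy hx hyR hxR)
  · exact norm_prodFun_taylor_le ha (hf x y hx hy hxR hyR) (hg x y hx hy hxR hyR)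

/-- The adapted values `X_s ∈ 𝒜_s` have the bounds of self-adjoint elements. -/
theorem bounds_filtElem (f : TestFn 3) (hX : ∀ t ∈ Icc 0 T, IsSelfAdjoint (X t))
    (hR : ∀ t ∈ Icc 0 T, ‖X t‖ ≤ R) {s : ℝ} (hs : s ∈ Icc 0 T) :
    f.Bounds (f.const R) (filtElem X s) (filtElem X s) := by
  have h1 := hermitian_filtElem hs.1 (hX s hs)
  have h2 : ‖filtElem X s‖ ≤ R := (norm_filtElem hs.1).trans_le (hR s hs)
  exact f.bounds h1 h1 h2 h2

theorem hermitian_subInclLE_filtElem (hX : ∀ t ∈ Icc 0 T, IsSelfAdjoint (X t)) {s t : ℝ}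
    (hs : 0 ≤ s) (hst : s ≤ t) (ht : t ≤ T) :
    Hermitian (subInclLE (filt_mono X hst) (filtElem X s)) :=
  (hermitian_filtElem hs (hX s ⟨hs, hst.trans ht⟩)).map (subInclLE (filt_mono X hst))
    (subInclLE_one _) (subInclLE_mul _) fun b => (norm_subInclLE (filt_mono X hst) b).le

theorem bounds_subInclLE_filtElem (f : TestFn 3) (hX : ∀ t ∈ Icc 0 T, IsSelfAdjoint (X t))
    (hR : ∀ t ∈ Icc 0 T, ‖X t‖ ≤ R) {s t : ℝ} (hs : 0 ≤ s) (hst : s ≤ t) (ht : t ≤ T) :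
    f.Bounds (f.const R) (subInclLE (filt_mono X hst) (filtElem X s)) (filtElem X t) ∧
    f.Bounds (f.const R) (filtElem X t) (subInclLE (filt_mono X hst) (filtElem X s)) := by
  have ms : s ∈ Icc 0 T := ⟨hs, hst.trans ht⟩
  have mt : t ∈ Icc 0 T := ⟨hs.trans hst, ht⟩
  have h1 := hermitian_filtElem mt.1 (hX t mt)
  have h2 := hermitian_subInclLE_filtElem hX hs hst ht
  have h3 : ‖filtElem X t‖ ≤ R := (norm_filtElem mt.1).trans_le (hR t mt)
  have h4 : ‖subInclLE (filt_mono X hst) (filtElem X s)‖ ≤ R :=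
    (norm_subInclLE (filt_mono X hst) (filtElem X s)).trans_le
      ((norm_filtElem hs).trans_le (hR s ms))
  exact ⟨f.bounds h2 h1 h4 h3, f.bounds h1 h2 h3 h4⟩

/-- The increments of `∂²f(X)` are estimated inside `𝒜_t`, by applying the Lipschitz bound there to
`X_t` and the image of `X_s`; naturality identifies the value at that image with the image of
`∂²f(X_s)`. -/
theorem represents_grad (f : TestFn 3) (hX : ∀ t ∈ Icc 0 T, IsSelfAdjoint (X t))
    (hR : ∀ t ∈ Icc 0 T, ‖X t‖ ≤ R) :
    Represents T X (gradBiprocess X f) (gradTri X f) (gradTri X f) f.deriv₁ f.deriv₂ f.deriv₂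
      (f.const R) := by
  have c2 : ∀ s ∈ Icc 0 T, toAmbient 3 X s (gradTri X f s) = f.deriv₂ (X s) := by
    intro s hs
    have h := f.map_deriv₂ (subIncl (filt X s)) (subIncl_one _) (subIncl_mul _)
      (hermitian_filtElem hs.1 (hX s hs))
    rw [subIncl_filtElem hs.1] at h
    exact h
  have n : ∀ s ∈ Icc 0 T, ‖gradTri X f s‖ ≤ f.const R := fun s hs =>
    (bounds_filtElem f hX hR hs).norm_deriv₂
  have l : ∀ (s t : ℝ) (_ : 0 ≤ s) (hst : s ≤ t) (_ : t ≤ T),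
      ‖gradTri X f t - tmap 3 (subInclLE (filt_mono X hst)) (gradTri X f s)‖ ≤
        f.const R * ‖X t - X s‖ := by
    intro s t hs hst ht
    have h := f.map_deriv₂ (subInclLE (filt_mono X hst)) (subInclLE_one _) (subInclLE_mul _)
      (hermitian_filtElem hs (hX s ⟨hs, hst.trans ht⟩))
    have h2 := (bounds_subInclLE_filtElem f hX hR hs hst ht).1.lip_deriv₂
    rw [norm_filtElem_sub hs hst, ← h] at h2
    exact h2
  refine ⟨fun s hs => ?_, c2, c2, n, n, l, l⟩
  have h := f.map_deriv₁ (subIncl (filt X s)) (subIncl_one _) (subIncl_mul _)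
    (hermitian_filtElem hs.1 (hX s hs))
  rw [subIncl_filtElem hs.1] at h
  exact h

section Naturality

variable {B C : Type*} [NormedRing B] [NormedAlgebra ℂ B] [CompleteSpace B]
  [NormedRing C] [NormedAlgebra ℂ C] [CompleteSpace C] (φ : B →L[ℂ] C)

theorem map_prodFun (f g : TestFn 3) (h1 : φ 1 = 1) (hm : ∀ a b, φ (a * b) = φ a * φ b) {x : B}
    (hx : Hermitian x) : tmap 2 φ (prodFun f g x) = prodFun f g (φ x) := by
  rw [prodFun, tmap_tmul₂, f.map_eval φ h1 hm hx, g.map_eval φ h1 hm hx]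
  rfl

theorem map_prodFun₁ (f g : TestFn 3) (h1 : φ 1 = 1) (hm : ∀ a b, φ (a * b) = φ a * φ b) {x : B}
    (hx : Hermitian x) : tmap 3 φ (prodFun₁ f g x) = prodFun₁ f g (φ x) := by
  rw [prodFun₁, tmap_tensRight, g.map_eval φ h1 hm hx, f.map_deriv₁ φ h1 hm hx]
  rfl

theorem map_prodFun₂ (f g : TestFn 3) (h1 : φ 1 = 1) (hm : ∀ a b, φ (a * b) = φ a * φ b) {x : B}
    (hx : Hermitian x) : tmap 3 φ (prodFun₂ f g x) = prodFun₂ f g (φ x) := by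
  rw [prodFun₂, tmap_tensLeft, f.map_eval φ h1 hm hx, g.map_deriv₁ φ h1 hm hx]
  rfl

end Naturality

theorem represents_prod (f g : TestFn 3) (hX : ∀ t ∈ Icc 0 T, IsSelfAdjoint (X t))
    (hR : ∀ t ∈ Icc 0 T, ‖X t‖ ≤ R) :
    Represents T X (prodBiprocess X f g) (prodTri₁ X f g) (prodTri₂ X f g) (prodFun f g)
      (prodFun₁ f g) (prodFun₂ f g) (3 * f.const R * g.const R) := by
  have ha := f.const_nonneg R
  have hb := g.const_nonneg R
  refine ⟨fun s hs => ?_, fun s hs => ?_, fun s hs => ?_, fun s hs => ?_, fun s hs => ?_,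
    fun s t hs hst ht => ?_, fun s t hs hst ht => ?_⟩
  · have h := map_prodFun (subIncl (filt X s)) f g (subIncl_one _) (subIncl_mul _)
      (hermitian_filtElem hs.1 (hX s hs))
    rw [subIncl_filtElem hs.1] at h
    exact h
  · have h := map_prodFun₁ (subIncl (filt X s)) f g (subIncl_one _) (subIncl_mul _)
      (hermitian_filtElem hs.1 (hX s hs))
    rw [subIncl_filtElem hs.1] at h
    exact h
  · have h := map_prodFun₂ (subIncl (filt X s)) f g (subIncl_one _) (subIncl_mul _)
      (hermitian_filtElem hs.1 (hX s hs))
    rw [subIncl_filtElem hs.1] at h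
    exact h
  · exact norm_prodFun₁_le ha hb (bounds_filtElem f hX hR hs) (bounds_filtElem g hX hR hs)
  · exact norm_prodFun₂_le ha hb (bounds_filtElem f hX hR hs) (bounds_filtElem g hX hR hs)
  · have h := map_prodFun₁ (subInclLE (filt_mono X hst)) f g (subInclLE_one _) (subInclLE_mul _)
      (hermitian_filtElem hs (hX s ⟨hs, hst.trans ht⟩))
    have bf := bounds_subInclLE_filtElem f hX hR hs hst ht
    have bg := bounds_subInclLE_filtElem g hX hR hs hst ht
    have h2 := norm_prodFun₁_sub_le ha hb bf.1 bf.2 bg.1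
    rw [norm_filtElem_sub hs hst, ← h] at h2
    exact h2
  · have h := map_prodFun₂ (subInclLE (filt_mono X hst)) f g (subInclLE_one _) (subInclLE_mul _)
      (hermitian_filtElem hs (hX s ⟨hs, hst.trans ht⟩))
    have bf := bounds_subInclLE_filtElem f hX hR hs hst ht
    have bg := bounds_subInclLE_filtElem g hX hR hs hst ht
    have h2 := norm_prodFun₂_sub_le ha hb bf.1 bg.1 bg.2
    rw [norm_filtElem_sub hs hst, ← h] at h2
    exact h2

theorem smoothIntegral_eq (x : ℝ → A) (f g : TestFn 3) :
    smoothIntegral x f g = pathIntegral x (prodFun f g) := by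
  funext s t
  unfold smoothIntegral pathIntegral prodFun
  simp only [sharp_tmul]

end Integrands

/-! ### Itô's formula. -/

section Ito

variable {A : Type*} [CStarAlgebra A] {T γ H R K : ℝ} {X : ℝ → A} {L : AreaFamily X}
  {D : ℕ → TimePartition T}

/-- The seminorm only sees `s < t`; on the diagonal all members of the space vanish. -/
theorem eq_of_tendstoC₂ {E : Type*} [NormedAddCommGroup E] {h : ℕ → ℝ → ℝ → E} {l : ℝ → ℝ → E}
    {a : E} {s t : ℝ} (hl : TendstoC₂ T γ h l) (hs : 0 ≤ s) (hst : s ≤ t) (ht : t ≤ T)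
    (ha : Tendsto (fun n => h n s t) atTop (𝓝 a)) : l s t = a := by
  refine tendsto_nhds_unique (f := fun n => h n s t) (l := atTop) ?_ ha
  rcases hst.eq_or_lt with rfl | hlt
  · rw [hl.2.1.2.1 s ⟨hs, ht⟩]
    exact tendsto_const_nhds.congr fun n => ((hl.1 n).2.1 s ⟨hs, ht⟩).symm
  · refine tendsto_of_eventually_norm_sub_le ((t - s) ^ γ) fun ε hε => ?_
    filter_upwards [eventually_of_tendsto_holder₂ hl.2.2 hε] with n hn
    exact hn s t hs hlt ht

/-- Itô's formula for a path along whose interpolations the classical integrals converge. -/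
theorem ito_of_tendstoC₂ (hT : 0 < T) (hγ : 0 < γ) (hX : ∀ t ∈ Icc 0 T, IsSelfAdjoint (X t))
    (hR : ∀ t ∈ Icc 0 T, ‖X t‖ ≤ R)
    (hconv₁ : Tendsto (fun n => holder₁ T γ fun t => interp X (D n) t - X t) atTop (𝓝 0))
    (f : TestFn 3) {J : ℝ → ℝ → A}
    (hJ : TendstoC₂ T γ (fun n => smoothGradIntegral (interp X (D n)) f) J) {s t : ℝ}
    (hs : 0 ≤ s) (hst : s ≤ t) (ht : t ≤ T) : f.eval (X t) - f.eval (X s) = J s t := by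
  have hev : ∀ u ∈ Icc 0 T, Tendsto (fun n => f.eval (interp X (D n) u)) atTop
      (𝓝 (f.eval (X u))) := by
    intro u hu
    have h1 := tendsto_iff_norm_sub_tendsto_zero.1 (tendsto_interp hγ hconv₁ hu)
    rw [tendsto_iff_norm_sub_tendsto_zero]
    refine squeeze_zero (fun _ => norm_nonneg _) (fun n => ?_)
      (by simpa using h1.const_mul (f.const R))
    exact (f.bounds_of_isSelfAdjoint (hX u hu) ((plPath_interp (D n) X hX hT).sa u) (hR u hu)
      (norm_interp_le hT (D n) hR hu)).lip_eval
  refine (eq_of_tendstoC₂ hJ hs hst ht ?_).symm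
  refine ((hev t ⟨hs.trans hst, ht⟩).sub (hev s ⟨hs, hst.trans ht⟩)).congr fun n => ?_
  have hx := plPath_interp (D n) X hX hT
  obtain ⟨M, hM⟩ := exists_norm_interp_le (D n) X
  exact (hx.pathIntegral_deriv₁ (f.const_nonneg M)
    (fun a b => f.bounds_of_isSelfAdjoint (hx.sa a) (hx.sa b) (hM a) (hM b))
    (hx.continuous_comp hM (expansion_deriv₁ f M)) s t).symm

end Ito

end RoughNC

end

theorem proposition4p11 {A : Type*} [CStarAlgebra A] {T γ : ℝ} (hT : 0 < T) (hγ : 1 / 3 < γ)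
    (X : ℝ → A) (hXsa : ∀ t ∈ Icc 0 T, IsSelfAdjoint (X t)) (hX : RoughNC.MemC₁ T γ X)
    (D : ℕ → RoughNC.TimePartition T) (hD : Tendsto (fun n => (D n).mesh) atTop (𝓝 0))
    (L : RoughNC.AreaFamily X)
    (hL : RoughNC.holderOp T (2 * γ) X (fun s t U => (L s t U : A)) < ∞)
    (hconv₁ : Tendsto (fun n => RoughNC.holder₁ T γ fun t => RoughNC.interp X (D n) t - X t)
      atTop (𝓝 0))
    (hconv₂ : Tendsto (fun n => RoughNC.holderOp T (2 * γ) X fun s t U =>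
      RoughNC.smoothArea (RoughNC.interp X (D n)) s t (RoughNC.toAmbient 2 X s U) - (L s t U : A))
      atTop (𝓝 0)) :
    RoughNC.IsProductLevyArea T γ X L ∧
    (∀ f g : RoughNC.TestFn 3,
      RoughNC.RoughIntegrable T γ X L (RoughNC.prodBiprocess X f g) (RoughNC.prodTri₁ X f g)
        (RoughNC.prodTri₂ X f g) ∧
      RoughNC.TendstoC₂ T γ (fun n => RoughNC.smoothIntegral (RoughNC.interp X (D n)) f g)
        (RoughNC.roughIntegral T γ X L (RoughNC.prodBiprocess X f g) (RoughNC.prodTri₁ X f g)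
          (RoughNC.prodTri₂ X f g))) ∧
    (∀ f : RoughNC.TestFn 3,
      RoughNC.RoughIntegrable T γ X L (RoughNC.gradBiprocess X f) (RoughNC.gradTri X f)
        (RoughNC.gradTri X f) ∧
      RoughNC.TendstoC₂ T γ (fun n => RoughNC.smoothGradIntegral (RoughNC.interp X (D n)) f)
        (RoughNC.roughIntegral T γ X L (RoughNC.gradBiprocess X f) (RoughNC.gradTri X f)
          (RoughNC.gradTri X f)) ∧
      ∀ s t : ℝ, 0 ≤ s → s ≤ t → t ≤ T →
        f.eval (X t) - f.eval (X s) =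
          RoughNC.roughIntegral T γ X L (RoughNC.gradBiprocess X f) (RoughNC.gradTri X f)
            (RoughNC.gradTri X f) s t) := by
  have hγ0 : 0 < γ := lt_trans (by norm_num) hγ
  have hLevy : RoughNC.IsProductLevyArea T γ X L :=
    ⟨hL, RoughNC.chen_of_tendsto hconv₂ hT hγ0 hXsa hconv₁⟩
  obtain ⟨H, hH⟩ := RoughNC.exists_roughDriver hT hγ hXsa hX hLevy
  obtain ⟨R, hR⟩ := RoughNC.exists_norm_le_of_memC₁ hX
  refine ⟨hLevy, fun f g => ?_, fun f => ?_⟩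
  · have hS : RoughNC.RoughSetting T γ H R _ X L _ _ _ _ _ _ :=
      ⟨hH, hR, RoughNC.expansion_prodFun f g R, RoughNC.represents_prod f g hXsa hR⟩
    refine ⟨hS.roughIntegrable, ?_⟩
    simp only [RoughNC.smoothIntegral_eq]
    exact hS.tendstoC₂ hconv₂ (fun R => ⟨_, RoughNC.expansion_prodFun f g R⟩) hD hconv₁
  · have hS : RoughNC.RoughSetting T γ H R _ X L _ _ _ _ _ _ :=
      ⟨hH, hR, RoughNC.expansion_deriv₁ f R, RoughNC.represents_grad f hXsa hR⟩
    have hlim := hS.tendstoC₂ hconv₂ (fun R => ⟨_, RoughNC.expansion_deriv₁ f R⟩) hD hconv₁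
    exact ⟨hS.roughIntegrable, hlim, fun s t hs hst ht =>
      RoughNC.ito_of_tendstoC₂ hT hγ0 hXsa hR hconv₁ f hlim hs hst ht⟩
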